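/- **Setting.** Write $\lambda$ for the security parameter and let $n,m:\mathbb N\to\mathbb N$ be polynomially bounded with $2^{-n(\lambda)}$ negligible, i.e. $n=\omega(\log\lambda)$. Efficient (QPT) algorithms are polynomial-size families of quantum circuits (with ancillas initialised to $|0\rangle$ and with some qubits traced out at the end). Non-uniform QPT adversaries are polynomial-size circuit families over the gate set $\{H,T,\mathrm{CNOT}\}$ with quantum advice of polynomially many qubits; the keyed algorithms $F$, $\mathsf{Inv}$ may use arbitrary two-qubit gates. **Haar isometries and inverses.** A Haar isometry from $n$ to $n+m$ qubits is $\mathcal I|\psi\rangle=U|\psi\rangle|0^m\rangle$ with $U$ a Haar random unitary on $n+m$ qubits. The inverse of an isometry $\mathcal I$ from $n$ to $n+m$ qubits is the channel $\mathcal I^{-1}(X)=\mathbb E_U\,\mathrm{Tr}_{\mathsf{Aux}}(U^\dagger XU)$, where $\mathsf{Aux}$ denotes the last $m$ qubits and $U$ is a Haar unitary conditioned on $U|\psi\rangle|0^m\rangle=\mathcal I|\psi\rangle$ for all $|\psi\rangle$. **Strong invertible adaptive PRI.** A strong invertible adaptive $(n,n+m)$-pseudorandom isometry is a pair of QPT algorithms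 $F$, $\mathsf{Inv}$ such that * for every $\lambda$ and $k\in\{0,1\}^\lambda$ there is an isometry $\mathcal I_k$ from $n$ to $n+m$ qubits with $F(k,\cdot)=\mathcal I_k(\cdot)\mathcal I_k^\dagger$ and $\mathsf{Inv}(k,\cdot)=\mathcal I_k^{-1}$ as channels; * for every non-uniform QPT distinguisher $\mathcal A$ making polynomially many adaptive oracle queries there is a negligible $\varepsilon$ such that for every $\lambda$ $$\Big|\Pr_{k\leftarrow\{0,1\}^\lambda}\big[\mathcal A^{F(k,\cdot),\mathsf{Inv}(k,\cdot)}=1\big]-\Pr_{\mathcal I\text{ Haar}}\big[\mathcal A^{\mathcal I(\cdot),\mathcal I^{-1}(\cdot)}=1\big]\Big|\le\varepsilon(\lambda).$$ The associated MAC for $n$-qubit messages has a uniformly random key $k\in\{0,1\}^\lambda$, $\mathsf{Sign}(k,\cdot)=F(k,\cdot)$ and $\mathsf{Ver}(k,\cdot)=\mathsf{Inv}(k,\cdot)$. **Theorem.** For every strong invertible adaptive $(n,n+m)$-PRI the associated MAC is uncompute-unforgeable: for every polynomially bounded $q$ and every non-uniform QPT adversary there is a negligible function $\varepsilon$ such that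 for every $\lambda$ the adversary wins the following game with probability at most $\varepsilon(\lambda)$. 1. The challenger samples $k\leftarrow\{0,1\}^\lambda$. 2. The adversary sends pure $n$-qubit states $|\psi_1\rangle,\dots,|\psi_q\rangle$ (possibly chosen at random, with a classical record of the choice) and receives $\mathsf{Sign}(k,|\psi_i\rangle)$ for $i=1,\dots,q$. 3. The adversary outputs a classical description of a measurement-free circuit $C$ over $\{H,T,\mathrm{CNOT}\}$ on $n$ qubits, and an $(n+m)$-qubit tag. 4. The challenger applies $\mathsf{Ver}(k,\cdot)$ to the tag, then $C^\dagger$, and measures all $n$ qubits in the computational basis. The adversary wins if and only if $C|0^n\rangle$ is orthogonal to all of $|\psi_1\rangle,\dots,|\psi_q\rangle$ and the outcome is $0^n$. -/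

import Mathlib

open scoped Matrix ComplexOrder

noncomputable section

namespace PRIMac

/-! ### Asymptotics -/

/-- `f` is bounded by a polynomial in the security parameter. -/
def PolyBounded (f : ℕ → ℕ) : Prop :=
  ∃ p : Polynomial ℕ, ∀ κ, f κ ≤ p.eval κ

/-- `ε` is a negligible function of the security parameter. -/
def Negligible (ε : ℕ → ℝ) : Prop :=
  Asymptotics.SuperpolynomialDecay Filter.atTop (fun κ : ℕ => (κ : ℝ)) ε

/-! ### States, operators and channels on registers of qubits -/

/-- Operators on the Hilbert space of qubits labelled by the wires `W`; the computational basis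
is indexed by the assignments `W → Bool` (`false` is `|0⟩`, `true` is `|1⟩`). -/
abbrev Op (W : Type) := Matrix (W → Bool) (W → Bool) ℂ

/-- Maps (channels) from operators on the wires `A` to operators on the wires `B`. -/
abbrev Chan (A B : Type) := Op A → Op B

/-- Density matrices. -/
def IsDensity {W : Type} [Fintype W] [DecidableEq W] (ρ : Op W) : Prop :=
  ρ.PosSemidef ∧ ρ.trace = 1

/-- Unit vectors, i.e. pure states. -/
def IsPure {W : Type} [Fintype W] [DecidableEq W] (ψ : (W → Bool) → ℂ) : Prop :=
  star ψ ⬝ᵥ ψ = 1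

/-- The operator `|ψ⟩⟨ψ|`. -/
def ketbra {W : Type} (ψ : (W → Bool) → ℂ) : Op W := Matrix.vecMulVec ψ (star ψ)

/-- The channel `ρ ↦ V ρ V†`. -/
def conj {A B : Type} [Fintype A] [DecidableEq A]
    (V : Matrix (B → Bool) (A → Bool) ℂ) : Chan A B :=
  fun ρ => V * ρ * Vᴴ

/-- `V` is an isometry. -/
def IsIsometry {A B : Type} [DecidableEq A] [Fintype B] [DecidableEq B]
    [Fintype A] (V : Matrix (B → Bool) (A → Bool) ℂ) : Prop :=
  Vᴴ * V = 1

/-- The channel `id ⊗ Φ` on a register `W`, where `Φ` acts on the wires selected by `e`. -/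
def applyOn {E W : Type} (e : E ↪ W) (Φ : Chan E E) : Chan W W := fun ρ =>
  Matrix.of fun y y' =>
    Φ (Matrix.of fun x x' => ρ (Function.extend e x y) (Function.extend e x' y')) (y ∘ e) (y' ∘ e)

/-! ### Quantum circuits -/

/-- Elementary gates of the discrete universal gate set `{H, T, CNOT}`. -/
inductive Gate (W : Type) : Type
  | H (w : W) : Gate W
  | T (w : W) : Gate W
  | CNOT (c t : W) (hne : c ≠ t) : Gate W

/-- The unitary matrix of an elementary gate. -/
def Gate.matrix {W : Type} [Fintype W] [DecidableEq W] : Gate W → Op W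
  | .H w => Matrix.of fun x y =>
      if ∀ v, v ≠ w → x v = y v then
        (if x w = true ∧ y w = true then -1 else 1) / (Real.sqrt 2 : ℂ)
      else 0
  | .T w => Matrix.diagonal fun x => if x w then Complex.exp (Complex.I * Real.pi / 4) else 1
  | .CNOT c t _ => Matrix.of fun x y =>
      if x = Function.update y t (xor (y t) (y c)) then 1 else 0

/-- An arbitrary unitary gate on two distinct wires `a`, `b`. -/
structure TwoQubitGate (W : Type) : Type where
  a : W
  b : W
  hne : a ≠ b
  u : Matrix.unitaryGroup (Bool × Bool) ℂ

/-- The unitary matrix of a two-qubit gate. -/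
def TwoQubitGate.matrix {W : Type} [Fintype W] [DecidableEq W] (g : TwoQubitGate W) : Op W :=
  Matrix.of fun x y =>
    if ∀ v, v ≠ g.a → v ≠ g.b → x v = y v then g.u.1 (x g.a, x g.b) (y g.a, y g.b) else 0

/-- A gate set: the gates on every register, with their matrices. -/
structure GateSet where
  G : Type → Type
  matrix : ∀ {W : Type} [Fintype W] [DecidableEq W], G W → Op W

/-- The discrete gate set `{H, T, CNOT}`. -/
def discrete : GateSet := ⟨Gate, Gate.matrix⟩

/-- All two-qubit unitary gates. -/
def twoQubit : GateSet := ⟨TwoQubitGate, TwoQubitGate.matrix⟩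

/-- The unitary implemented by a list of gates; the head of the list is applied first. -/
def circuitMatrix (Γ : GateSet) {W : Type} [Fintype W] [DecidableEq W] : List (Γ.G W) → Op W
  | [] => 1
  | g :: gs => circuitMatrix Γ gs * Γ.matrix g

/-- Generalized quantum circuits with input wires `A` and output wires `B`: besides the input
there are `anc` wires initialised to `|0⟩`; then the gates are applied; and finally all wires
except those that `out` labels by `B` are traced out. -/
structure GenCircuit (Γ : GateSet) (A B : Type) where
  anc : ℕ
  traced : ℕ
  gates : List (Γ.G (A ⊕ Fin anc))
  out : A ⊕ Fin anc ≃ B ⊕ Fin traced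

namespace GenCircuit

variable {Γ : GateSet} {A B : Type} [Fintype A] [DecidableEq A] [Fintype B] [DecidableEq B]

/-- Number of gates plus number of input and output qubits (including the ancillas and the
qubits traced out). -/
def size (C : GenCircuit Γ A B) : ℕ :=
  C.gates.length + (Fintype.card A + C.anc) + (Fintype.card B + C.traced)

/-- The channel implemented by a generalized circuit. -/
def channel (C : GenCircuit Γ A B) : Chan A B := fun ρ =>
  let ρ₀ : Op (A ⊕ Fin C.anc) := Matrix.of fun x x' =>
    if (∀ i, x (Sum.inr i) = false) ∧ (∀ i, x' (Sum.inr i) = false) then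
      ρ (x ∘ Sum.inl) (x' ∘ Sum.inl) else 0
  let U := circuitMatrix Γ C.gates
  let σ := U * ρ₀ * Uᴴ
  Matrix.of fun y y' => ∑ z : Fin C.traced → Bool,
    σ (fun w => Sum.elim y z (C.out w)) (fun w => Sum.elim y' z (C.out w))

/-- A circuit with a classical key `k` on its first input register: the channel
`ρ ↦ C(|k⟩⟨k| ⊗ ρ)`. -/
def keyed {κ : ℕ} (C : GenCircuit Γ (Fin κ ⊕ A) B) (k : Fin κ → Bool) : Chan A B := fun ρ =>
  C.channel (Matrix.of fun x x' =>
    if x ∘ Sum.inl = k ∧ x' ∘ Sum.inl = k then ρ (x ∘ Sum.inr) (x' ∘ Sum.inr) else 0)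

end GenCircuit

/-! ### Classical descriptions of circuits -/

/-- All elementary gates on `n` qubits. -/
def gateList (n : ℕ) : List (Gate (Fin n)) :=
  (List.finRange n).map Gate.H ++ (List.finRange n).map Gate.T ++
    (List.finRange n).flatMap fun c => (List.finRange n).filterMap fun t =>
      if h : c ≠ t then some (Gate.CNOT c t h) else none

/-- The bits of a classical description of a measurement-free circuit on `n` qubits with `s`
steps: one flag for every step and every elementary gate. -/
abbrev DescWires (n s : ℕ) : Type := Fin s × Fin (gateList n).length

/-- The circuit described by a bit string: step by step, the flagged gates are applied. -/
def describedCircuit {n s : ℕ} (b : DescWires n s → Bool) : List (Gate (Fin n)) :=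
  (List.finRange s).flatMap fun j =>
    ((List.finRange (gateList n).length).filter fun i => b (j, i)).map (gateList n).get

/-- The unitary on `n` qubits of the circuit described by a bit string. -/
def describedUnitary {n s : ℕ} (b : DescWires n s → Bool) : Op (Fin n) :=
  circuitMatrix discrete (describedCircuit b)

theorem mem_gateList {n : ℕ} (g : Gate (Fin n)) : g ∈ gateList n := by
  cases g with
  | H w => simp [gateList]
  | T w => simp [gateList]
  | CNOT c t h =>
    simp only [gateList, List.mem_append, List.mem_flatMap, List.mem_filterMap]
    exact Or.inr ⟨c, List.mem_finRange c, t, List.mem_finRange t, by simp [h]⟩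

/-- Every circuit over the elementary gates has a classical description. -/
theorem exists_description {n : ℕ} (gs : List (Gate (Fin n))) :
    ∃ b : DescWires n gs.length → Bool, describedCircuit b = gs := by
  have hg : ∀ j : Fin gs.length, ∃ i : Fin (gateList n).length, (gateList n).get i = gs.get j :=
    fun j => List.mem_iff_get.1 (mem_gateList _)
  choose f hf using hg
  refine ⟨fun p => decide (p.2 = f p.1), ?_⟩
  have h1 : ∀ j : Fin gs.length,
      ((List.finRange (gateList n).length).filter fun i => decide (i = f j)) = [f j] := by
    intro j
    rw [List.filter_eq (l := List.finRange (gateList n).length) (f j), List.count_eq_one_of_mem (List.nodup_finRange _) (List.mem_finRange _)]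
    rfl
  simp only [describedCircuit, h1, List.map_cons, List.map_nil, hf]
  rw [← List.map_eq_flatMap]
  simp

/-! ### Haar measure -/

section Haar

variable {I : Type} [Fintype I] [DecidableEq I]

instance : CompactSpace (Matrix.unitaryGroup I ℂ) := by
  refine isCompact_iff_compactSpace.1
    (?_ : IsCompact (Matrix.unitaryGroup I ℂ : Set (Matrix I I ℂ)))
  have hb : IsCompact (Set.pi Set.univ fun _ : I => Set.pi Set.univ fun _ : I =>
      Metric.closedBall (0 : ℂ) 1) :=
    isCompact_univ_pi fun _ => isCompact_univ_pi fun _ => isCompact_closedBall _ _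
  refine hb.of_isClosed_subset ?_ ?_
  · exact isClosed_unitary (R := Matrix I I ℂ)
  · intro U hU i _ j _
    simpa using entry_norm_bound_of_unitary hU i j

instance : MeasurableSpace (Matrix.unitaryGroup I ℂ) := borel _

instance : BorelSpace (Matrix.unitaryGroup I ℂ) := ⟨rfl⟩

/-- The Haar probability measure of the unitary group. -/
def haarUnitary (I : Type) [Fintype I] [DecidableEq I] :
    MeasureTheory.Measure (Matrix.unitaryGroup I ℂ) :=
  MeasureTheory.Measure.haarMeasure ⊤

end Haar

/-- Unitaries on `n` qubits. -/
abbrev UGroup (n : ℕ) := Matrix.unitaryGroup (Fin n → Bool) ℂ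

/-- The isometry `|ψ⟩ ↦ |ψ⟩|0^m⟩` from `n` to `n + m` qubits. -/
def padZero (n m : ℕ) : Matrix (Fin (n + m) → Bool) (Fin n → Bool) ℂ :=
  Matrix.of fun z x => if z = Fin.append x (fun _ => false) then 1 else 0

/-- Tracing out the last `m` of `n + m` qubits. -/
def traceAux (n m : ℕ) : Chan (Fin (n + m)) (Fin n) := fun X =>
  Matrix.of fun x x' => ∑ a : Fin m → Bool, X (Fin.append x a) (Fin.append x' a)

/-- The subgroup of the unitaries that fix every `|ψ⟩|0^m⟩`. -/
def fixPad (n m : ℕ) : Subgroup (UGroup (n + m)) where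
  carrier := {W | W.1 * padZero n m = padZero n m}
  one_mem' := by simp
  mul_mem' := by
    intro A B hA hB
    simp only [Set.mem_ofPred_eq] at hA hB ⊢
    rw [Submonoid.coe_mul, Matrix.mul_assoc, hB, hA]
  inv_mem' := by
    intro A hA
    simp only [Set.mem_ofPred_eq] at hA ⊢
    have h1 : (A⁻¹).1 * A.1 = 1 := by
      rw [← Submonoid.coe_mul, inv_mul_cancel, Submonoid.coe_one]
    calc (A⁻¹).1 * padZero n m = (A⁻¹).1 * (A.1 * padZero n m) := by rw [hA]
      _ = padZero n m := by rw [← Matrix.mul_assoc, h1, Matrix.one_mul]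

instance (n m : ℕ) : CompactSpace (fixPad n m) := by
  refine isCompact_iff_compactSpace.1 (?_ : IsCompact (fixPad n m : Set (UGroup (n + m))))
  refine IsClosed.isCompact ?_
  exact isClosed_eq (continuous_subtype_val.matrix_mul continuous_const) continuous_const

/-- A unitary `U` is consistent with `V` if `U|ψ⟩|0^m⟩ = V|ψ⟩` for all `|ψ⟩`. -/
def Consistent {n m : ℕ} (V : Matrix (Fin (n + m) → Bool) (Fin n → Bool) ℂ)
    (U : UGroup (n + m)) : Prop :=
  U.1 * padZero n m = V

/-- Every isometry from `n` to `n + m` qubits has a consistent unitary. -/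
theorem exists_consistent {n m : ℕ} (V : Matrix (Fin (n + m) → Bool) (Fin n → Bool) ℂ)
    (hV : IsIsometry V) : ∃ U, Consistent V U := by
  classical
  let pad : (Fin n → Bool) → (Fin (n + m) → Bool) := fun x => Fin.append x fun _ => false
  have hpad : Function.Injective pad := by
    intro x y h
    funext i
    simpa [pad] using congrFun h (Fin.castAdd m i)
  let v : (Fin (n + m) → Bool) → EuclideanSpace ℂ (Fin (n + m) → Bool) := fun z =>
    if h : ∃ x, pad x = z then WithLp.toLp 2 fun w => V w h.choose else 0
  have hv : ∀ x, v (pad x) = WithLp.toLp 2 fun w => V w x := by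
    intro x
    have h : ∃ y, pad y = pad x := ⟨x, rfl⟩
    simp only [v, dif_pos h, hpad h.choose_spec]
  have horth : Orthonormal ℂ ((Set.range pad).domRestrict v) := by
    rw [orthonormal_iff_ite]
    rintro ⟨i, hi⟩ ⟨j, hj⟩
    obtain ⟨x, rfl⟩ := Set.mem_range.1 hi
    obtain ⟨y, rfl⟩ := Set.mem_range.1 hj
    have h := congrFun (congrFun hV x) y
    simp only [Matrix.mul_apply, Matrix.conjTranspose_apply, Matrix.one_apply] at h
    rw [Set.domRestrict_apply, Set.domRestrict_apply]
    simp only [hv, PiLp.inner_apply, Subtype.mk.injEq, hpad.eq_iff]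
    rw [← h]
    exact Finset.sum_congr rfl fun w _ => by simp [mul_comm]
  obtain ⟨b, hb⟩ := horth.exists_orthonormalBasis_extension_of_card_eq (by simp)
  let U : Matrix (Fin (n + m) → Bool) (Fin (n + m) → Bool) ℂ := Matrix.of fun z w => b w z
  have hU : Uᴴ * U = 1 := by
    ext i j
    have h := orthonormal_iff_ite.1 b.orthonormal i j
    simp only [PiLp.inner_apply] at h
    simp only [Matrix.mul_apply, Matrix.conjTranspose_apply, Matrix.one_apply]
    rw [← h]
    exact Finset.sum_congr rfl fun w _ => by simp [U, mul_comm]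
  refine ⟨⟨U, Matrix.mem_unitaryGroup_iff'.2 hU⟩, ?_⟩
  ext z x
  have h := congrArg (fun f => f z) ((hb (pad x) ⟨x, rfl⟩).trans (hv x))
  simpa [Consistent, padZero, Matrix.mul_apply, U, pad] using h

/-- The Haar measure on `n + m` qubit unitaries conditioned on being consistent with the isometry
`V`: the uniform distribution on the coset `U₀ · fixPad` of all consistent unitaries, where `U₀`
is any one of them (by invariance of Haar measure the choice does not matter). -/
def haarConditioned {n m : ℕ} (V : Matrix (Fin (n + m) → Bool) (Fin n → Bool) ℂ) :
    MeasureTheory.Measure (UGroup (n + m)) :=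
  (MeasureTheory.Measure.haarMeasure (⊤ : TopologicalSpace.PositiveCompacts (fixPad n m))).map
    fun W => Classical.epsilon (Consistent V) * W.1

/-- The inverse of an isometry `V` from `n` to `n + m` qubits: the channel
`X ↦ 𝔼_U Tr_Aux(U† X U)`, with `U` a Haar unitary conditioned on being consistent with `V`. -/
def isometryInverse {n m : ℕ} (V : Matrix (Fin (n + m) → Bool) (Fin n → Bool) ℂ) :
    Chan (Fin (n + m)) (Fin n) := fun X =>
  Matrix.of fun x x' => ∫ U, traceAux n m (U.1ᴴ * X * U.1) x x' ∂(haarConditioned V)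

/-! ### Algorithms with oracles -/

/-- Instructions of an algorithm on a workspace of `N` qubits with access to an oracle from `n` to
`n + m` qubits and an oracle from `n + m` to `n` qubits. -/
inductive OracleInstr (N n m : ℕ) : Type
  /-- Apply an elementary gate. -/
  | gate (g : Gate (Fin N)) : OracleInstr N n m
  /-- Query the first oracle with the first `n` of the selected wires as input; its output is
  written on all the selected wires (the last `m` of them are discarded before). -/
  | forward (e : Fin (n + m) ↪ Fin N) : OracleInstr N n m
  /-- Query the second oracle with the selected wires as input; its output is written on the first
  `n` of them, the others are reset to `|0⟩`. -/
  | backward (e : Fin (n + m) ↪ Fin N) : OracleInstr N n m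

/-- The effect of an instruction on the state of the workspace, with the oracles `F` and `G`. -/
def OracleInstr.apply {N n m : ℕ} (F : Chan (Fin n) (Fin (n + m)))
    (G : Chan (Fin (n + m)) (Fin n)) : OracleInstr N n m → Chan (Fin N) (Fin N)
  | .gate g => conj g.matrix
  | .forward e => applyOn e fun X => F (traceAux n m X)
  | .backward e => applyOn e fun X => conj (padZero n m) (G X)

/-- A (non-uniform) oracle distinguisher: a sequence of instructions on `N` qubits that are
initialised to a quantum advice state; a designated qubit is measured at the end. -/
structure Distinguisher (n m : ℕ) where
  N : ℕ
  advice : Op (Fin N)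
  advice_isDensity : IsDensity advice
  program : List (OracleInstr N n m)
  out : Fin N

namespace Distinguisher

variable {n m : ℕ}

/-- Number of qubits plus number of gates and oracle queries. -/
def size (D : Distinguisher n m) : ℕ := D.N + D.program.length

/-- The final state of the workspace. -/
def finalState (D : Distinguisher n m) (F : Chan (Fin n) (Fin (n + m)))
    (G : Chan (Fin (n + m)) (Fin n)) : Op (Fin D.N) :=
  D.program.foldl (fun ρ c => c.apply F G ρ) D.advice

/-- The probability that the distinguisher outputs `1`. -/
def prob (D : Distinguisher n m) (F : Chan (Fin n) (Fin (n + m)))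
    (G : Chan (Fin (n + m)) (Fin n)) : ℝ :=
  ∑ y : Fin D.N → Bool, if y D.out = true then (D.finalState F G y y).re else 0

end Distinguisher

/-! ### Strong invertible adaptive pseudorandom isometries -/

/-- Average over a uniformly random key of `κ` bits. -/
def keyAvg (κ : ℕ) (f : (Fin κ → Bool) → ℝ) : ℝ := (∑ k, f k) / 2 ^ κ

/-- Strong invertible adaptive `(n, n + m)`-pseudorandom isometries. -/
structure StrongInvertiblePRI (n m : ℕ → ℕ) where
  F : ∀ κ, GenCircuit twoQubit (Fin κ ⊕ Fin (n κ)) (Fin (n κ + m κ))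
  Inv : ∀ κ, GenCircuit twoQubit (Fin κ ⊕ Fin (n κ + m κ)) (Fin (n κ))
  F_efficient : PolyBounded fun κ => (F κ).size
  Inv_efficient : PolyBounded fun κ => (Inv κ).size
  /-- `F(k, ·)` is functionally equivalent to an isometry and `Inv(k, ·)` to its inverse. -/
  functional : ∀ κ (k : Fin κ → Bool),
    ∃ V : Matrix (Fin (n κ + m κ) → Bool) (Fin (n κ) → Bool) ℂ, IsIsometry V ∧
      (F κ).keyed k = conj V ∧ (Inv κ).keyed k = isometryInverse V
  /-- No efficient adversary with adaptive access to both oracles can distinguish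
  `F(k, ·), Inv(k, ·)` from a Haar isometry and its inverse. -/
  secure : ∀ D : ∀ κ, Distinguisher (n κ) (m κ), PolyBounded (fun κ => (D κ).size) →
    ∃ ε : ℕ → ℝ, Negligible ε ∧ ∀ κ,
      |keyAvg κ (fun k => (D κ).prob ((F κ).keyed k) ((Inv κ).keyed k)) -
        ∫ U : UGroup (n κ + m κ), (D κ).prob (conj (U.1 * padZero (n κ) (m κ)))
          (isometryInverse (U.1 * padZero (n κ) (m κ))) ∂(haarUnitary (Fin (n κ + m κ) → Bool))|
        ≤ ε κ

/-! ### Message authentication codes for quantum messages -/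

/-- A message authentication code for quantum messages of `n` qubits with pure tags of `s` qubits,
where signing is an isometry for every key; keys are uniformly random strings of `κ` bits. -/
structure QMAC (n s : ℕ → ℕ) where
  Sign : ∀ κ, GenCircuit twoQubit (Fin κ ⊕ Fin (n κ)) (Fin (s κ))
  Ver : ∀ κ, GenCircuit twoQubit (Fin κ ⊕ Fin (s κ)) (Fin (n κ))
  Sign_efficient : PolyBounded fun κ => (Sign κ).size
  Ver_efficient : PolyBounded fun κ => (Ver κ).size
  Sign_isometry : ∀ κ (k : Fin κ → Bool),
    ∃ V : Matrix (Fin (s κ) → Bool) (Fin (n κ) → Bool) ℂ, IsIsometry V ∧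
      (Sign κ).keyed k = conj V

/-- The code with `Sign = F` and `Ver = Inv`. -/
def StrongInvertiblePRI.toQMAC {n m : ℕ → ℕ} (P : StrongInvertiblePRI n m) :
    QMAC n (fun κ => n κ + m κ) where
  Sign := P.F
  Ver := P.Inv
  Sign_efficient := P.F_efficient
  Ver_efficient := P.Inv_efficient
  Sign_isometry := fun κ k =>
    let ⟨V, hV, hF, _⟩ := P.functional κ k
    ⟨V, hV, hF⟩

/-- An adversary (for one value of the security parameter) against messages of `n` qubits, tags of
`s` qubits, that obtains `q` tags.

First stage: with probability `prob r` it produces a classical record `r`, the pure messages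
`msg r 1, …, msg r q`, and a quantum memory in the state `memory r`. Since the adversary is
non-uniform, this joint state of polynomially many qubits may be its quantum advice, so no
condition on its preparation is needed.

Second stage: the circuit `forge` acts on the received tags, the record and the memory, and outputs
a register that is measured, giving the classical description of a circuit, and a tag. -/
structure Forger (n s q : ℕ) where
  recLen : ℕ
  memLen : ℕ
  steps : ℕ
  prob : (Fin recLen → Bool) → ℝ
  prob_nonneg : ∀ r, 0 ≤ prob r
  prob_sum : ∑ r, prob r = 1
  msg : (Fin recLen → Bool) → Fin q → (Fin n → Bool) → ℂ
  msg_isPure : ∀ r i, IsPure (msg r i)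
  memory : (Fin recLen → Bool) → Op (Fin memLen)
  memory_isDensity : ∀ r, IsDensity (memory r)
  forge : GenCircuit discrete ((Fin q × Fin s) ⊕ (Fin recLen ⊕ Fin memLen))
    (DescWires n steps ⊕ Fin s)

namespace Forger

variable {n s q : ℕ}

/-- The size of the adversary. -/
def size (A : Forger n s q) : ℕ := A.forge.size

/-- The state `⨂ᵢ Sign(|ψᵢ⟩⟨ψᵢ|) ⊗ |r⟩⟨r| ⊗ memory` on which the second stage is run, when the
record is `r`. -/
def afterQueries (A : Forger n s q) (sign : Chan (Fin n) (Fin s)) (r : Fin A.recLen → Bool) :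
    Op ((Fin q × Fin s) ⊕ (Fin A.recLen ⊕ Fin A.memLen)) :=
  Matrix.of fun x x' =>
    (∏ i, sign (ketbra (A.msg r i)) (fun j => x (Sum.inl (i, j))) (fun j => x' (Sum.inl (i, j)))) *
      (if (fun j => x (Sum.inr (Sum.inl j))) = r ∧ (fun j => x' (Sum.inr (Sum.inl j))) = r
        then 1 else 0) *
      A.memory r (fun j => x (Sum.inr (Sum.inr j))) (fun j => x' (Sum.inr (Sum.inr j)))

/-- The unnormalised state of the forged tag when the record is `r` and the measured description is
`b`; its trace is the probability of `b` given `r`. -/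
def forgedTag (A : Forger n s q) (sign : Chan (Fin n) (Fin s)) (r : Fin A.recLen → Bool)
    (b : DescWires n A.steps → Bool) : Op (Fin s) :=
  Matrix.of fun y y' => A.forge.channel (A.afterQueries sign r) (Sum.elim b y) (Sum.elim b y')

/-- The forgery is fresh: `C|0^n⟩` is orthogonal to all the queried messages, where `C` is the
circuit described by `b`. -/
def Fresh (A : Forger n s q) (r : Fin A.recLen → Bool) (b : DescWires n A.steps → Bool) : Prop :=
  ∀ i, star (A.msg r i) ⬝ᵥ (fun x => describedUnitary b x (fun _ => false)) = 0

open Classical in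
/-- The probability that the adversary wins, for a fixed key, i.e. for fixed signing and
verification channels: the forgery is fresh, and when `C†` is applied to the output of the
verification and all qubits are measured, the outcome is `0^n`. -/
def winProb (A : Forger n s q) (sign : Chan (Fin n) (Fin s)) (ver : Chan (Fin s) (Fin n)) : ℝ :=
  ∑ r, A.prob r * ∑ b, if A.Fresh r b then
    (((describedUnitary b)ᴴ * ver (A.forgedTag sign r b) * describedUnitary b)
      (fun _ => false) (fun _ => false)).re else 0

end Forger

/-- Uncompute-unforgeability. -/
def QMAC.UncomputeUnforgeable {n s : ℕ → ℕ} (M : QMAC n s) : Prop :=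
  ∀ q : ℕ → ℕ, PolyBounded q →
    ∀ A : ∀ κ, Forger (n κ) (s κ) (q κ), PolyBounded (fun κ => (A κ).size) →
      ∃ ε : ℕ → ℝ, Negligible ε ∧ ∀ κ,
        keyAvg κ (fun k => (A κ).winProb ((M.Sign κ).keyed k) ((M.Ver κ).keyed k)) ≤ ε κ

end PRIMac

end

open scoped Matrix ComplexOrder

noncomputable section

namespace PRIMac

set_option linter.unusedSectionVars false

section

open MeasureTheory Matrix

/-! ### Invariance of Haar measure on compact groups -/

/-! A reduction to pseudorandomness must decide whether a forgery is fresh, and orthogonality of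
C|0^n⟩ to the signed messages cannot be read off efficiently from a description of C. The way out is
a quantum test supplied as advice. Averaging fixes the best classical record r of the forger
(`exists_forgeProb_le`), so the messages are fixed; let S be their span, s ≤ q its dimension, E an
isometry onto S, and σ = EE†/s. The distinguisher holds T = t·s copies of σ, runs the forger, sends
the tag through the inverse oracle, applies C† to the result and to every copy, and accepts iff the
verified message reads 0^n and no copy does. With φ_b = C_b|0^n⟩ for the circuit C_b described by b,
it accepts with probability Σ_b ⟨φ_b|Ver(tag_b)|φ_b⟩ (1 - ⟨φ_b|σ|φ_b⟩)^T (`prob_reduction`). Fresh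
forgeries pass all tests with certainty, so for every key this dominates the winning probability at
record r (`winProbOf_le_prob`).

For a Haar isometry V the acceptance probability is at most 2/t + (2q+3)·2^{-n}
(`integral_prob_reduction_le`), for three reasons. (1) Off the range of V the averaged inverse
produces noise that favours no direction, so ⟨φ|V⁻¹(X)|φ⟩ ≤ ⟨Vφ|X|Vφ⟩ + 2^{-n} tr X
(`re_qform_isometryInverse_le`). (2) Split φ into its projection onto S and a remainder u. The
projection is suppressed by the tests, because (1-x)^T·T·x ≤ 1 bounds its squared norm times the
passing probability by 1/t (`exists_testState`). (3) The tags depend on V restricted to S only, and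
given this all directions of the orthogonal complement of S are equivalent, so the tag overlaps with
Vu by at most (q+1)·2^{-n} on average (`integral_qform_orthogonal_le`). Neither (1) nor (3) computes
a Haar integral: a unitary exchanging two orthonormal vectors is absorbed by right invariance, so
many equal terms share a total bounded by a trace.

Pseudorandomness therefore bounds the forging probability by ε_t + 2/t + (2q+3)·2^{-n} for every
positive polynomially bounded t. The negligible ε_t depends on t, but each inverse polynomial needs
only one t (`negligible_of_forall_le`).

The rest of the work is to carry out the test over {H, T, CNOT}: the bits of the description control
the inverses of the gates they flag, and a reversible classical circuit evaluates the acceptance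
condition. -/

theorem isMulRightInvariant_of_isProbabilityMeasure {G : Type*} [TopologicalSpace G] [Group G]
    [IsTopologicalGroup G] [MeasurableSpace G] [BorelSpace G] [CompactSpace G]
    (μ : Measure G) [μ.IsHaarMeasure] [IsProbabilityMeasure μ] : μ.IsMulRightInvariant := by
  refine ⟨fun g => ?_⟩
  have hm : Measurable fun x : G => x * g := (continuous_mul_const g).measurable
  have : IsProbabilityMeasure (μ.map fun x => x * g) := Measure.isProbabilityMeasure_map hm.aemeasurable
  -- Left and right translations commute, so the right translate of `μ` is again left invariant. By
  -- uniqueness it is a multiple of `μ`, and total mass one forces the factor to be one.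
  have hl : (μ.map fun x => x * g).IsMulLeftInvariant := by
    refine ⟨fun h => ?_⟩
    rw [Measure.map_map (measurable_const_mul h) hm]
    have : ((fun x : G => h * x) ∘ fun x => x * g) = (fun x => x * g) ∘ fun x => h * x := by
      funext x; simp [mul_assoc]
    rw [this, ← Measure.map_map hm (measurable_const_mul h), map_mul_left_eq_self]
  have h := Measure.isMulInvariant_eq_smul_of_compactSpace (μ.map fun x => x * g) μ
  have h1 := congrArg (fun ν : Measure G => ν Set.univ) h
  simp only [measure_univ, Measure.smul_apply] at h1
  have h2 : (μ.map fun x => x * g).haarScalarFactor μ = 1 := by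
    simpa [ENNReal.smul_def] using h1.symm
  rw [h, h2, one_smul]

instance {G : Type*} [TopologicalSpace G] [Group G] [IsTopologicalGroup G] [MeasurableSpace G]
    [BorelSpace G] [CompactSpace G] :
    IsProbabilityMeasure (Measure.haarMeasure (⊤ : TopologicalSpace.PositiveCompacts G)) :=
  ⟨by simpa using Measure.haarMeasure_self (G := G) (K₀ := ⊤)⟩

instance {G : Type*} [TopologicalSpace G] [Group G] [IsTopologicalGroup G] [MeasurableSpace G]
    [BorelSpace G] [CompactSpace G] :
    (Measure.haarMeasure (⊤ : TopologicalSpace.PositiveCompacts G)).IsMulRightInvariant :=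
  isMulRightInvariant_of_isProbabilityMeasure _

instance (I : Type) [Fintype I] [DecidableEq I] : IsProbabilityMeasure (haarUnitary I) := by
  unfold haarUnitary; infer_instance

instance (I : Type) [Fintype I] [DecidableEq I] : (haarUnitary I).IsMulRightInvariant := by
  unfold haarUnitary; infer_instance

/-- A continuous function on a compact space is bounded. The averages below over a unitary group or
a closed subgroup of one get their integrability from this. -/
theorem integrable_of_continuous {G E : Type*} [TopologicalSpace G] [CompactSpace G]
    [MeasurableSpace G] [BorelSpace G] [NormedAddCommGroup E] [SecondCountableTopology E]
    {μ : Measure G}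
    [IsFiniteMeasure μ] {f : G → E} (hf : Continuous f) : Integrable f μ := by
  let _ : MeasurableSpace E := borel E
  have : BorelSpace E := ⟨rfl⟩
  obtain ⟨C, hC⟩ := (isCompact_range hf).isBounded.exists_norm_le
  refine Integrable.of_bound hf.measurable.aestronglyMeasurable C
    (Filter.Eventually.of_forall fun x => hC _ ⟨x, rfl⟩)

/-! ### Quadratic forms and swaps of orthonormal vectors -/

section LinAlg

variable {I J : Type*} [Fintype I] [Fintype J]

/-- The quadratic form `⟨φ|X|φ⟩`. -/
def qform (φ : I → ℂ) (X : Matrix I I ℂ) : ℂ := star φ ⬝ᵥ X *ᵥ φ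

theorem qform_conj (A : Matrix J I ℂ) (φ : I → ℂ) (X : Matrix J J ℂ) :
    qform φ (Aᴴ * X * A) = qform (A *ᵥ φ) X := by
  simp only [qform, star_mulVec, ← mulVec_mulVec, dotProduct_mulVec, vecMul_vecMul]

theorem qform_sum {K : Type*} (s : Finset K) (φ : I → ℂ) (X : K → Matrix I I ℂ) :
    qform φ (∑ k ∈ s, X k) = ∑ k ∈ s, qform φ (X k) := by
  simp [qform, sum_mulVec, dotProduct_sum]

theorem qform_eq_sum (φ : I → ℂ) (X : Matrix I I ℂ) :
    qform φ X = ∑ x, ∑ x', star (φ x) * φ x' * X x x' := by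
  simp only [qform, dotProduct, mulVec, Finset.mul_sum, Pi.star_apply]
  exact Finset.sum_congr rfl fun x _ => Finset.sum_congr rfl fun y _ => by ring

theorem qform_nonneg {X : Matrix I I ℂ} (hX : X.PosSemidef) (φ : I → ℂ) : 0 ≤ (qform φ X).re :=
  (Complex.le_def.1 (hX.dotProduct_mulVec_nonneg φ)).1

theorem continuous_qform (X : Matrix I I ℂ) : Continuous fun φ : I → ℂ => qform φ X := by
  unfold qform; fun_prop

variable [DecidableEq I]

theorem qform_single (x : I) (X : Matrix I I ℂ) : qform (Pi.single x 1) X = X x x := by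
  simp [qform]

theorem sum_qform_mulVec_single (A : Matrix J I ℂ) (X : Matrix J J ℂ) :
    ∑ x, qform (A *ᵥ Pi.single x 1) X = (X * (A * Aᴴ)).trace := by
  rw [← Matrix.mul_assoc, trace_mul_comm, ← Matrix.mul_assoc]
  exact Finset.sum_congr rfl fun x _ => by rw [← qform_conj, qform_single, diag_apply]

/-- The unitary that exchanges the orthonormal vectors `u` and `v`. -/
def swapMat (u v : I → ℂ) : Matrix I I ℂ := 1 - vecMulVec (u - v) (star (u - v))

variable {u v : I → ℂ}

theorem swapMat_mulVec (u v x : I → ℂ) :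
    swapMat u v *ᵥ x = x - (star u ⬝ᵥ x - star v ⬝ᵥ x) • (u - v) := by
  ext i
  simp [swapMat, sub_mulVec, vecMulVec_mulVec, sub_dotProduct]
  ring

theorem swapMat_mulVec_left (hu : star u ⬝ᵥ u = 1) (huv : star v ⬝ᵥ u = 0) :
    swapMat u v *ᵥ u = v := by
  simp [swapMat_mulVec, hu, huv]

/-- Since `u - v` has squared norm 2, `swapMat u v` is the Householder reflection along `u - v`. -/
theorem swapMat_mem (hu : star u ⬝ᵥ u = 1) (hv : star v ⬝ᵥ v = 1) (huv : star u ⬝ᵥ v = 0) :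
    swapMat u v ∈ unitaryGroup I ℂ := by
  have hvu : star v ⬝ᵥ u = 0 := by
    rw [star_dotProduct, huv, star_zero]
  have hs : (swapMat u v)ᴴ = swapMat u v := by
    ext i j
    simp [swapMat, vecMulVec_apply, Matrix.one_apply, eq_comm (a := i), mul_comm]
  rw [mem_unitaryGroup_iff', star_eq_conjTranspose, hs]
  have h2 : star (u - v) ⬝ᵥ (u - v) = 2 := by
    simp [sub_dotProduct, hu, hv, huv, hvu]; norm_num
  simp only [swapMat, sub_mul, mul_sub, Matrix.one_mul, Matrix.mul_one, vecMulVec_mul_vecMulVec, h2]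
  ext i j
  simp [vecMulVec_apply]
  ring

end LinAlg

end

section

open MeasureTheory Matrix

/-! ### The inverse of an isometry -/

/-- The isometry `|ψ⟩ ↦ |ψ⟩|a⟩` from `n` to `n + m` qubits. -/
def padWith (n m : ℕ) (a : Fin m → Bool) : Matrix (Fin (n + m) → Bool) (Fin n → Bool) ℂ :=
  Matrix.of fun z x => if z = Fin.append x a then 1 else 0

theorem padWith_zero (n m : ℕ) : padWith n m (fun _ => false) = padZero n m := rfl

theorem append_inj {n m : ℕ} {x x' : Fin n → Bool} {a a' : Fin m → Bool} :
    Fin.append x a = Fin.append x' a' ↔ x = x' ∧ a = a' := by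
  simpa [Fin.appendEquiv] using
    (Fin.appendEquiv n m).injective.eq_iff (a := (x, a)) (b := (x', a'))

theorem padWith_conjTranspose_mul (n m : ℕ) (a b : Fin m → Bool) :
    (padWith n m a)ᴴ * padWith n m b = if a = b then 1 else 0 := by
  ext x y
  simp only [padWith, mul_apply, conjTranspose_apply, of_apply]
  rw [Finset.sum_eq_single (Fin.append x a) (by intros; simp_all) (by simp)]
  by_cases h : a = b <;> simp [append_inj, h, one_apply]

theorem padWith_isometry (n m : ℕ) (a : Fin m → Bool) :
    (padWith n m a)ᴴ * padWith n m a = 1 := by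
  simp [padWith_conjTranspose_mul]

theorem conj_padWith_apply {n m : ℕ} (a : Fin m → Bool) (Z : Op (Fin (n + m)))
    (x x' : Fin n → Bool) : ((padWith n m a)ᴴ * Z * padWith n m a) x x' =
      Z (Fin.append x a) (Fin.append x' a) := by
  simp [mul_apply, padWith]

theorem traceAux_eq_sum {n m : ℕ} (Z : Op (Fin (n + m))) :
    traceAux n m Z = ∑ a, (padWith n m a)ᴴ * Z * padWith n m a := by
  ext x x'
  simp [traceAux, Matrix.sum_apply, conj_padWith_apply]

theorem sum_padWith_mul (n m : ℕ) : ∑ a, padWith n m a * (padWith n m a)ᴴ = 1 := by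
  ext z z'
  obtain ⟨⟨x, a⟩, rfl⟩ := (Fin.appendEquiv n m).surjective z
  obtain ⟨⟨x', a'⟩, rfl⟩ := (Fin.appendEquiv n m).surjective z'
  simp only [Matrix.sum_apply, mul_apply, padWith, conjTranspose_apply, of_apply, Fin.appendEquiv,
    Equiv.coe_fn_mk, append_inj, one_apply]
  rw [Finset.sum_eq_single a (by intros; simp_all [eq_comm]) (by simp)]
  rw [Finset.sum_eq_single x (by intros; simp_all [eq_comm]) (by simp)]
  simp [eq_comm]

variable {n m : ℕ}

theorem fixPad_mul (W : fixPad n m) : W.1.1 * padZero n m = padZero n m := W.2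

theorem continuous_fixPad_coe : Continuous fun W : fixPad n m => (W.1.1 : Op (Fin (n + m))) :=
  continuous_subtype_val.comp continuous_subtype_val

theorem unitary_conjTranspose_mul {I : Type*} [Fintype I] [DecidableEq I]
    (U : unitaryGroup I ℂ) : U.1ᴴ * U.1 = 1 := by
  have := U.2
  rwa [mem_unitaryGroup_iff', star_eq_conjTranspose] at this

theorem unitary_mul_conjTranspose {I : Type*} [Fintype I] [DecidableEq I]
    (U : unitaryGroup I ℂ) : U.1 * U.1ᴴ = 1 := by
  have := U.2
  rwa [mem_unitaryGroup_iff, star_eq_conjTranspose] at this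

/-- The Haar probability measure of `fixPad`. -/
abbrev haarFixPad (n m : ℕ) : Measure (fixPad n m) :=
  Measure.haarMeasure (⊤ : TopologicalSpace.PositiveCompacts (fixPad n m))

theorem continuous_traceAux (n m : ℕ) : Continuous (traceAux n m) := by
  have : traceAux n m = fun Z => ∑ a, (padWith n m a)ᴴ * Z * padWith n m a :=
    funext traceAux_eq_sum
  rw [this]; fun_prop

/-- The conditioned measure is a pushforward of Haar measure on `fixPad`. Pulled back to this
subgroup, the average can be treated by right invariance. -/
theorem isometryInverse_apply (V : Matrix (Fin (n + m) → Bool) (Fin n → Bool) ℂ)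
    (X : Op (Fin (n + m))) (x x' : Fin n → Bool) :
    isometryInverse V X x x' = ∫ W : fixPad n m,
      traceAux n m ((Classical.epsilon (Consistent V) * W.1).1ᴴ * X *
        (Classical.epsilon (Consistent V) * W.1).1) x x' ∂haarFixPad n m := by
  have hc : Continuous fun W : fixPad n m => Classical.epsilon (Consistent V) * W.1 :=
    continuous_const.mul continuous_subtype_val
  have hg : Continuous fun U : UGroup (n + m) => traceAux n m (U.1ᴴ * X * U.1) x x' := by
    have h1 : Continuous fun U : UGroup (n + m) => (U.1 : Op (Fin (n + m))) :=
      continuous_subtype_val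
    exact (((continuous_traceAux n m).comp
      ((h1.matrix_conjTranspose.matrix_mul continuous_const).matrix_mul h1)).matrix_elem x x')
  simp only [isometryInverse, of_apply, haarConditioned]
  rw [integral_map hc.measurable.aemeasurable]
  exact hg.measurable.aestronglyMeasurable

theorem continuous_conj_fixPad (U : UGroup (n + m)) (X : Op (Fin (n + m))) :
    Continuous fun W : fixPad n m => (U * W.1).1ᴴ * X * (U * W.1).1 := by
  have h : Continuous fun W : fixPad n m => (U * W.1).1 :=
    continuous_subtype_val.comp (continuous_const.mul continuous_subtype_val)
  exact (h.matrix_conjTranspose.matrix_mul continuous_const).matrix_mul h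

theorem integrable_isometryInverse (U : UGroup (n + m)) (X : Op (Fin (n + m)))
    (x x' : Fin n → Bool) : Integrable (fun W : fixPad n m =>
      traceAux n m ((U * W.1).1ᴴ * X * (U * W.1).1) x x') (haarFixPad n m) :=
  integrable_of_continuous
    (((continuous_traceAux n m).comp (continuous_conj_fixPad U X)).matrix_elem x x')

theorem traceAux_add (X Y : Op (Fin (n + m))) :
    traceAux n m (X + Y) = traceAux n m X + traceAux n m Y := by
  simp [traceAux_eq_sum, Matrix.mul_add, Matrix.add_mul, Finset.sum_add_distrib]

theorem traceAux_smul (c : ℂ) (X : Op (Fin (n + m))) :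
    traceAux n m (c • X) = c • traceAux n m X := by
  simp [traceAux_eq_sum, Finset.smul_sum]

/-- The inverse of an isometry as a linear map. -/
def isometryInverseLin (V : Matrix (Fin (n + m) → Bool) (Fin n → Bool) ℂ) :
    Op (Fin (n + m)) →ₗ[ℂ] Op (Fin n) where
  toFun := isometryInverse V
  map_add' X Y := by
    ext x x'
    simp only [isometryInverse_apply, Matrix.add_apply, Matrix.mul_add, Matrix.add_mul, traceAux_add]
    exact integral_add (integrable_isometryInverse _ _ _ _) (integrable_isometryInverse _ _ _ _)
  map_smul' c X := by
    ext x x'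
    simp only [isometryInverse_apply, Matrix.smul_apply, Matrix.mul_smul, Matrix.smul_mul,
      traceAux_smul, RingHom.id_apply]
    exact integral_smul _ _

/-- Expanding the partial trace separates the part `a = 0`, on which `W` acts trivially, from the
parts `a ≠ 0`, which the average over `W` scrambles. -/
theorem re_qform_isometryInverse (V : Matrix (Fin (n + m) → Bool) (Fin n → Bool) ℂ)
    (X : Op (Fin (n + m))) (φ : (Fin n → Bool) → ℂ) :
    (qform φ (isometryInverse V X)).re = ∑ a, ∫ W : fixPad n m,
      (qform (W.1.1 *ᵥ padWith n m a *ᵥ φ)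
        ((Classical.epsilon (Consistent V)).1ᴴ * X * (Classical.epsilon (Consistent V)).1)).re
          ∂haarFixPad n m := by
  set U := Classical.epsilon (Consistent V)
  have hq : ∀ W : fixPad n m, qform φ (traceAux n m ((U * W.1).1ᴴ * X * (U * W.1).1)) =
      ∑ a, qform (W.1.1 *ᵥ padWith n m a *ᵥ φ) (U.1ᴴ * X * U.1) := by
    intro W
    rw [traceAux_eq_sum, qform_sum]
    refine Finset.sum_congr rfl fun a _ => ?_
    rw [qform_conj, qform_conj, qform_conj]
    simp [mulVec_mulVec, Matrix.mul_assoc]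
  have hc : ∀ a, Continuous fun W : fixPad n m =>
      qform (W.1.1 *ᵥ padWith n m a *ᵥ φ) (U.1ᴴ * X * U.1) := fun a =>
    (continuous_qform _).comp (continuous_fixPad_coe.matrix_mulVec continuous_const)
  have h1 : qform φ (isometryInverse V X) = ∫ W : fixPad n m,
      qform φ (traceAux n m ((U * W.1).1ᴴ * X * (U * W.1).1)) ∂haarFixPad n m := by
    simp only [qform_eq_sum, isometryInverse_apply]
    rw [integral_finsetSum _ fun x _ => integrable_finsetSum _ fun x' _ =>
      (integrable_isometryInverse U X x x').const_mul _]
    refine Finset.sum_congr rfl fun x _ => ?_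
    rw [integral_finsetSum _ fun x' _ => (integrable_isometryInverse U X x x').const_mul _]
    exact Finset.sum_congr rfl fun x' _ => (integral_const_mul _ _).symm
  rw [h1, ← RCLike.re_eq_complex_re, ← integral_re]
  · simp only [hq, map_sum, RCLike.re_eq_complex_re]
    exact integral_finsetSum _ fun a _ =>
      integrable_of_continuous (Complex.continuous_re.comp (hc a))
  · simp only [hq]
    exact integrable_finsetSum _ fun a _ => integrable_of_continuous (hc a)

theorem re_qform_isometryInverse_nonneg (V : Matrix (Fin (n + m) → Bool) (Fin n → Bool) ℂ)
    {X : Op (Fin (n + m))} (hX : X.PosSemidef) (φ : (Fin n → Bool) → ℂ) :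
    0 ≤ (qform φ (isometryInverse V X)).re := by
  rw [re_qform_isometryInverse]
  exact Finset.sum_nonneg fun a _ => integral_nonneg fun W =>
    qform_nonneg (hX.conjTranspose_mul_mul_same _) _

/-- Haar averages over `fixPad` do not distinguish orthonormal vectors that are orthogonal to all
`|ψ⟩|0^m⟩`. -/
theorem integral_fixPad_swap (f : ((Fin (n + m) → Bool) → ℂ) → ℝ)
    {u v : (Fin (n + m) → Bool) → ℂ} (hu : star u ⬝ᵥ u = 1) (hv : star v ⬝ᵥ v = 1)
    (huv : star u ⬝ᵥ v = 0) (hu0 : star u ᵥ* padZero n m = 0) (hv0 : star v ᵥ* padZero n m = 0) :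
    ∫ W : fixPad n m, f (W.1.1 *ᵥ u) ∂haarFixPad n m =
      ∫ W : fixPad n m, f (W.1.1 *ᵥ v) ∂haarFixPad n m := by
  -- Both vectors are orthogonal to the padded vectors, so their swap fixes the latter and belongs
  -- to `fixPad`. Right translation by it turns one integral into the other.
  have hS : swapMat u v * padZero n m = padZero n m := by
    rw [swapMat, Matrix.sub_mul, vecMulVec_mul, star_sub, sub_vecMul, hu0, hv0]
    ext
    simp [vecMulVec_apply]
  let S : fixPad n m := ⟨⟨swapMat u v, swapMat_mem hu hv huv⟩, hS⟩
  have hvu : star v ⬝ᵥ u = 0 := by rw [star_dotProduct, huv, star_zero]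
  rw [← integral_mul_right_eq_self (fun W : fixPad n m => f (W.1.1 *ᵥ v)) S]
  refine integral_congr_ae (Filter.Eventually.of_forall fun W => ?_)
  have h2 : swapMat u v *ᵥ v = u := by
    rw [swapMat_mulVec, huv, hv]
    simp
  change f (W.1.1 *ᵥ u) = f ((W.1.1 * swapMat u v) *ᵥ v)
  rw [← mulVec_mulVec, h2]

theorem mulVec_dotProduct_of_isometry {I J : Type*} [Fintype I] [Fintype J] [DecidableEq I]
    {A : Matrix J I ℂ}
    (hA : Aᴴ * A = 1) (u v : I → ℂ) : star (A *ᵥ u) ⬝ᵥ (A *ᵥ v) = star u ⬝ᵥ v := by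
  rw [star_mulVec, dotProduct_mulVec, vecMul_vecMul, hA, vecMul_one]

/-- The term `a = 0` gives the main term exactly. For `a ≠ 0` the average is the same for all `2 ^
n` columns of the unitary `C`. Summed over every `a` and every column the forms give `X.trace`, so
one column carries at most a fraction `2 ^ (-n)` of it. -/
theorem re_qform_isometryInverse_le {V : Matrix (Fin (n + m) → Bool) (Fin n → Bool) ℂ}
    (hV : IsIsometry V) {X : Op (Fin (n + m))} (hX : X.PosSemidef) {C : Op (Fin n)}
    (hC : Cᴴ * C = 1) (x₀ : Fin n → Bool) :
    (qform (C *ᵥ Pi.single x₀ 1) (isometryInverse V X)).re ≤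
      (qform (C *ᵥ Pi.single x₀ 1) (Vᴴ * X * V)).re + (2 : ℝ)⁻¹ ^ n * X.trace.re := by
  rw [re_qform_isometryInverse]
  have hU : (Classical.epsilon (Consistent V)).1 * padZero n m = V :=
    Classical.epsilon_spec (exists_consistent V hV)
  set U := Classical.epsilon (Consistent V)
  set Y := U.1ᴴ * X * U.1 with hY
  have hYp : Y.PosSemidef := hX.conjTranspose_mul_mul_same _
  rw [← Finset.add_sum_erase _ _ (Finset.mem_univ fun _ : Fin m => false)]
  have hC' : C * Cᴴ = 1 := mul_eq_one_comm.1 hC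
  have hcont : ∀ a φ, Continuous fun W : fixPad n m =>
      (qform (W.1.1 *ᵥ padWith n m a *ᵥ φ) Y).re := fun a φ => Complex.continuous_re.comp
    ((continuous_qform _).comp (continuous_fixPad_coe.matrix_mulVec continuous_const))
  refine add_le_add ?_ ?_
  · have : ∀ W : fixPad n m, (qform (W.1.1 *ᵥ padWith n m (fun _ => false) *ᵥ C *ᵥ
        Pi.single x₀ 1) Y).re = (qform (C *ᵥ Pi.single x₀ 1) (Vᴴ * X * V)).re := by
      intro W
      rw [padWith_zero, mulVec_mulVec, fixPad_mul, hY, qform_conj, qform_conj, mulVec_mulVec, hU]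
    simp only [this, integral_const, probReal_univ, one_smul, le_refl]
  · have hswap : ∀ a ∈ Finset.univ.erase (fun _ : Fin m => false), ∀ x,
        ∫ W : fixPad n m, (qform (W.1.1 *ᵥ padWith n m a *ᵥ C *ᵥ Pi.single x₀ 1) Y).re
          ∂haarFixPad n m =
        ∫ W : fixPad n m, (qform (W.1.1 *ᵥ padWith n m a *ᵥ C *ᵥ Pi.single x 1) Y).re
          ∂haarFixPad n m := by
      intro a ha x
      by_cases hx : x = x₀
      · rw [hx]
      have h0 : ∀ φ, star (padWith n m a *ᵥ φ) ᵥ* padZero n m = 0 := by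
        intro φ
        rw [star_mulVec, vecMul_vecMul, ← padWith_zero, padWith_conjTranspose_mul,
          if_neg (Finset.ne_of_mem_erase ha), vecMul_zero]
      refine integral_fixPad_swap (fun w => (qform w Y).re) ?_ ?_ ?_ (h0 _) (h0 _)
      · rw [mulVec_dotProduct_of_isometry (padWith_isometry n m a),
          mulVec_dotProduct_of_isometry hC]
        simp
      · rw [mulVec_dotProduct_of_isometry (padWith_isometry n m a),
          mulVec_dotProduct_of_isometry hC]
        simp
      · rw [mulVec_dotProduct_of_isometry (padWith_isometry n m a),
          mulVec_dotProduct_of_isometry hC]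
        simp [hx]
    have htr : ∀ W : fixPad n m, ∑ a, ∑ x,
        qform (W.1.1 *ᵥ padWith n m a *ᵥ C *ᵥ Pi.single x 1) Y = X.trace := by
      intro W
      have h1 : ∀ a x, W.1.1 *ᵥ padWith n m a *ᵥ C *ᵥ Pi.single x 1 =
          (W.1.1 * (padWith n m a * C)) *ᵥ Pi.single x 1 := by
        intro a x; simp only [mulVec_mulVec]
      simp only [h1, sum_qform_mulVec_single]
      rw [← Matrix.trace_sum, ← Finset.mul_sum]
      have h2 : ∀ a, W.1.1 * (padWith n m a * C) * (W.1.1 * (padWith n m a * C))ᴴ =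
          W.1.1 * (padWith n m a * (padWith n m a)ᴴ) * W.1.1ᴴ := by
        intro a
        simp only [conjTranspose_mul, Matrix.mul_assoc]
        rw [← Matrix.mul_assoc C, hC', Matrix.one_mul]
      simp only [h2]
      rw [← Finset.sum_mul, ← Finset.mul_sum, sum_padWith_mul, Matrix.mul_one,
        unitary_mul_conjTranspose, Matrix.mul_one, hY, trace_mul_comm, ← Matrix.mul_assoc,
        unitary_mul_conjTranspose, Matrix.one_mul]
    have hle : ∀ W : fixPad n m, ∑ a ∈ Finset.univ.erase (fun _ : Fin m => false), ∑ x,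
        (qform (W.1.1 *ᵥ padWith n m a *ᵥ C *ᵥ Pi.single x 1) Y).re ≤ X.trace.re := by
      intro W
      rw [← htr W]
      simp only [Complex.re_sum]
      exact Finset.sum_le_sum_of_subset_of_nonneg (Finset.erase_subset _ _) fun a _ _ =>
        Finset.sum_nonneg fun x _ => qform_nonneg hYp _
    have hint : (2 : ℝ) ^ n * ∑ a ∈ Finset.univ.erase (fun _ : Fin m => false),
        ∫ W : fixPad n m, (qform (W.1.1 *ᵥ padWith n m a *ᵥ C *ᵥ Pi.single x₀ 1) Y).re
          ∂haarFixPad n m ≤ X.trace.re := by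
      calc _ = ∑ a ∈ Finset.univ.erase (fun _ : Fin m => false), ∑ x : Fin n → Bool,
            ∫ W : fixPad n m, (qform (W.1.1 *ᵥ padWith n m a *ᵥ C *ᵥ Pi.single x 1) Y).re
              ∂haarFixPad n m := by
            rw [Finset.mul_sum]
            refine Finset.sum_congr rfl fun a ha => ?_
            rw [← Finset.sum_congr rfl fun x _ => hswap a ha x]
            simp
        _ = ∫ W : fixPad n m, ∑ a ∈ Finset.univ.erase (fun _ : Fin m => false), ∑ x,
            (qform (W.1.1 *ᵥ padWith n m a *ᵥ C *ᵥ Pi.single x 1) Y).re ∂haarFixPad n m := by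
            rw [integral_finsetSum _ fun a _ => integrable_finsetSum _ fun x _ =>
              integrable_of_continuous (hcont a _)]
            exact Finset.sum_congr rfl fun a _ => (integral_finsetSum _ fun x _ =>
              integrable_of_continuous (hcont a _)).symm
        _ ≤ ∫ _W : fixPad n m, X.trace.re ∂haarFixPad n m :=
            integral_mono (integrable_finsetSum _ fun a _ => integrable_finsetSum _ fun x _ =>
              integrable_of_continuous (hcont a _)) (integrable_const _) hle
        _ = X.trace.re := by simp
    rw [inv_pow, ← div_eq_inv_mul, le_div_iff₀' (by positivity)]
    exact hint

end

section

open MeasureTheory Matrix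

/-! ### Haar averages orthogonal to a subspace -/

section Orthonormal

variable {I : Type*} [Fintype I] [DecidableEq I]

theorem inner_toLp (x y : I → ℂ) :
    inner ℂ (WithLp.toLp 2 x) (WithLp.toLp 2 y : EuclideanSpace ℂ I) = star x ⬝ᵥ y := by
  rw [EuclideanSpace.inner_toLp_toLp, dotProduct_comm]

/-- The span of finitely many vectors has an orthonormal basis, given as the columns of `E`. -/
theorem exists_orthonormal_columns {q : ℕ} (ψ : Fin q → I → ℂ) :
    ∃ (s : ℕ) (E : Matrix I (Fin s) ℂ), s ≤ q ∧ Eᴴ * E = 1 ∧ (∀ i, E *ᵥ Eᴴ *ᵥ ψ i = ψ i) ∧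
      ∀ φ : I → ℂ, (∀ i, star (ψ i) ⬝ᵥ φ = 0) → Eᴴ *ᵥ φ = 0 := by
  let S : Submodule ℂ (EuclideanSpace ℂ I) :=
    Submodule.span ℂ (Set.range fun i => WithLp.toLp 2 (ψ i))
  let b := stdOrthonormalBasis ℂ S
  let E : Matrix I (Fin (Module.finrank ℂ S)) ℂ := Matrix.of fun x j => (b j : EuclideanSpace ℂ I) x
  have hE : ∀ (φ : I → ℂ) j, (Eᴴ *ᵥ φ) j = inner ℂ (b j : EuclideanSpace ℂ I) (WithLp.toLp 2 φ) := by
    intro φ j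
    have : (b j : EuclideanSpace ℂ I) = WithLp.toLp 2 fun x => E x j := rfl
    rw [this, inner_toLp]; rfl
  refine ⟨_, E, ?_, ?_, ?_, ?_⟩
  · have := finrank_range_le_card (R := ℂ) fun i => (WithLp.toLp 2 (ψ i) : EuclideanSpace ℂ I)
    rwa [Fintype.card_fin] at this
  · ext i j
    have h := orthonormal_iff_ite.1 b.orthonormal i j
    have h2 := hE (fun x => E x j) i
    rw [one_apply, ← h]
    exact h2
  · intro i
    let y : S := ⟨WithLp.toLp 2 (ψ i), Submodule.subset_span ⟨i, rfl⟩⟩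
    have h := congrArg (fun z : S => (z : EuclideanSpace ℂ I)) (b.sum_repr' y)
    ext x
    have hx := congrArg (fun z : EuclideanSpace ℂ I => z x) h
    simp only [mulVec, dotProduct] at hE ⊢
    simp only [hE]
    have : (y : EuclideanSpace ℂ I) x = ψ i x := rfl
    rw [← this, ← hx]
    simp [E, mul_comm, y]
  · intro φ hφ
    have hφS : ∀ y ∈ S, inner ℂ y (WithLp.toLp 2 φ) = 0 := by
      intro y hy
      induction hy using Submodule.span_induction with
      | mem y hy =>
        obtain ⟨i, rfl⟩ := hy
        rw [inner_toLp, hφ]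
      | zero => simp
      | add a b _ _ ha hb => rw [inner_add_left, ha, hb, add_zero]
      | smul c a _ ha => rw [inner_smul_left, ha, mul_zero]
    ext j
    rw [hE, hφS _ (b j).2, Pi.zero_apply]

/-- Unit vectors orthogonal to the columns of `E` extend to an orthonormal basis of the orthogonal
complement. -/
theorem exists_complement_columns {s : ℕ} {E : Matrix I (Fin s) ℂ} (hE : Eᴴ * E = 1)
    {u : I → ℂ} (hu : star u ⬝ᵥ u = 1) (huE : Eᴴ *ᵥ u = 0) :
    ∃ (K : Finset (EuclideanSpace ℂ I)) (A : Matrix I K ℂ) (k : K), Aᴴ * A = 1 ∧ Eᴴ * A = 0 ∧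
      (fun x => A x k) = u ∧ K.card + s = Fintype.card I := by
  classical
  let e : Fin s → EuclideanSpace ℂ I := fun j => WithLp.toLp 2 fun x => E x j
  have he : Orthonormal ℂ e := by
    rw [orthonormal_iff_ite]
    intro i j
    rw [inner_toLp, ← one_apply, ← hE]; rfl
  have hue : ∀ j, inner ℂ (e j) (WithLp.toLp 2 u) = 0 := by
    intro j
    rw [inner_toLp]; exact congrFun huE j
  have hu1 : ‖(WithLp.toLp 2 u : EuclideanSpace ℂ I)‖ = 1 := by
    have h2 : ((‖(WithLp.toLp 2 u : EuclideanSpace ℂ I)‖ : ℂ)) ^ 2 = 1 := by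
      rw [← hu, ← inner_toLp]
      rw [inner_self_eq_norm_sq_to_K (𝕜 := ℂ)]
      simp
    have h3 : ‖(WithLp.toLp 2 u : EuclideanSpace ℂ I)‖ ^ 2 = 1 := by exact_mod_cast h2
    exact (pow_eq_one_iff_of_nonneg (norm_nonneg _) two_ne_zero).1 h3
  have hv : Orthonormal ℂ (Subtype.val : ↥(insert (WithLp.toLp 2 u) (Set.range e)) →
      EuclideanSpace ℂ I) := by
    constructor
    · rintro ⟨x, rfl | ⟨j, rfl⟩⟩
      · exact hu1
      · exact he.1 j
    · rintro ⟨x, hx⟩ ⟨y, hy⟩ hxy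
      have hxy : x ≠ y := fun h => hxy (Subtype.ext h)
      rcases hx with rfl | ⟨i, rfl⟩ <;> rcases hy with rfl | ⟨j, rfl⟩
      · exact absurd rfl hxy
      · exact inner_eq_zero_symm.1 (hue j)
      · exact hue i
      · exact he.2 fun h => hxy (h ▸ rfl)
  obtain ⟨w, b, hw, hb⟩ := hv.exists_orthonormalBasis_extension
  have hbo : ∀ x y : w, inner ℂ (x : EuclideanSpace ℂ I) (y : EuclideanSpace ℂ I) =
      if x = y then 1 else 0 := by
    intro x y
    have := orthonormal_iff_ite.1 b.orthonormal x y
    simpa only [hb] using this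
  -- The orthonormal basis `w` extends `u` together with the columns of `E`; deleting those columns
  -- leaves a basis of the complement that still contains `u`.
  let R : Finset (EuclideanSpace ℂ I) := Finset.univ.image e
  have hR : R ⊆ w := by
    intro x hx
    obtain ⟨j, -, rfl⟩ := Finset.mem_image.1 hx
    exact hw (Or.inr ⟨j, rfl⟩)
  have huK : WithLp.toLp 2 u ∈ w \ R := by
    refine Finset.mem_sdiff.2 ⟨hw (Or.inl rfl), fun h => ?_⟩
    obtain ⟨j, -, hj⟩ := Finset.mem_image.1 h
    have h0 := hue j
    rw [hj, inner_self_eq_zero] at h0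
    rw [h0, norm_zero] at hu1
    exact zero_ne_one hu1
  refine ⟨w \ R, Matrix.of fun x k => k.1 x, ⟨_, huK⟩, ?_, ?_, rfl, ?_⟩
  · ext k l
    have := hbo ⟨k.1, (Finset.mem_sdiff.1 k.2).1⟩ ⟨l.1, (Finset.mem_sdiff.1 l.2).1⟩
    simp only [Subtype.mk.injEq, ← Subtype.ext_iff] at this
    rw [one_apply, ← this, mul_apply', dotProduct_comm]; rfl
  · ext j l
    obtain ⟨hl, hlR⟩ := Finset.mem_sdiff.1 l.2
    have hj : e j ∈ R := Finset.mem_image_of_mem e (Finset.mem_univ j)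
    have := hbo ⟨e j, hR hj⟩ ⟨l.1, hl⟩
    rw [if_neg (by rintro h; exact hlR (Subtype.mk.inj h ▸ hj))] at this
    rw [Matrix.zero_apply, ← this, mul_apply', dotProduct_comm]; rfl
  · have hc : w.card = Fintype.card I := by
      have := Module.finrank_eq_card_basis b.toBasis
      rw [finrank_euclideanSpace] at this
      simpa using this.symm
    have hRc : R.card = s := by
      rw [Finset.card_image_of_injective _ he.linearIndependent.injective]; simp
    rw [Finset.card_sdiff_of_subset hR, hRc, hc]
    have := Finset.card_le_card hR
    omega

/-- `A * Aᴴ` is a projection, and the difference of the two sides is the trace of `X` compressed by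
the complementary projection. -/
theorem sum_qform_columns_le {κ : Type*} [Fintype κ] [DecidableEq κ] {A : Matrix I κ ℂ}
    (hA : Aᴴ * A = 1) {X : Matrix I I ℂ} (hX : X.PosSemidef) :
    ∑ k, (qform (A *ᵥ Pi.single k 1) X).re ≤ X.trace.re := by
  rw [← Complex.re_sum, sum_qform_mulVec_single]
  have h1 : (1 - A * Aᴴ) * (1 - A * Aᴴ)ᴴ = 1 - A * Aᴴ := by
    have h2 : A * Aᴴ * (A * Aᴴ) = A * Aᴴ := by
      rw [Matrix.mul_assoc, ← Matrix.mul_assoc Aᴴ, hA, Matrix.one_mul]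
    simp [Matrix.sub_mul, Matrix.mul_sub, h2]
  have h3 : X.trace - (X * (A * Aᴴ)).trace = ((1 - A * Aᴴ)ᴴ * X * (1 - A * Aᴴ)).trace := by
    rw [trace_mul_comm (_ * X), ← Matrix.mul_assoc (1 - A * Aᴴ), h1, Matrix.sub_mul, trace_sub, Matrix.one_mul,
      trace_mul_comm X]
  have h4 := (Complex.le_def.1 (hX.conjTranspose_mul_mul_same (1 - A * Aᴴ)).trace_nonneg).1
  rw [← h3] at h4
  simpa using h4

end Orthonormal

theorem isIsometry_mul_padZero {n m : ℕ} (U : UGroup (n + m)) : IsIsometry (U.1 * padZero n m) := by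
  rw [IsIsometry, conjTranspose_mul, Matrix.mul_assoc, ← Matrix.mul_assoc U.1ᴴ,
    unitary_conjTranspose_mul, Matrix.one_mul, ← padWith_zero, padWith_isometry]

/-- If `X V` depends only on the action of the Haar isometry `V` on the range of `E`, then it is
hard to find the image of a vector orthogonal to the columns of `E`. -/
theorem integral_qform_orthogonal_le {n m s q : ℕ} (hs : s ≤ q)
    {E : Matrix (Fin n → Bool) (Fin s) ℂ}
    (hE : Eᴴ * E = 1) (X : UGroup (n + m) → Op (Fin (n + m))) (hXc : Continuous X)
    (hX : ∀ U, (X U).PosSemidef)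
    (hXE : ∀ U U' : UGroup (n + m), U.1 * padZero n m * E = U'.1 * padZero n m * E → X U = X U')
    {u : (Fin n → Bool) → ℂ} (huE : Eᴴ *ᵥ u = 0) (hu : (star u ⬝ᵥ u).re ≤ 1) :
    ∫ U, (qform ((U.1 * padZero n m) *ᵥ u) (X U)).re ∂haarUnitary (Fin (n + m) → Bool) ≤
      (q + 1) * (2 : ℝ)⁻¹ ^ n * ∫ U, (X U).trace.re ∂haarUnitary (Fin (n + m) → Bool) := by
  have hcU : Continuous fun U : UGroup (n + m) => (U.1 : Op (Fin (n + m))) :=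
    continuous_subtype_val
  have hcq : ∀ φ, Continuous fun U : UGroup (n + m) =>
      (qform ((U.1 * padZero n m) *ᵥ φ) (X U)).re := by
    intro φ
    have h1 : Continuous fun U : UGroup (n + m) => (U.1 * padZero n m) *ᵥ φ :=
      (hcU.matrix_mul continuous_const).matrix_mulVec continuous_const
    refine Complex.continuous_re.comp ?_
    unfold qform
    exact (h1.star).dotProduct (hXc.matrix_mulVec h1)
  have hct : Continuous fun U => (X U).trace.re := Complex.continuous_re.comp hXc.matrix_trace
  have htr0 : 0 ≤ ∫ U, (X U).trace.re ∂haarUnitary (Fin (n + m) → Bool) :=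
    integral_nonneg fun U => (Complex.le_def.1 (hX U).trace_nonneg).1
  set T := ∫ U, (X U).trace.re ∂haarUnitary (Fin (n + m) → Bool)
  set P := padZero n m with hP
  have hPi : Pᴴ * P = 1 := by rw [hP, ← padWith_zero, padWith_isometry]
  let J : ((Fin n → Bool) → ℂ) → ℝ := fun φ =>
    ∫ U, (qform ((U.1 * P) *ᵥ φ) (X U)).re ∂haarUnitary (Fin (n + m) → Bool)
  -- `J` is homogeneous of degree two, so it suffices to treat unit vectors; `u` itself may be
  -- shorter, or zero.
  have hJs : ∀ (c : ℂ) φ, J (c • φ) = ‖c‖ ^ 2 * J φ := by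
    intro c φ
    simp only [J]
    rw [← integral_const_mul]
    refine integral_congr_ae (Filter.Eventually.of_forall fun U => ?_)
    have : qform ((U.1 * P) *ᵥ (c • φ)) (X U) =
        ((‖c‖ ^ 2 : ℝ) : ℂ) * qform ((U.1 * P) *ᵥ φ) (X U) := by
      have hc : star c * c = ((‖c‖ ^ 2 : ℝ) : ℂ) := by
        rw [mul_comm]; simpa using Complex.mul_conj' c
      rw [← hc]
      simp only [qform, mulVec_smul, star_smul, smul_dotProduct, dotProduct_smul, smul_eq_mul]
      ring
    simp only [this, Complex.re_ofReal_mul]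
  have hJu : ∀ v : (Fin n → Bool) → ℂ, star v ⬝ᵥ v = 1 → Eᴴ *ᵥ v = 0 →
      J v ≤ (q + 1) * (2 : ℝ)⁻¹ ^ n * T := by
    intro v hv hvE
    obtain ⟨K, A, k, hA, hEA, hk, hcard⟩ := exists_complement_columns hE hv hvE
    have hcol : ∀ l, A *ᵥ Pi.single l 1 = fun x => A x l := fun l => by
      rw [mulVec_single_one]; rfl
    have hkv : A *ᵥ Pi.single k 1 = v := by rw [hcol, hk]
    -- Translate `U` on the right by the swap `S` of the padded columns `l` and `k`. Since `S` fixes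
    -- `P * E`, the hypothesis `hXE` leaves `X` unchanged while the two columns trade places.
    have hJk : ∀ l, J (A *ᵥ Pi.single l 1) = J v := by
      intro l
      by_cases hl : l = k
      · rw [hl, hkv]
      rw [← hkv]
      have hPA : (P * A)ᴴ * (P * A) = 1 := by
        rw [conjTranspose_mul, Matrix.mul_assoc, ← Matrix.mul_assoc Pᴴ, hPi, Matrix.one_mul, hA]
      have ho : ∀ i j, star ((P * A) *ᵥ Pi.single i 1) ⬝ᵥ ((P * A) *ᵥ Pi.single j 1) =
          if i = j then 1 else 0 := by
        intro i j
        rw [mulVec_dotProduct_of_isometry hPA]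
        simp [Pi.single_apply, eq_comm]
      let S : UGroup (n + m) := ⟨swapMat ((P * A) *ᵥ Pi.single l 1) ((P * A) *ᵥ Pi.single k 1),
        swapMat_mem (by rw [ho, if_pos rfl]) (by rw [ho, if_pos rfl]) (by rw [ho, if_neg hl])⟩
      have hSE : S.1 * (P * E) = P * E := by
        have h0 : ∀ i, star ((P * A) *ᵥ Pi.single i 1) ᵥ* (P * E) = 0 := by
          intro i
          rw [star_mulVec, vecMul_vecMul, conjTranspose_mul, Matrix.mul_assoc,
            ← Matrix.mul_assoc Pᴴ, hPi, Matrix.one_mul]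
          have : Aᴴ * E = 0 := by
            rw [← conjTranspose_conjTranspose E, ← conjTranspose_mul, hEA, conjTranspose_zero]
          rw [this, vecMul_zero]
        change (swapMat ((P * A) *ᵥ Pi.single l 1) ((P * A) *ᵥ Pi.single k 1) :
          Op (Fin (n + m))) * (P * E) = P * E
        rw [swapMat, Matrix.sub_mul, vecMulVec_mul, star_sub, sub_vecMul, h0, h0]
        ext
        simp [vecMulVec_apply]
      have hSk : S.1 *ᵥ ((P * A) *ᵥ Pi.single l 1) = (P * A) *ᵥ Pi.single k 1 :=
        swapMat_mulVec_left (by rw [ho, if_pos rfl]) (by rw [ho, if_neg (Ne.symm hl)])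
      have hSl : S.1 *ᵥ ((P * A) *ᵥ Pi.single k 1) = (P * A) *ᵥ Pi.single l 1 := by
        change swapMat _ _ *ᵥ _ = _
        rw [swapMat_mulVec, ho, ho, if_neg hl, if_pos rfl]
        simp
      simp only [J]
      rw [← integral_mul_right_eq_self (fun U : UGroup (n + m) =>
        (qform ((U.1 * P) *ᵥ A *ᵥ Pi.single k 1) (X U)).re) S]
      refine integral_congr_ae (Filter.Eventually.of_forall fun U => ?_)
      have h1 : X (U * S) = X U := by
        refine hXE _ _ ?_
        rw [Submonoid.coe_mul, Matrix.mul_assoc, Matrix.mul_assoc U.1, hSE, Matrix.mul_assoc]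
      have h2 : ((U * S).1 * P) *ᵥ A *ᵥ Pi.single k 1 = (U.1 * P) *ᵥ A *ᵥ Pi.single l 1 := by
        rw [Submonoid.coe_mul, mulVec_mulVec, Matrix.mul_assoc, Matrix.mul_assoc, ← mulVec_mulVec,
          ← mulVec_mulVec, hSl, mulVec_mulVec, mulVec_mulVec, Matrix.mul_assoc]
      simp only [h1, h2]
    have hpt : ∀ U : UGroup (n + m), ∑ l, (qform ((U.1 * P) *ᵥ A *ᵥ Pi.single l 1) (X U)).re ≤
        (X U).trace.re := by
      intro U
      have hVA : (U.1 * P * A)ᴴ * (U.1 * P * A) = 1 := by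
        have := isIsometry_mul_padZero U
        rw [IsIsometry, ← hP] at this
        rw [conjTranspose_mul, Matrix.mul_assoc, ← Matrix.mul_assoc (U.1 * P)ᴴ, this,
          Matrix.one_mul, hA]
      simpa only [mulVec_mulVec] using sum_qform_columns_le hVA (hX U)
    have hsum : (K.card : ℝ) * J v ≤ T := by
      calc (K.card : ℝ) * J v = ∑ l, J (A *ᵥ Pi.single l 1) := by
            rw [Finset.sum_congr rfl fun l _ => hJk l]; simp
        _ = ∫ U, ∑ l, (qform ((U.1 * P) *ᵥ A *ᵥ Pi.single l 1) (X U)).re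
            ∂haarUnitary (Fin (n + m) → Bool) :=
          (integral_finsetSum _ fun l _ => integrable_of_continuous (hcq _)).symm
        _ ≤ T := integral_mono (integrable_finsetSum _ fun l _ =>
          integrable_of_continuous (hcq _)) (integrable_of_continuous hct) hpt
    have hJv0 : 0 ≤ J v := integral_nonneg fun U => qform_nonneg (hX U) _
    -- Only `2 ^ n - s` directions share `T`. The crude bound `J v ≤ T` makes up for the missing
    -- `s`, giving `2 ^ n * J v ≤ (s + 1) * T` without assuming that `2 ^ n` is large compared with
    -- `s`.
    have hJv1 : J v ≤ T := by
      have hk1 : (1 : ℝ) ≤ K.card := by exact_mod_cast Finset.card_pos.2 ⟨k.1, k.2⟩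
      nlinarith
    have hc : (K.card : ℝ) + s = 2 ^ n := by
      have : K.card + s = 2 ^ n := by simpa using hcard
      exact_mod_cast this
    have hsq : (s : ℝ) ≤ q := by exact_mod_cast hs
    rw [inv_pow, mul_assoc, ← div_eq_inv_mul, mul_div_assoc', le_div_iff₀ (by positivity), ← hc]
    nlinarith
  change J u ≤ _
  by_cases h0 : u = 0
  · have : J u = 0 := by
      have := hJs 0 u
      simpa [h0] using this
    rw [this]; positivity
  · have hnn : 0 < ‖(WithLp.toLp 2 u : EuclideanSpace ℂ (Fin n → Bool))‖ := by
      rw [norm_pos_iff]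
      intro h
      exact h0 (by simpa using congrArg WithLp.ofLp h)
    set r := ‖(WithLp.toLp 2 u : EuclideanSpace ℂ (Fin n → Bool))‖
    have hr : star u ⬝ᵥ u = ((r ^ 2 : ℝ) : ℂ) := by
      rw [← inner_toLp]
      rw [inner_self_eq_norm_sq_to_K (𝕜 := ℂ)]
      simp [r]
    have hrC : (r : ℂ) ≠ 0 := by exact_mod_cast hnn.ne'
    have hu' : u = (r : ℂ) • ((r : ℂ)⁻¹ • u) := by
      rw [smul_smul, mul_inv_cancel₀ hrC, one_smul]
    have h1 := hJu ((r : ℂ)⁻¹ • u) (by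
      rw [star_smul, smul_dotProduct, dotProduct_smul, hr]
      simp
      field_simp) (by rw [mulVec_smul, huE, smul_zero])
    rw [hu', hJs]
    have hr1 : r ^ 2 ≤ 1 := by
      rw [hr] at hu; simpa [← Complex.ofReal_pow] using hu
    have h2 : 0 ≤ J ((r : ℂ)⁻¹ • u) := integral_nonneg fun U => qform_nonneg (hX U) _
    have h3 : ‖(r : ℂ)‖ ^ 2 = r ^ 2 := by simp
    rw [h3]
    nlinarith

end

section

open Matrix

/-! ### Operators acting on a subregister, controlled by the other wires -/

section Controlled

variable {V E : Type} [Fintype V] [DecidableEq V] [Fintype E] [DecidableEq E]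

theorem extend_comp_self (ι : E ↪ V) (x : E → Bool) (y : V → Bool) :
    Function.extend ι x y ∘ ι = x := by
  funext e; exact ι.injective.extend_apply _ _ _

theorem extend_of_notMem (ι : E ↪ V) (x : E → Bool) (y : V → Bool) {w : V}
    (hw : w ∉ Set.range ι) : Function.extend ι x y w = y w :=
  Function.extend_apply' _ _ _ fun ⟨e, he⟩ => hw ⟨e, he⟩

theorem extend_eq_of_agree (ι : E ↪ V) {y y' : V → Bool}
    (h : ∀ w, w ∉ Set.range ι → y w = y' w) : Function.extend ι (y ∘ ι) y' = y := by
  funext w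
  by_cases hw : w ∈ Set.range ι
  · obtain ⟨e, rfl⟩ := hw
    exact ι.injective.extend_apply _ _ _
  · rw [extend_of_notMem ι _ _ hw, h w hw]

open Classical in
theorem sum_agree {α : Type*} [AddCommMonoid α] (ι : E ↪ V) (y : V → Bool)
    (f : (V → Bool) → α) :
    (∑ y', if ∀ w, w ∉ Set.range ι → y w = y' w then f y' else 0) =
      ∑ x : E → Bool, f (Function.extend ι x y) := by
  rw [← Finset.sum_filter]
  refine Finset.sum_nbij' (fun y' => y' ∘ ι) (fun x => Function.extend ι x y) ?_ ?_ ?_ ?_ ?_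
  · simp
  · intro x _
    simp only [Finset.mem_filter, Finset.mem_univ, true_and]
    exact fun w hw => (extend_of_notMem ι x y hw).symm
  · intro y' hy'
    exact extend_eq_of_agree ι fun w hw => ((Finset.mem_filter.1 hy').2 w hw).symm
  · intro x _
    exact extend_comp_self ι x y
  · intro y' hy'
    rw [extend_eq_of_agree ι fun w hw => ((Finset.mem_filter.1 hy').2 w hw).symm]

open Classical in
/-- The operator that acts on the wires selected by `ι` as `M y`, where `y` is the assignment of
the other wires. -/
def ctl (ι : E ↪ V) (M : (V → Bool) → Op E) : Op V := Matrix.of fun y y' =>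
  if ∀ w, w ∉ Set.range ι → y w = y' w then M y' (y ∘ ι) (y' ∘ ι) else 0

/-- `M y` does not depend on the wires selected by `ι`. -/
def Insensitive {α : Type*} (ι : E ↪ V) (M : (V → Bool) → α) : Prop :=
  ∀ x y, M (Function.extend ι x y) = M y

theorem Insensitive.eq_of_agree {α : Type*} {ι : E ↪ V} {M : (V → Bool) → α}
    (hM : Insensitive ι M) {y y' : V → Bool} (h : ∀ w, w ∉ Set.range ι → y w = y' w) :
    M y = M y' := by
  rw [← extend_eq_of_agree ι h, hM]

/-- Only the left factor must be insensitive: in the product it is evaluated at the intermediate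
assignment, which differs from the input just on the wires of `ι`. -/
theorem ctl_mul (ι : E ↪ V) {M M' : (V → Bool) → Op E} (hM : Insensitive ι M) :
    ctl ι M * ctl ι M' = ctl ι fun y => M y * M' y := by
  classical
  ext y y''
  simp only [mul_apply, ctl, of_apply, ite_mul, zero_mul]
  rw [sum_agree ι y fun y' => M y' (y ∘ ι) (y' ∘ ι) * (if ∀ w, w ∉ Set.range ι → y' w = y'' w then
    M' y'' (y' ∘ ι) (y'' ∘ ι) else 0)]
  simp only [extend_comp_self, hM _ _]
  have h : ∀ x, (∀ w, w ∉ Set.range ι → Function.extend ι x y w = y'' w) ↔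
      ∀ w, w ∉ Set.range ι → y w = y'' w := fun x =>
    forall₂_congr fun w hw => by rw [extend_of_notMem ι x y hw]
  simp only [h]
  split_ifs with hy
  · rw [hM.eq_of_agree hy]
  · simp

theorem ctl_one (ι : E ↪ V) : ctl ι (fun _ => 1) = 1 := by
  ext y y'
  simp only [ctl, of_apply, one_apply]
  by_cases h : y = y'
  · simp [h]
  · rw [if_neg h]
    split_ifs with h1 h2
    · exact absurd (by rw [← extend_eq_of_agree ι h1, h2]; exact extend_eq_of_agree ι fun _ _ => rfl) h
    · rfl
    · rfl

/-- The block of an operator in which the wires outside of `ι` have the values in `y`, `y'`. -/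
def block (ι : E ↪ V) (ρ : Op V) (y y' : V → Bool) : Op E :=
  Matrix.of fun x x' => ρ (Function.extend ι x y) (Function.extend ι x' y')

/-- On a diagonal entry (`y = y'`) the controls have a definite value and `M y` acts as a fixed
operator on the block. This is why the reduction may leave the description register unmeasured. -/
theorem conj_ctl_apply (ι : E ↪ V) {M : (V → Bool) → Op E} (hM : Insensitive ι M) (ρ : Op V)
    (y y' : V → Bool) : conj (ctl ι M) ρ y y' =
      (M y * block ι ρ y y' * (M y')ᴴ) (y ∘ ι) (y' ∘ ι) := by
  classical
  have h1 : ∀ z, (ctl ι M * ρ) y z = ∑ x, M y (y ∘ ι) x * ρ (Function.extend ι x y) z := by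
    intro z
    simp only [mul_apply, ctl, of_apply, ite_mul, zero_mul]
    rw [sum_agree ι y fun y' => M y' (y ∘ ι) (y' ∘ ι) * ρ y' z]
    simp only [extend_comp_self, hM _ _]
  simp only [conj]
  rw [mul_apply]
  simp only [conjTranspose_apply, ctl, of_apply, apply_ite star, star_zero, mul_ite, mul_zero]
  rw [sum_agree ι y' fun z => (Matrix.of (fun y y' => if ∀ w, w ∉ Set.range ι → y w = y' w then
    M y' (y ∘ ι) (y' ∘ ι) else 0) * ρ) y z * star (M z (y' ∘ ι) (z ∘ ι))]
  simp only [extend_comp_self, hM _ _]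
  rw [mul_apply]
  refine Finset.sum_congr rfl fun x _ => congrArg₂ _ ((h1 _).trans ?_) rfl
  rw [mul_apply]
  rfl

theorem conj_ctl_const (ι : E ↪ V) (M : Op E) :
    conj (ctl ι fun _ => M) = applyOn ι (conj M) := by
  funext ρ
  ext y y'
  rw [conj_ctl_apply ι fun _ _ => rfl]
  rfl

end Controlled

/-! ### Single-wire operators -/

section SingleWire

variable {V : Type} [Fintype V] [DecidableEq V]

/-- The register consisting of the wire `w`. -/
def wire (w : V) : Unit ↪ V := ⟨fun _ => w, fun _ _ _ => rfl⟩

/-- Operators on one qubit as `2 × 2` matrices. -/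
def qubitOp (M : Matrix Bool Bool ℂ) : Op Unit := Matrix.of fun x y => M (x ()) (y ())

theorem notMem_range_wire {v w : V} : v ∉ Set.range (wire w) ↔ v ≠ w :=
  not_congr ⟨fun ⟨_, h⟩ => h.symm, fun h => ⟨(), h.symm⟩⟩

theorem qubitOp_mul (M N : Matrix Bool Bool ℂ) : qubitOp M * qubitOp N = qubitOp (M * N) := by
  ext x y
  simp only [qubitOp, mul_apply, of_apply]
  exact Fintype.sum_equiv (Equiv.funUnique Unit Bool) _ _ fun z => rfl

/-- The operator that acts on the wire `w` as `M y`, where `y` is the assignment of the others. -/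
def ctl1 (w : V) (M : (V → Bool) → Matrix Bool Bool ℂ) : Op V := ctl (wire w) fun y => qubitOp (M y)

theorem ctl1_apply (w : V) (M : (V → Bool) → Matrix Bool Bool ℂ) (y y' : V → Bool) :
    ctl1 w M y y' = if ∀ v, v ≠ w → y v = y' v then M y' (y w) (y' w) else 0 := by
  simp only [ctl1, ctl, of_apply, notMem_range_wire]
  congr

/-- `M y` does not depend on the wire `w`. -/
def Insensitive1 {α : Type*} (w : V) (M : (V → Bool) → α) : Prop :=
  ∀ (b : Bool) y, M (Function.update y w b) = M y

theorem ctl1_mul (w : V) {M M' : (V → Bool) → Matrix Bool Bool ℂ} (hM : Insensitive1 w M) :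
    ctl1 w M * ctl1 w M' = ctl1 w fun y => M y * M' y := by
  simp only [ctl1]
  rw [ctl_mul]
  · simp only [qubitOp_mul]
  · intro x y
    have : Function.extend (wire w) x y = Function.update y w (x ()) := by
      funext v
      by_cases hv : v = w
      · subst hv
        rw [Function.update_self]
        exact (wire v).injective.extend_apply x y ()
      · rw [Function.update_of_ne hv]
        exact extend_of_notMem _ _ _ (notMem_range_wire.2 hv)
    simp only [this, hM _ _]

theorem ctl1_one (w : V) : ctl1 w (fun _ => 1) = 1 := by
  have : qubitOp 1 = 1 := by
    ext x y
    have : x = y ↔ x () = y () := ⟨fun h => h ▸ rfl, fun h => funext fun _ => h⟩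
    simp [qubitOp, one_apply, this]
  simp only [ctl1, this, ctl_one]

theorem ctl1_diagonal (w : V) (d : (V → Bool) → Bool → ℂ) :
    ctl1 w (fun y => diagonal (d y)) = diagonal fun y => d y (y w) := by
  ext y y'
  rw [ctl1_apply]
  by_cases h : y = y'
  · simp [h]
  · rw [diagonal_apply_ne _ h]
    split_ifs with h1
    · rw [diagonal_apply_ne]
      intro h2
      refine h (funext fun v => ?_)
      by_cases hv : v = w
      · rw [hv, h2]
      · exact h1 v hv
    · rfl

/-- The primitive eighth root of unity in the gate `T`. -/
def omega : ℂ := Complex.exp (Complex.I * Real.pi / 4)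

/-- The Hadamard matrix. -/
def hadamardM : Matrix Bool Bool ℂ :=
  Matrix.of fun x y => (if x = true ∧ y = true then -1 else 1) / (Real.sqrt 2 : ℂ)

/-- The diagonal matrix with entries `1` and `c`. -/
def phaseM (c : ℂ) : Matrix Bool Bool ℂ := diagonal fun x => if x then c else 1

/-- The Pauli matrix `X`. -/
def flipM : Matrix Bool Bool ℂ := Matrix.of fun x y => if x = !y then 1 else 0

theorem H_matrix (w : V) : (Gate.H w).matrix = ctl1 w fun _ => hadamardM := by
  ext y y'
  rw [ctl1_apply]
  rfl

theorem T_matrix (w : V) : (Gate.T w).matrix = ctl1 w fun _ => phaseM omega := by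
  simp only [phaseM]
  rw [ctl1_diagonal]
  rfl

theorem CNOT_matrix (c t : V) (h : c ≠ t) :
    (Gate.CNOT c t h).matrix = ctl1 t fun y => if y c then flipM else 1 := by
  ext y y'
  rw [ctl1_apply]
  simp only [Gate.matrix, of_apply]
  have h1 : y = Function.update y' t (xor (y' t) (y' c)) ↔
      (∀ v, v ≠ t → y v = y' v) ∧ y t = xor (y' t) (y' c) := by
    constructor
    · intro h
      refine ⟨fun v hv => ?_, ?_⟩
      · rw [h, Function.update_of_ne hv]
      · rw [h, Function.update_self]
    · rintro ⟨h1, h2⟩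
      funext v
      by_cases hv : v = t
      · rw [hv, Function.update_self, h2]
      · rw [Function.update_of_ne hv, h1 v hv]
  simp only [h1, ite_and]
  split_ifs with h2 h3 h4 h4
  · simp [flipM, h3, h4]
  · simp [one_apply, h3, h4]
  · simp [flipM, h4] at h3 ⊢; simp [h3]
  · simp [h4] at h3 ⊢; simp [h3]
  · rfl

theorem insensitive1_const {α : Type*} (w : V) (a : α) : Insensitive1 w fun _ => a := fun _ _ => rfl

theorem insensitive1_of_ne {α : Type*} {w c : V} (h : c ≠ w) (f : Bool → α) :
    Insensitive1 w fun y => f (y c) := fun b y => by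
  simp only [Function.update_of_ne h]

theorem insensitive1_of_ne₂ {α : Type*} {w c d : V} (h : c ≠ w) (h' : d ≠ w)
    (f : Bool → Bool → α) : Insensitive1 w fun y => f (y c) (y d) := fun b y => by
  simp only [Function.update_of_ne h, Function.update_of_ne h']

end SingleWire

/-! ### Identities between one-qubit matrices -/

theorem inv_sqrt_two_sq : ((Real.sqrt 2 : ℂ))⁻¹ * ((Real.sqrt 2 : ℂ))⁻¹ = 1 / 2 := by
  rw [← mul_inv, ← Complex.ofReal_mul, Real.mul_self_sqrt (by norm_num)]
  norm_num

theorem omega_eq : omega = ((Real.sqrt 2 : ℂ))⁻¹ * (1 + Complex.I) := by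
  have : Complex.I * Real.pi / 4 = ((Real.pi / 4 : ℝ) : ℂ) * Complex.I := by push_cast; ring
  rw [omega, this, Complex.exp_mul_I, ← Complex.ofReal_cos, ← Complex.ofReal_sin,
    Real.cos_pi_div_four, Real.sin_pi_div_four]
  have h : ((Real.sqrt 2 / 2 : ℝ) : ℂ) = ((Real.sqrt 2 : ℂ))⁻¹ := by
    have h2 : ((Real.sqrt 2 : ℂ)) * (Real.sqrt 2 : ℂ) = 2 := by
      rw [← Complex.ofReal_mul, Real.mul_self_sqrt (by norm_num)]; norm_num
    have h0 : (Real.sqrt 2 : ℂ) ≠ 0 := by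
      intro h; rw [h] at h2; norm_num at h2
    push_cast
    field_simp
    linear_combination h2
  rw [h]; ring

theorem omega_sq : omega ^ 2 = Complex.I := by
  rw [omega_eq, mul_pow, pow_two, inv_sqrt_two_sq]
  linear_combination (1 / 2 : ℂ) * Complex.I_sq

theorem omega_pow_four : omega ^ 4 = -1 := by
  rw [show 4 = 2 * 2 from rfl, pow_mul, omega_sq, Complex.I_sq]

theorem omega_pow_eight : omega ^ 8 = 1 := by
  rw [show 8 = 4 * 2 from rfl, pow_mul, omega_pow_four]; norm_num

/-- The gate set has no inverse of `T`; the seventh power takes its place. -/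
theorem star_omega : star omega = omega ^ 7 := by
  have h : omega * star omega = 1 := by
    rw [omega, Complex.star_def, ← Complex.exp_conj, ← Complex.exp_add]
    have h4 : (starRingEnd ℂ) (4 : ℂ) = 4 := Complex.conj_ofNat 4
    simp [Complex.conj_ofReal, h4]
    ring_nf
    simp
  calc star omega = omega ^ 8 * star omega := by rw [omega_pow_eight, one_mul]
    _ = omega ^ 7 := by rw [pow_succ, mul_assoc, h, mul_one]

theorem hadamardM_mul_self : hadamardM * hadamardM = 1 := by
  ext x y
  have h := inv_sqrt_two_sq
  cases x <;> cases y <;>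
    simp [hadamardM, mul_apply, one_apply, div_eq_mul_inv] <;> linear_combination 2 * h

theorem flipM_mul_self : flipM * flipM = 1 := by
  ext x y
  cases x <;> cases y <;> simp [flipM, mul_apply, one_apply]

theorem phaseM_mul (c d : ℂ) : phaseM c * phaseM d = phaseM (c * d) := by
  rw [phaseM, phaseM, phaseM, diagonal_mul_diagonal]
  congr 1
  funext x
  cases x <;> simp

theorem phaseM_one : phaseM 1 = 1 := by
  ext x y
  cases x <;> cases y <;> simp [phaseM, one_apply]

theorem hadamardM_phaseM_hadamardM : hadamardM * (phaseM (-1) * hadamardM) = flipM := by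
  ext x y
  have h := inv_sqrt_two_sq
  cases x <;> cases y <;>
    simp [hadamardM, phaseM, flipM, mul_apply, div_eq_mul_inv, diagonal_apply] <;>
    linear_combination 2 * h

theorem flipM_phaseM_flipM (c : ℂ) :
    flipM * (phaseM c * flipM) = diagonal fun x => if x then 1 else c := by
  ext x y
  cases x <;> cases y <;> simp [phaseM, flipM, mul_apply, diagonal_apply]

/-- The Hadamard matrix is a conjugate of Pauli `X`, by `S H T` with `S = T²`. If the factor `flipM`
is dropped, the remaining factors cancel, so controlling this one factor controls the whole product.
-/
theorem hadamardM_eq : phaseM (omega ^ 2) * (hadamardM * (phaseM omega * (flipM *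
    (phaseM (omega ^ 7) * (hadamardM * phaseM (omega ^ 6)))))) = hadamardM := by
  have h := inv_sqrt_two_sq
  have h6 : omega ^ 6 = -Complex.I := by
    rw [show 6 = 4 + 2 from rfl, pow_add, omega_pow_four, omega_sq]; ring
  have h7 : omega ^ 7 = -Complex.I * omega := by rw [pow_succ, h6]
  have hI := Complex.I_sq
  rw [h6, h7, omega_sq, omega_eq]
  ext x y
  cases x <;> cases y <;>
    simp [hadamardM, phaseM, flipM, mul_apply, div_eq_mul_inv, diagonal_apply] <;>
    generalize ((Real.sqrt 2 : ℂ))⁻¹ = r at *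
  · linear_combination 2 * r * h - r ^ 3 * hI
  · linear_combination 2 * r * h - r ^ 3 * (Complex.I + 2) * hI
  · linear_combination 2 * r * h - r ^ 3 * (Complex.I + 2) * hI
  · linear_combination -2 * r * h + r ^ 3 * (2 - Complex.I ^ 2) * hI

end

section

open Matrix

/-! ### Circuits over the elementary gates -/

section Circuits

variable {V : Type} [Fintype V] [DecidableEq V]

/-- The unitary of a list of elementary gates. -/
def gmat (l : List (Gate V)) : Op V := circuitMatrix discrete l

theorem gmat_nil : gmat ([] : List (Gate V)) = 1 := rfl

theorem gmat_cons (g : Gate V) (l : List (Gate V)) : gmat (g :: l) = gmat l * g.matrix := rfl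

theorem gmat_append (l l' : List (Gate V)) : gmat (l ++ l') = gmat l' * gmat l := by
  induction l with
  | nil => rw [List.nil_append, gmat_nil, Matrix.mul_one]
  | cons g l ih => rw [List.cons_append, gmat_cons, gmat_cons, ih, Matrix.mul_assoc]

theorem gmat_singleton (g : Gate V) : gmat [g] = g.matrix := by
  rw [gmat_cons, gmat_nil, Matrix.one_mul]

/-- The Pauli matrix `X` or the identity. -/
def flipIf (b : Bool) : Matrix Bool Bool ℂ := if b then flipM else 1

theorem flipIf_mul (a b : Bool) : flipIf a * flipIf b = flipIf (xor a b) := by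
  cases a <;> cases b <;> simp [flipIf, flipM_mul_self]

theorem gmat_CNOT {c t : V} (h : c ≠ t) :
    gmat [Gate.CNOT c t h] = ctl1 t fun y => flipIf (y c) := by
  rw [gmat_singleton, CNOT_matrix]; rfl

/-- The `k`-th power of the gate `T`. -/
def tPow (k : ℕ) (w : V) : List (Gate V) := List.replicate k (Gate.T w)

theorem gmat_tPow (k : ℕ) (w : V) : gmat (tPow k w) = ctl1 w fun _ => phaseM (omega ^ k) := by
  induction k with
  | zero => simp [tPow, gmat_nil, phaseM_one, ctl1_one]
  | succ k ih =>
    rw [tPow, List.replicate_succ, gmat_cons, ← tPow, ih, T_matrix,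
      ctl1_mul _ (insensitive1_const _ _)]
    simp only [phaseM_mul, pow_succ]

/-- The phase `ω ^ k` on a parity that is computed on the wire `w` by `l`. -/
def parityPhase (l : List (Gate V)) (k : ℕ) (w : V) : List (Gate V) := l ++ (tPow k w ++ l)

/-- The first `l` adds `f` to the wire `w`, the phase is applied to the sum, and the second `l`
removes `f` again, because `f` does not read `w`. -/
theorem gmat_parityPhase {l : List (Gate V)} {w : V} {f : (V → Bool) → Bool}
    (hl : gmat l = ctl1 w fun y => flipIf (f y)) (hf : Insensitive1 w f) (k : ℕ) :
    gmat (parityPhase l k w) = diagonal fun y => if xor (y w) (f y) then omega ^ k else 1 := by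
  have hf' : Insensitive1 w fun y => flipIf (f y) := fun b y => by simp only [hf b y]
  rw [parityPhase, gmat_append, gmat_append, gmat_tPow, hl, Matrix.mul_assoc,
    ctl1_mul _ (insensitive1_const _ _), ctl1_mul _ hf']
  have : ∀ y, flipIf (f y) * (phaseM (omega ^ k) * flipIf (f y)) =
      diagonal fun x => if xor x (f y) then omega ^ k else 1 := by
    intro y
    cases f y
    · simp [flipIf, phaseM]
    · simp only [flipIf, if_true, flipM_phaseM_flipM]
      congr 1
      funext x
      cases x <;> simp
  simp only [this]
  rw [ctl1_diagonal]

/-- The doubly controlled phase flip. -/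
def ccz {a b c : V} (hab : a ≠ b) (hac : a ≠ c) (hbc : b ≠ c) : List (Gate V) :=
  parityPhase [] 1 a ++ (parityPhase [] 1 b ++ (parityPhase [] 1 c ++
    (parityPhase [Gate.CNOT a b hab] 7 b ++ (parityPhase [Gate.CNOT a c hac] 7 c ++
      (parityPhase [Gate.CNOT b c hbc] 7 c ++
        parityPhase [Gate.CNOT a c hac, Gate.CNOT b c hbc] 1 c)))))

/-- This is the identity `4abc = a + b + c - (a⊕b) - (a⊕c) - (b⊕c) + (a⊕b⊕c)` on bits, used as an
exponent of `ω` with `ω⁴ = -1`; the negative signs become the exponent 7. -/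
theorem gmat_ccz {a b c : V} (hab : a ≠ b) (hac : a ≠ c) (hbc : b ≠ c) :
    gmat (ccz hab hac hbc) = ctl1 c fun y => phaseM (if y a && y b then -1 else 1) := by
  have h0 : ∀ w : V, gmat ([] : List (Gate V)) = ctl1 w fun _ => flipIf false := fun w => by
    simp [gmat_nil, flipIf, ctl1_one]
  have h2 : gmat [Gate.CNOT a c hac, Gate.CNOT b c hbc] =
      ctl1 c fun y => flipIf (xor (y b) (y a)) := by
    rw [gmat_cons, gmat_CNOT, ← gmat_singleton, gmat_CNOT,
      ctl1_mul _ (insensitive1_of_ne hbc flipIf)]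
    simp only [flipIf_mul]
  simp only [ccz, gmat_append]
  rw [gmat_parityPhase (h0 a) (insensitive1_const _ _),
    gmat_parityPhase (h0 b) (insensitive1_const _ _),
    gmat_parityPhase (h0 c) (insensitive1_const _ _),
    gmat_parityPhase (gmat_CNOT hab) (insensitive1_of_ne hab id),
    gmat_parityPhase (gmat_CNOT hac) (insensitive1_of_ne hac id),
    gmat_parityPhase (gmat_CNOT hbc) (insensitive1_of_ne hbc id),
    gmat_parityPhase h2 (insensitive1_of_ne₂ hbc hac xor)]
  simp only [diagonal_mul_diagonal, phaseM]
  rw [ctl1_diagonal]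
  congr 1
  funext y
  have h4 := omega_pow_four
  have h8 := omega_pow_eight
  have h16 : omega ^ 16 = 1 := by rw [show 16 = 8 * 2 from rfl, pow_mul, h8, one_pow]
  cases y a <;> cases y b <;> cases y c <;> simp <;> ring_nf <;> assumption

/-- The Toffoli gate. -/
def toffoli {a b c : V} (hab : a ≠ b) (hac : a ≠ c) (hbc : b ≠ c) : List (Gate V) :=
  Gate.H c :: (ccz hab hac hbc ++ [Gate.H c])

theorem gmat_toffoli {a b c : V} (hab : a ≠ b) (hac : a ≠ c) (hbc : b ≠ c) :
    gmat (toffoli hab hac hbc) = ctl1 c fun y => flipIf (y a && y b) := by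
  rw [toffoli, gmat_cons, gmat_append, gmat_singleton, gmat_ccz, H_matrix, Matrix.mul_assoc,
    ctl1_mul _ (insensitive1_of_ne₂ hac hbc fun x y => phaseM (if x && y then -1 else 1)),
    ctl1_mul _ (insensitive1_const _ _)]
  congr 1
  funext y
  cases y a <;> cases y b <;>
    simp [flipIf, hadamardM_phaseM_hadamardM, phaseM_one, hadamardM_mul_self]

/-- The controlled Hadamard gate. -/
def controlledH {b w : V} (h : b ≠ w) : List (Gate V) :=
  tPow 6 w ++ (Gate.H w :: (tPow 7 w ++ (Gate.CNOT b w h :: (tPow 1 w ++ (Gate.H w :: tPow 2 w)))))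

theorem gmat_controlledH {b w : V} (h : b ≠ w) :
    gmat (controlledH h) = ctl1 w fun y => if y b then hadamardM else 1 := by
  simp only [controlledH, gmat_append, gmat_cons, gmat_tPow, H_matrix, CNOT_matrix,
    Matrix.mul_assoc]
  have hc : Insensitive1 w fun y : V → Bool => if y b then flipM else 1 :=
    insensitive1_of_ne h fun x => if x then flipM else 1
  rw [ctl1_mul _ (insensitive1_const _ _), ctl1_mul _ (insensitive1_const _ _), ctl1_mul _ hc,
    ctl1_mul _ (insensitive1_const _ _), ctl1_mul _ (insensitive1_const _ _),
    ctl1_mul _ (insensitive1_const _ _)]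
  congr 1
  funext y
  split_ifs with hy
  · simpa using hadamardM_eq
  · rw [Matrix.one_mul, ← Matrix.mul_assoc (phaseM (omega ^ 1)), phaseM_mul,
      show omega ^ 1 * omega ^ 7 = 1 by rw [← pow_add, omega_pow_eight], phaseM_one,
      Matrix.one_mul, ← Matrix.mul_assoc hadamardM, hadamardM_mul_self, Matrix.one_mul, phaseM_mul,
      ← pow_add, omega_pow_eight, phaseM_one]

theorem H_conjTranspose (w : V) : (Gate.H w).matrixᴴ = (Gate.H w).matrix := by
  ext x y
  have h : (∀ v, v ≠ w → y v = x v) ↔ ∀ v, v ≠ w → x v = y v :=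
    forall₂_congr fun _ _ => eq_comm
  simp only [Gate.matrix, conjTranspose_apply, of_apply, h, and_comm (a := y w = true)]
  split_ifs <;> simp

theorem T_conjTranspose (w : V) : (Gate.T w).matrixᴴ = ctl1 w fun _ => phaseM (omega ^ 7) := by
  simp only [phaseM]
  rw [ctl1_diagonal, Gate.matrix, diagonal_conjTranspose]
  congr 1
  funext y
  rw [Pi.star_apply]
  split_ifs
  · exact star_omega
  · simp

theorem CNOT_conjTranspose {c t : V} (h : c ≠ t) :
    (Gate.CNOT c t h).matrixᴴ = (Gate.CNOT c t h).matrix := by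
  ext x y
  have key : ∀ x y : V → Bool, x = Function.update y t (xor (y t) (y c)) →
      y = Function.update x t (xor (x t) (x c)) := by
    rintro _ y rfl
    funext v
    by_cases hv : v = t
    · subst hv; simp [Function.update_of_ne h]
    · simp [Function.update_of_ne hv]
  simp only [Gate.matrix, conjTranspose_apply, of_apply,
    show (y = Function.update x t (xor (x t) (x c))) ↔ x = Function.update y t (xor (y t) (y c)) from
      ⟨key _ _, key _ _⟩]
  split_ifs <;> simp

theorem gate_conjTranspose_mul (g : Gate V) : g.matrixᴴ * g.matrix = 1 := by
  cases g with
  | H w =>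
    rw [H_conjTranspose, H_matrix, ctl1_mul _ (insensitive1_const _ _)]
    simp only [hadamardM_mul_self, ctl1_one]
  | T w =>
    rw [T_conjTranspose, T_matrix, ctl1_mul _ (insensitive1_const _ _)]
    simp only [phaseM_mul, ← pow_succ]
    rw [omega_pow_eight, phaseM_one, ctl1_one]
  | CNOT c t h =>
    rw [CNOT_conjTranspose, ← gmat_singleton, gmat_CNOT,
      ctl1_mul _ (insensitive1_of_ne h flipIf)]
    simp only [flipIf_mul, Bool.xor_self]
    exact ctl1_one t

theorem gmat_conjTranspose_mul (l : List (Gate V)) : (gmat l)ᴴ * gmat l = 1 := by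
  induction l with
  | nil => simp [gmat_nil]
  | cons g l ih =>
    rw [gmat_cons, conjTranspose_mul, Matrix.mul_assoc, ← Matrix.mul_assoc (gmat l)ᴴ, ih,
      Matrix.one_mul, gate_conjTranspose_mul]

end Circuits

/-! ### Circuits on subregisters -/

section Subregister

variable {V E : Type} [Fintype V] [DecidableEq V] [Fintype E] [DecidableEq E]

theorem ctl1_embedding (e : E ↪ V) (w : E) (N : (V → Bool) → Matrix Bool Bool ℂ) :
    ctl1 (e w) N = ctl e fun y => ctl1 w fun x => N (Function.extend e x y) := by
  ext y y'
  rw [ctl1_apply]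
  simp only [ctl, of_apply, ctl1_apply]
  rw [extend_eq_of_agree e (fun _ _ => rfl : ∀ v, v ∉ Set.range e → y' v = y' v)]
  have h : (∀ v, v ≠ e w → y v = y' v) ↔
      (∀ v, v ∉ Set.range e → y v = y' v) ∧ ∀ v, v ≠ w → (y ∘ e) v = (y' ∘ e) v := by
    constructor
    · exact fun h => ⟨fun v hv => h v fun h' => hv ⟨w, h'.symm⟩, fun v hv =>
        h (e v) fun h' => hv (e.injective h')⟩
    · rintro ⟨h1, h2⟩ v hv
      by_cases hr : v ∈ Set.range e
      · obtain ⟨v, rfl⟩ := hr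
        exact h2 v fun h => hv (h ▸ rfl)
      · exact h1 v hr
  simp only [h, ite_and]
  rfl

/-- The gate `g` on the wires selected by `e`. -/
def Gate.map (e : E ↪ V) : Gate E → Gate V
  | .H w => .H (e w)
  | .T w => .T (e w)
  | .CNOT c t h => .CNOT (e c) (e t) (e.injective.ne h)

theorem Gate.map_matrix (e : E ↪ V) (g : Gate E) : (g.map e).matrix = ctl e fun _ => g.matrix := by
  cases g with
  | H w => rw [Gate.map, H_matrix, H_matrix, ctl1_embedding]
  | T w => rw [Gate.map, T_matrix, T_matrix, ctl1_embedding]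
  | CNOT c t h =>
    rw [Gate.map, CNOT_matrix, CNOT_matrix, ctl1_embedding]
    simp only [e.injective.extend_apply]

variable (e : E ↪ V) (d a : V)

/-- The inverse of `g` on the wires selected by `e`, controlled by the wire `d`; the wire `a` is an
ancilla initialised to `|0⟩`. -/
def controlledInv (hd : d ∉ Set.range e) (ha : a ∉ Set.range e) (hda : d ≠ a) :
    Gate E → List (Gate V)
  | .H w => controlledH (b := d) (w := e w) fun h => hd ⟨w, h.symm⟩
  -- A controlled phase is a phase on the conjunction of control and target. The Toffoli gates write
  -- it on the ancilla and erase it afterwards.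
  | .T w => parityPhase (toffoli (a := d) (b := e w) (c := a) (fun h => hd ⟨w, h.symm⟩) hda
      fun h => ha ⟨w, h⟩) 7 a
  | .CNOT c t h => toffoli (a := d) (b := e c) (c := e t) (fun h => hd ⟨c, h.symm⟩)
      (fun h => hd ⟨t, h.symm⟩) (e.injective.ne h)

variable {e d a} (hd : d ∉ Set.range e) (ha : a ∉ Set.range e) (hda : d ≠ a)

theorem length_controlledInv_le (g : Gate E) : (controlledInv e d a hd ha hda g).length ≤ 81 := by
  cases g <;> simp [controlledInv, controlledH, parityPhase, toffoli, ccz, tPow]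

/-- For a general ancilla value it is enough to know that `M` reads only the control and the
ancilla: this is the insensitivity needed to multiply such operators. The intended value of `M` is
required only for a clean ancilla. -/
theorem gmat_controlledInv (g : Gate E) : ∃ M : (V → Bool) → Op E,
    (∀ y y', y d = y' d → y a = y' a → M y = M y') ∧
    gmat (controlledInv e d a hd ha hda g) = ctl e M ∧
      ∀ y, y a = false → M y = if y d then g.matrixᴴ else 1 := by
  cases g with
  | H w =>
    refine ⟨_, ?_, (gmat_controlledH _).trans (ctl1_embedding e w _), ?_⟩
    · intro y y' h _
      simp only [extend_of_notMem _ _ _ hd, h]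
    · intro y _
      simp only [extend_of_notMem _ _ _ hd]
      split_ifs
      · rw [H_conjTranspose, H_matrix]
      · exact ctl1_one w
  | CNOT c t h =>
    refine ⟨_, ?_, (gmat_toffoli _ _ _).trans (ctl1_embedding e t _), ?_⟩
    · intro y y' h _
      simp only [extend_of_notMem _ _ _ hd, e.injective.extend_apply, h]
    · intro y _
      simp only [extend_of_notMem _ _ _ hd, e.injective.extend_apply]
      split_ifs with hy
      · simp only [hy, Bool.true_and]
        rw [CNOT_conjTranspose, ← gmat_singleton, gmat_CNOT]
      · simp only [hy, Bool.false_and]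
        exact ctl1_one t
  | T w =>
    refine ⟨fun y => ctl1 w fun _ => diagonal fun b =>
      if xor (y a) (y d && b) then omega ^ 7 else 1, ?_, ?_, ?_⟩
    · intro y y' h h'
      simp only [h, h']
    · rw [controlledInv, gmat_parityPhase (gmat_toffoli _ _ _)
        (insensitive1_of_ne₂ hda (fun h => ha ⟨w, h⟩) and)]
      rw [← ctl1_diagonal (e w) fun y b => if xor (y a) (y d && b) then omega ^ 7 else 1,
        ctl1_embedding]
      simp only [extend_of_notMem _ _ _ hd, extend_of_notMem _ _ _ ha]
    · intro y hy
      simp only [hy, Bool.false_xor]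
      split_ifs with hyd
      · rw [T_conjTranspose]
        simp [hyd, phaseM]
      · simpa [hyd] using ctl1_one w

/-- The inverse of the circuit consisting of those gates in `L` whose control wires are set. -/
def controlledInvList {P : Type} (d : P → V) (hd : ∀ p, d p ∉ Set.range e)
    (ha : a ∉ Set.range e) (hda : ∀ p, d p ≠ a) : List (P × Gate E) → List (Gate V)
  | [] => []
  -- The adjoint of a product reverses the order, so the inverse of the tail is applied first.
  | p :: L => controlledInvList d hd ha hda L ++
      controlledInv e (d p.1) a (hd p.1) ha (hda p.1) p.2

theorem length_controlledInvList_le {P : Type} (d : P → V) (hd : ∀ p, d p ∉ Set.range e)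
    (ha : a ∉ Set.range e) (hda : ∀ p, d p ≠ a) (L : List (P × Gate E)) :
    (controlledInvList d hd ha hda L).length ≤ 81 * L.length := by
  induction L with
  | nil => simp [controlledInvList]
  | cons p L ih =>
    have := length_controlledInv_le (hd p.1) ha (hda p.1) p.2
    simp only [controlledInvList, List.length_append, List.length_cons]
    omega

theorem gmat_controlledInvList {P : Type} (d : P → V) (hd : ∀ p, d p ∉ Set.range e)
    (ha : a ∉ Set.range e) (hda : ∀ p, d p ≠ a) (L : List (P × Gate E)) :
    ∃ M : (V → Bool) → Op E,
      (∀ y y', (∀ p, y (d p) = y' (d p)) → y a = y' a → M y = M y') ∧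
      gmat (controlledInvList d hd ha hda L) = ctl e M ∧
        ∀ y, y a = false →
          M y = (gmat ((L.filter fun p => y (d p.1)).map Prod.snd))ᴴ := by
  induction L with
  | nil => exact ⟨fun _ => 1, fun _ _ _ _ => rfl, (ctl_one e).symm, fun y _ => by simp [gmat_nil]⟩
  | cons p L ih =>
    obtain ⟨M, hM, hML, hMy⟩ := ih
    obtain ⟨N, hN, hNg, hNy⟩ := gmat_controlledInv (hd p.1) ha (hda p.1) p.2
    refine ⟨fun y => N y * M y, fun y y' h h' => by
      simp only [hM y y' h h', hN y y' (h _) h'], ?_, fun y hy => ?_⟩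
    · rw [controlledInvList, gmat_append, hML, hNg, ctl_mul]
      exact fun x y => hN _ _ (extend_of_notMem _ _ _ (hd _)) (extend_of_notMem _ _ _ ha)
    · simp only [hNy y hy, hMy y hy]
      by_cases h : y (d p.1) = true
      · rw [if_pos h, List.filter_cons_of_pos (by simpa using h), List.map_cons, gmat_cons,
          conjTranspose_mul]
      · rw [if_neg h, List.filter_cons_of_neg (by simpa using h), Matrix.one_mul]

end Subregister

/-! ### Described circuits -/

/-- All flags of a description, with their gates. -/
def describedGates (n s : ℕ) : List ((Fin s × Fin (gateList n).length) × Gate (Fin n)) :=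
  (List.finRange s).flatMap fun j =>
    (List.finRange (gateList n).length).map fun i => ((j, i), (gateList n).get i)

/-- Every described circuit is a sublist, selected by the flags, of one list independent of `b`. A
single circuit with the flags as controls can therefore uncompute all of them. -/
theorem describedUnitary_eq {n s : ℕ} (b : DescWires n s → Bool) : describedUnitary b =
    gmat (((describedGates n s).filter fun p => b p.1).map Prod.snd) := by
  have : describedCircuit b = ((describedGates n s).filter fun p => b p.1).map Prod.snd := by
    simp only [describedCircuit, describedGates, List.filter_flatMap, List.map_flatMap,
      List.filter_map, List.map_map]
    rfl
  rw [← this]; rfl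

theorem length_describedGates (n s : ℕ) :
    (describedGates n s).length = s * (gateList n).length := by
  simp [describedGates, List.length_flatMap]

end

section

open Matrix

/-! ### Reversible classical circuits -/

section Classical

variable {V : Type} [Fintype V] [DecidableEq V]

/-- The reversible gate that adds `a ∧ ¬x` to the wire `c`. -/
structure AndNot (V : Type) where
  a : V
  x : V
  c : V
  hax : a ≠ x
  hac : a ≠ c
  hxc : x ≠ c

/-- The action of a reversible gate on assignments. -/
def AndNot.act (s : AndNot V) (y : V → Bool) : V → Bool :=
  Function.update y s.c (xor (y s.c) (y s.a && !y s.x))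

/-- A circuit for a reversible gate. -/
def AndNot.circuit (s : AndNot V) : List (Gate V) :=
  Gate.CNOT s.a s.c s.hac :: toffoli s.hax s.hac s.hxc

theorem AndNot.length_circuit (s : AndNot V) : s.circuit.length = 38 := by
  simp [AndNot.circuit, toffoli, ccz, parityPhase, tPow]

theorem AndNot.act_act (s : AndNot V) (y : V → Bool) : s.act (s.act y) = y := by
  funext v
  by_cases hv : v = s.c
  · subst hv
    simp [AndNot.act, Function.update_of_ne s.hac, Function.update_of_ne s.hxc]
  · simp [AndNot.act, Function.update_of_ne hv]

/-- `a ∧ ¬x = a ⊕ (a ∧ x)`, so a CNOT and a Toffoli gate suffice and no wire has to be negated. -/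
theorem AndNot.gmat_circuit (s : AndNot V) :
    gmat s.circuit = Matrix.of fun y y' => if y' = s.act y then 1 else 0 := by
  rw [AndNot.circuit, gmat_cons, gmat_toffoli, ← gmat_singleton, gmat_CNOT,
    ctl1_mul _ (insensitive1_of_ne₂ s.hac s.hxc fun a b => flipIf (a && b))]
  simp only [flipIf_mul]
  ext y y'
  rw [ctl1_apply, of_apply]
  have h1 : y' = s.act y ↔ (∀ v, v ≠ s.c → y v = y' v) ∧
      y s.c = xor (y' s.c) (y' s.a && !y' s.x) := by
    constructor
    · rintro rfl
      refine ⟨fun v hv => by simp [AndNot.act, Function.update_of_ne hv], ?_⟩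
      simp [AndNot.act, Function.update_of_ne s.hac, Function.update_of_ne s.hxc]
    · rintro ⟨h1, h2⟩
      have : y = s.act y' := by
        funext v
        by_cases hv : v = s.c
        · rw [hv, h2, AndNot.act, Function.update_self]
        · rw [h1 v hv, AndNot.act, Function.update_of_ne hv]
      rw [this, s.act_act]
  simp only [h1, ite_and]
  split_ifs with h2 h3
  · rw [h3]
    cases y' s.a <;> cases y' s.x <;> cases y' s.c <;> simp [flipIf, flipM, one_apply]
  · revert h3
    cases y s.c <;> cases y' s.a <;> cases y' s.x <;> cases y' s.c <;> simp [flipIf, flipM]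
  · rfl

/-- The action of a list of reversible gates. -/
def actList (l : List (AndNot V)) (y : V → Bool) : V → Bool := l.foldl (fun y s => s.act y) y

/-- Permutation matrices only permute the diagonal entries, so for a final measurement the circuit
may be replaced by its action on assignments. -/
theorem sum_conj_circuit (l : List (AndNot V)) (ρ : Op V) (f : (V → Bool) → ℂ) :
    ∑ y, f y * conj (gmat (l.flatMap AndNot.circuit)) ρ y y = ∑ y, f (actList l y) * ρ y y := by
  induction l generalizing ρ with
  | nil => simp [conj, gmat_nil, actList]
  | cons s l ih =>
    have h1 : conj (gmat ((s :: l).flatMap AndNot.circuit)) ρ =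
        conj (gmat (l.flatMap AndNot.circuit)) (conj (gmat s.circuit) ρ) := by
      simp only [conj, List.flatMap_cons, gmat_append, conjTranspose_mul, Matrix.mul_assoc]
    have h2 : ∀ y, conj (gmat s.circuit) ρ y y = ρ (s.act y) (s.act y) := by
      intro y
      rw [s.gmat_circuit]
      simp [conj, mul_apply]
    rw [h1, ih]
    simp only [h2]
    refine (Equiv.sum_comp (Function.Involutive.toPerm _ s.act_act) fun y =>
      f (actList l y) * ρ (s.act y) (s.act y)).symm.trans (Finset.sum_congr rfl fun y _ => ?_)
    change f (actList l (s.act y)) * ρ (s.act (s.act y)) (s.act (s.act y)) = _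
    rw [s.act_act]
    rfl

/-- The reversible circuit that computes into `a k` the conjunction of `a 0` and all `¬ x i`. -/
def ladder : (k : ℕ) → (a : Fin (k + 1) → V) → (x : Fin k → V) → Function.Injective a →
    (∀ i j, x i ≠ a j) → List (AndNot V)
  | 0, _, _, _, _ => []
  | k + 1, a, x, ha, hx =>
    ladder k (a ∘ Fin.castSucc) (x ∘ Fin.castSucc) (ha.comp (Fin.castSucc_injective _))
      (fun _ _ => hx _ _) ++
    [⟨a (Fin.last k).castSucc, x (Fin.last k), a (Fin.last (k + 1)), (hx _ _).symm,
      ha.ne (Fin.castSucc_lt_last _).ne, hx _ _⟩]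

theorem length_ladder (k : ℕ) (a : Fin (k + 1) → V) (x : Fin k → V) (ha : Function.Injective a)
    (hx : ∀ i j, x i ≠ a j) : (ladder k a x ha hx).length = k := by
  induction k with
  | zero => rfl
  | succ k ih => simp [ladder, ih]

theorem actList_ladder (k : ℕ) (a : Fin (k + 1) → V) (x : Fin k → V) (ha : Function.Injective a)
    (hx : ∀ i j, x i ≠ a j) (y : V → Bool) (hy : ∀ i : Fin k, y (a i.succ) = false) :
    (∀ w, (∀ i : Fin k, w ≠ a i.succ) → actList (ladder k a x ha hx) y w = y w) ∧
      actList (ladder k a x ha hx) y (a (Fin.last k)) =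
        (y (a 0) && decide (∀ i, y (x i) = false)) := by
  induction k with
  | zero => simp [ladder, actList]
  | succ k ih =>
    obtain ⟨h1, h2⟩ := ih (a ∘ Fin.castSucc) (x ∘ Fin.castSucc)
      (ha.comp (Fin.castSucc_injective _)) (fun i j => hx _ _) fun i => by
        simpa using hy i.castSucc
    set l := ladder k (a ∘ Fin.castSucc) (x ∘ Fin.castSucc)
      (ha.comp (Fin.castSucc_injective _)) (fun i j => hx _ _)
    set z := actList l y with hz
    have hstep : ∀ w, actList (ladder (k + 1) a x ha hx) y w =
        Function.update z (a (Fin.last (k + 1))) (xor (z (a (Fin.last (k + 1))))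
          (z (a (Fin.last k).castSucc) && !z (x (Fin.last k)))) w := by
      intro w
      simp only [ladder, actList, List.foldl_append]
      rfl
    have hzl : z (a (Fin.last (k + 1))) = false := by
      rw [h1 _ fun i => ha.ne ?_]
      · simpa using hy (Fin.last k)
      · exact (Fin.castSucc_lt_last _).ne'
    have hzx : z (x (Fin.last k)) = y (x (Fin.last k)) := h1 _ fun i => hx _ _
    constructor
    · intro w hw
      rw [hstep, Function.update_of_ne]
      · exact h1 w fun i => by simpa using hw i.castSucc
      · simpa using hw (Fin.last k)
    · rw [hstep, Function.update_self, hzl, hzx, Bool.false_xor]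
      change z ((a ∘ Fin.castSucc) (Fin.last k)) = _ at h2
      have h2' : z (a (Fin.last k).castSucc) = _ := h2
      rw [h2', Bool.and_assoc]
      congr 1
      rw [Bool.eq_iff_iff]
      simp only [Function.comp_apply, Bool.and_eq_true, decide_eq_true_eq, Bool.not_eq_true',
        Fin.forall_fin_succ']

end Classical

/-! ### Product states -/

section Products

variable {V E : Type} [Fintype V] [DecidableEq V] [Fintype E] [DecidableEq E]

/-- The operator `ρ` on the wires selected by `e`, as a function on all assignments. -/
def pull (e : E ↪ V) (ρ : Op E) : Op V := Matrix.of fun y y' => ρ (y ∘ e) (y' ∘ e)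

/-- The entries of `K` do not depend on the wires selected by `e`. -/
def Insensitive₂ (e : E ↪ V) (K : Op V) : Prop :=
  ∀ x x' y y', K (Function.extend e x y) (Function.extend e x' y') = K y y'

/-- A map on operators that is compatible with scalar multiplication. -/
def Homogeneous {B C : Type} (Φ : Chan B C) : Prop := ∀ (c : ℂ) X, Φ (c • X) = c • Φ X

/-- Product states on overlapping labels are handled as entrywise products instead of reindexed
tensor products. A factor that ignores the wires of `e` is a scalar on each block, and homogeneity
moves it through the channel. -/
theorem applyOn_hadamard {e : E ↪ V} {Φ : Chan E E} (hΦ : Homogeneous Φ) (R : Op V) {K : Op V}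
    (hK : Insensitive₂ e K) : applyOn e Φ (R ⊙ K) = applyOn e Φ R ⊙ K := by
  ext y y'
  have : (Matrix.of fun x x' => (R ⊙ K) (Function.extend e x y) (Function.extend e x' y')) =
      K y y' • Matrix.of fun x x' => R (Function.extend e x y) (Function.extend e x' y') := by
    ext x x'
    simp [hK x x' y y', mul_comm]
  change Φ (Matrix.of fun x x' => (R ⊙ K) (Function.extend e x y) (Function.extend e x' y')) _ _ =
    Φ (Matrix.of fun x x' => R (Function.extend e x y) (Function.extend e x' y')) _ _ * K y y'
  rw [this, hΦ, Matrix.smul_apply, smul_eq_mul, mul_comm]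

theorem conj_ctl_hadamard {e : E ↪ V} {M : (V → Bool) → Op E} (hM : Insensitive e M) (R : Op V)
    {K : Op V} (hK : Insensitive₂ e K) : conj (ctl e M) (R ⊙ K) = conj (ctl e M) R ⊙ K := by
  ext y y'
  have : block e (R ⊙ K) y y' = K y y' • block e R y y' := by
    ext x x'
    simp [block, hK x x' y y', mul_comm]
  rw [conj_ctl_apply _ hM, this, hadamard_apply, conj_ctl_apply _ hM, mul_comm]
  simp

theorem block_pull (e : E ↪ V) (ρ : Op E) (y y' : V → Bool) : block e (pull e ρ) y y' = ρ := by
  ext x x'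
  simp [block, pull, extend_comp_self]

theorem applyOn_pull (e : E ↪ V) {Φ : Chan E E} (ρ : Op E) :
    applyOn e Φ (pull e ρ) = pull e (Φ ρ) := by
  ext y y'
  change Φ (block e (pull e ρ) y y') _ _ = _
  rw [block_pull]; rfl

theorem extend_trans_comp {E' : Type} [Fintype E'] [DecidableEq E'] (e : E ↪ V) (e' : E' ↪ E)
    (x : E' → Bool) (y : V → Bool) :
    Function.extend (e'.trans e) x y ∘ e = Function.extend e' x (y ∘ e) := by
  funext w
  by_cases hw : w ∈ Set.range e'
  · obtain ⟨i, rfl⟩ := hw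
    rw [e'.injective.extend_apply]
    exact (e'.trans e).injective.extend_apply x y i
  · rw [extend_of_notMem _ _ _ hw, Function.comp_apply, extend_of_notMem]
    · rfl
    · rintro ⟨i, hi⟩
      exact hw ⟨i, e.injective hi⟩

theorem applyOn_trans_pull {E' : Type} [Fintype E'] [DecidableEq E'] (e : E ↪ V) (e' : E' ↪ E)
    {Φ : Chan E' E'} (ρ : Op E) :
    applyOn (e'.trans e) Φ (pull e ρ) = pull e (applyOn e' Φ ρ) := by
  ext y y'
  simp only [applyOn, pull, of_apply, extend_trans_comp]
  rfl

theorem block_trans_pull {E' : Type} [Fintype E'] [DecidableEq E'] (e : E ↪ V) (e' : E' ↪ E)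
    (ρ : Op E) (y y' : V → Bool) :
    block (e'.trans e) (pull e ρ) y y' = block e' ρ (y ∘ e) (y' ∘ e) := by
  ext x x'
  simp only [block, pull, of_apply, extend_trans_comp]

theorem insensitive₂_pull {E' : Type} {e : E ↪ V} {e' : E' ↪ V} (h : ∀ i j, e i ≠ e' j)
    (ρ : Op E') : Insensitive₂ e (pull e' ρ) := by
  have h' : ∀ x y, Function.extend e x y ∘ e' = y ∘ e' := fun x y => by
    funext j
    exact extend_of_notMem _ _ _ fun ⟨i, hi⟩ => h i j hi
  intro x x' y y'
  simp only [pull, of_apply, h']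

theorem Insensitive₂.hadamard {e : E ↪ V} {K L : Op V} (hK : Insensitive₂ e K)
    (hL : Insensitive₂ e L) : Insensitive₂ e (K ⊙ L) := fun x x' y y' => by
  rw [hadamard_apply, hadamard_apply, hK, hL]

theorem insensitive₂_conj_ctl {E' : Type} [Fintype E'] [DecidableEq E'] {e : E ↪ V} {e' : E' ↪ V}
    (h : ∀ i j, e i ≠ e' j) {M : (V → Bool) → Op E'} (hM : Insensitive e' M)
    (hM' : Insensitive e M) {R : Op V} (hR : Insensitive₂ e R) :
    Insensitive₂ e (conj (ctl e' M) R) := by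
  have h1 : ∀ (x : E → Bool) (y : V → Bool), Function.extend e x y ∘ e' = y ∘ e' := fun x y => by
    funext j
    exact extend_of_notMem _ _ _ fun ⟨i, hi⟩ => h i j hi
  have h2 : ∀ (x : E → Bool) (z : E' → Bool) (y : V → Bool),
      Function.extend e' z (Function.extend e x y) =
        Function.extend e x (Function.extend e' z y) := by
    intro x z y
    funext w
    by_cases hw : w ∈ Set.range e
    · obtain ⟨i, rfl⟩ := hw
      have hi : e i ∉ Set.range e' := fun ⟨j, hj⟩ => h i j hj.symm
      rw [extend_of_notMem _ _ _ hi, e.injective.extend_apply, e.injective.extend_apply]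
    · rw [extend_of_notMem e _ _ hw]
      by_cases hw' : w ∈ Set.range e'
      · obtain ⟨j, rfl⟩ := hw'
        rw [e'.injective.extend_apply, e'.injective.extend_apply]
      · rw [extend_of_notMem e' _ _ hw', extend_of_notMem e' _ _ hw', extend_of_notMem e _ _ hw]
  intro x x' y y'
  have h3 : block e' R (Function.extend e x y) (Function.extend e x' y') = block e' R y y' := by
    ext z z'
    simp only [block, of_apply, h2, hR x x' _ _]
  rw [conj_ctl_apply _ hM, conj_ctl_apply _ hM, h1, h1, h3, hM', hM']

theorem gmat_map (e : E ↪ V) (l : List (Gate E)) :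
    gmat (l.map (Gate.map e)) = ctl e fun _ => gmat l := by
  induction l with
  | nil => rw [List.map_nil, gmat_nil, gmat_nil, ctl_one]
  | cons g l ih =>
    rw [List.map_cons, gmat_cons, ih, Gate.map_matrix, ctl_mul _ fun _ _ => rfl]; rfl

theorem pull_posSemidef (e : E ↪ V) {ρ : Op E} (hρ : ρ.PosSemidef) : (pull e ρ).PosSemidef :=
  hρ.submatrix fun y : V → Bool => y ∘ e

end Products

end

section

open Matrix

/-! ### Sums over assignments -/

theorem sum_assignment_sum {A B α : Type*} [Fintype A] [DecidableEq A] [Fintype B] [DecidableEq B]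
    [AddCommMonoid α] (f : (A ⊕ B → Bool) → α) :
    ∑ x, f x = ∑ a : A → Bool, ∑ b : B → Bool, f (Sum.elim a b) := by
  rw [← Fintype.sum_prod_type', ← Equiv.sum_comp (Equiv.sumArrowEquivProdArrow A B Bool).symm]
  rfl

theorem sum_assignment_prod {A B α : Type*} [Fintype A] [DecidableEq A] [Fintype B] [DecidableEq B]
    [AddCommMonoid α] (f : (A × B → Bool) → α) :
    ∑ x, f x = ∑ c : A → B → Bool, f fun p => c p.1 p.2 := by
  rw [← Equiv.sum_comp (Equiv.curry A B Bool).symm]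
  rfl

theorem sum_prod_pi {ι β : Type*} [Fintype ι] [DecidableEq ι] [Fintype β] (g : ι → β → ℂ) :
    ∑ c : ι → β, ∏ i, g i (c i) = ∏ i, ∑ b, g i b := by
  rw [Finset.prod_univ_sum, Fintype.piFinset_univ]

theorem sum_assignment_append {n m : ℕ} {α : Type*} [AddCommMonoid α]
    (f : (Fin (n + m) → Bool) → α) :
    ∑ x, f x = ∑ v : Fin n → Bool, ∑ a : Fin m → Bool, f (Fin.append v a) := by
  rw [← Fintype.sum_prod_type', ← Equiv.sum_comp (Fin.appendEquiv n m)]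
  rfl

/-! ### Product states -/

/-- This is the Schur product theorem, starting from the all-ones matrix as the empty product. -/
theorem prod_posSemidef {I ι : Type*} [Fintype I] [DecidableEq ι] (s : Finset ι)
    {K : ι → Matrix I I ℂ} (hK : ∀ i ∈ s, (K i).PosSemidef) :
    (Matrix.of fun x x' => ∏ i ∈ s, K i x x').PosSemidef := by
  induction s using Finset.induction_on with
  | empty =>
    have : (Matrix.of fun x x' => ∏ i ∈ (∅ : Finset ι), K i x x') =
        vecMulVec (1 : I → ℂ) (star 1) := by ext; simp [vecMulVec_apply]
    rw [this]
    exact posSemidef_vecMulVec_self_star 1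
  | insert i s hi ih =>
    have : (Matrix.of fun x x' => ∏ j ∈ insert i s, K j x x') =
        K i ⊙ Matrix.of fun x x' => ∏ j ∈ s, K j x x' := by
      ext; simp [Finset.prod_insert hi]
    rw [this]
    exact (hK i (by simp)).hadamard (ih fun j hj => hK j (by simp [hj]))

open Classical in
/-- The operator with entries `1` on the assignments satisfying `p`. -/
def indicatorOp {V : Type} (p : (V → Bool) → Prop) : Op V :=
  Matrix.of fun y y' => if p y ∧ p y' then 1 else 0

theorem indicatorOp_posSemidef {V : Type} [Fintype V] [DecidableEq V] (p : (V → Bool) → Prop) :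
    (indicatorOp p).PosSemidef := by
  classical
  have : indicatorOp p = vecMulVec (fun y => if p y then (1 : ℂ) else 0)
      (star fun y => if p y then (1 : ℂ) else 0) := by
    ext y y'
    by_cases h : p y <;> by_cases h' : p y' <;> simp [indicatorOp, vecMulVec_apply, h, h']
  rw [this]
  exact posSemidef_vecMulVec_self_star _

/-- The state `⨂ᵢ Xᵢ ⊗ |r⟩⟨r| ⊗ mem`. -/
def tagState {q s R M : ℕ} (X : Fin q → Op (Fin s)) (r : Fin R → Bool) (mem : Op (Fin M)) :
    Op ((Fin q × Fin s) ⊕ (Fin R ⊕ Fin M)) :=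
  Matrix.of fun x x' =>
    (∏ i, X i (fun j => x (Sum.inl (i, j))) (fun j => x' (Sum.inl (i, j)))) *
      (if (fun j => x (Sum.inr (Sum.inl j))) = r ∧ (fun j => x' (Sum.inr (Sum.inl j))) = r
        then 1 else 0) *
      mem (fun j => x (Sum.inr (Sum.inr j))) (fun j => x' (Sum.inr (Sum.inr j)))

section TagState

variable {q s R M : ℕ} {X : Fin q → Op (Fin s)} {r : Fin R → Bool} {mem : Op (Fin M)}

theorem tagState_posSemidef (hX : ∀ i, (X i).PosSemidef) (hm : mem.PosSemidef) :
    (tagState X r mem).PosSemidef := by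
  have h1 : (Matrix.of fun x x' : (Fin q × Fin s) ⊕ (Fin R ⊕ Fin M) → Bool =>
      ∏ i, (X i).submatrix (fun (x : (Fin q × Fin s) ⊕ (Fin R ⊕ Fin M) → Bool) j =>
        x (Sum.inl (i, j))) (fun x j => x (Sum.inl (i, j))) x x').PosSemidef :=
    prod_posSemidef _ fun i _ => (hX i).submatrix _
  have h2 := indicatorOp_posSemidef fun x : (Fin q × Fin s) ⊕ (Fin R ⊕ Fin M) → Bool =>
    (fun j => x (Sum.inr (Sum.inl j))) = r
  have h3 := hm.submatrix fun (x : (Fin q × Fin s) ⊕ (Fin R ⊕ Fin M) → Bool) j =>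
    x (Sum.inr (Sum.inr j))
  have h4 : tagState X r mem = (Matrix.of fun x x' : (Fin q × Fin s) ⊕ (Fin R ⊕ Fin M) → Bool =>
      ∏ i, (X i).submatrix (fun (x : (Fin q × Fin s) ⊕ (Fin R ⊕ Fin M) → Bool) j =>
        x (Sum.inl (i, j))) (fun x j => x (Sum.inl (i, j))) x x') ⊙
      indicatorOp (fun x : (Fin q × Fin s) ⊕ (Fin R ⊕ Fin M) → Bool =>
        (fun j => x (Sum.inr (Sum.inl j))) = r) ⊙
      mem.submatrix (fun (x : (Fin q × Fin s) ⊕ (Fin R ⊕ Fin M) → Bool) j =>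
        x (Sum.inr (Sum.inr j))) (fun x j => x (Sum.inr (Sum.inr j))) := by
    ext x x'
    simp only [tagState, of_apply, hadamard_apply, submatrix_apply, indicatorOp]
    congr
  rw [h4]
  exact (h1.hadamard h2).hadamard h3

theorem tagState_trace : (tagState X r mem).trace = (∏ i, (X i).trace) * mem.trace := by
  simp only [trace, diag_apply]
  rw [sum_assignment_sum, sum_assignment_prod]
  simp only [sum_assignment_sum, tagState, of_apply, Sum.elim_inl, Sum.elim_inr, and_self]
  rw [← sum_prod_pi, Finset.sum_mul]
  refine Finset.sum_congr rfl fun c _ => ?_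
  refine (Finset.sum_eq_single r (fun a _ ha => ?_) fun h => absurd (Finset.mem_univ r) h).trans ?_
  · refine Finset.sum_eq_zero fun b _ => ?_
    exact mul_eq_zero_of_left (mul_eq_zero_of_right _ (if_neg ha)) _
  · rw [Finset.mul_sum]
    refine Finset.sum_congr rfl fun b _ => ?_
    exact congrArg (· * mem b b) ((congrArg (_ * ·) (if_pos rfl)).trans (mul_one _))

theorem applyOn_tagState (i : Fin q) (e : Fin s ↪ (Fin q × Fin s) ⊕ (Fin R ⊕ Fin M))
    (he : ∀ j, e j = Sum.inl (i, j)) {Φ : Chan (Fin s) (Fin s)} (hΦ : Homogeneous Φ) :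
    applyOn e Φ (tagState X r mem) = tagState (Function.update X i (Φ (X i))) r mem := by
  let ei : Fin s ↪ (Fin q × Fin s) ⊕ (Fin R ⊕ Fin M) :=
    ⟨fun j => Sum.inl (i, j), fun a b h => by simpa using h⟩
  obtain rfl : e = ei := DFunLike.ext _ _ he
  let K : Op ((Fin q × Fin s) ⊕ (Fin R ⊕ Fin M)) := Matrix.of fun x x' =>
    (∏ k ∈ Finset.univ.erase i, X k (fun j => x (Sum.inl (k, j))) (fun j => x' (Sum.inl (k, j)))) *
      (if (fun j => x (Sum.inr (Sum.inl j))) = r ∧ (fun j => x' (Sum.inr (Sum.inl j))) = r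
        then 1 else 0) *
      mem (fun j => x (Sum.inr (Sum.inr j))) (fun j => x' (Sum.inr (Sum.inr j)))
  have hY : ∀ Y, tagState (Function.update X i Y) r mem = pull ei Y ⊙ K := by
    intro Y
    ext x x'
    simp only [tagState, hadamard_apply, pull, of_apply, K]
    rw [← Finset.mul_prod_erase _ _ (Finset.mem_univ i), Function.update_self,
      Finset.prod_congr rfl fun k hk => by rw [Function.update_of_ne (Finset.ne_of_mem_erase hk)]]
    simp only [mul_assoc]
    rfl
  have hK : Insensitive₂ ei K := by
    have h1 : ∀ w, (∀ j, w ≠ Sum.inl (i, j)) → ∀ (x : Fin s → Bool) y,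
        Function.extend ei x y w = y w := fun w hw x y =>
      extend_of_notMem _ _ _ fun ⟨j, hj⟩ => hw j hj.symm
    intro x x' y y'
    simp only [K, of_apply]
    congr 1
    · congr 1
      · refine Finset.prod_congr rfl fun k hk => ?_
        have hki := Finset.ne_of_mem_erase hk
        congr 1 <;> funext j <;> exact h1 _ (by simp [hki]) _ _
      · simp only [h1 (Sum.inr _) (by simp)]
    · simp only [h1 (Sum.inr _) (by simp)]
  have h0 := hY (X i)
  rw [Function.update_eq_self] at h0
  rw [h0, applyOn_hadamard hΦ _ hK, applyOn_pull, ← hY]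

end TagState

/-- Adding wires initialised to `|0⟩`. -/
def addAnc {A : Type} (k : ℕ) (ρ : Op A) : Op (A ⊕ Fin k) := Matrix.of fun x x' =>
  if (∀ i, x (Sum.inr i) = false) ∧ (∀ i, x' (Sum.inr i) = false) then
    ρ (x ∘ Sum.inl) (x' ∘ Sum.inl) else 0

section AddAnc

variable {A : Type} [Fintype A] [DecidableEq A] {k : ℕ} {ρ : Op A}

theorem addAnc_eq : addAnc k ρ = pull Function.Embedding.inl ρ ⊙
    indicatorOp fun x : A ⊕ Fin k → Bool => ∀ i, x (Sum.inr i) = false := by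
  ext x x'
  simp only [addAnc, of_apply, hadamard_apply, pull, indicatorOp]
  split_ifs
  · rw [mul_one]; rfl
  · rw [mul_zero]

theorem addAnc_posSemidef (hρ : ρ.PosSemidef) : (addAnc k ρ).PosSemidef := by
  rw [addAnc_eq]
  exact (pull_posSemidef _ hρ).hadamard (indicatorOp_posSemidef _)

theorem addAnc_trace : (addAnc k ρ).trace = ρ.trace := by
  simp only [trace, diag_apply]
  rw [sum_assignment_sum]
  refine Finset.sum_congr rfl fun a _ => ?_
  rw [Finset.sum_eq_single fun _ => false]
  · simp [addAnc]
  · intro b _ hb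
    have : ¬ ∀ i, b i = false := fun h => hb (funext h)
    simp [addAnc, this]
  · simp

theorem applyOn_addAnc {E : Type} [Fintype E] [DecidableEq E] (e : E ↪ A) {Φ : Chan E E}
    (hΦ : Homogeneous Φ) :
    applyOn (e.trans Function.Embedding.inl) Φ (addAnc k ρ) = addAnc k (applyOn e Φ ρ) := by
  rw [addAnc_eq, addAnc_eq, applyOn_hadamard hΦ, applyOn_trans_pull]
  intro x x' y y'
  have h : ∀ (x : E → Bool) (y : A ⊕ Fin k → Bool) i,
      Function.extend (e.trans Function.Embedding.inl) x y (Sum.inr i) = y (Sum.inr i) :=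
    fun x y i => extend_of_notMem _ _ _ (by simp)
  simp only [indicatorOp, of_apply, h]
  congr

end AddAnc

/-! ### Forged tags -/

namespace Forger

variable {n s q : ℕ} (A : Forger n s q)

theorem afterQueries_eq (sign : Chan (Fin n) (Fin s)) (r : Fin A.recLen → Bool) :
    A.afterQueries sign r = tagState (fun i => sign (ketbra (A.msg r i))) r (A.memory r) := rfl

/-- The gates of the forging circuit. -/
def forgeGates :
    List (Gate (((Fin q × Fin s) ⊕ (Fin A.recLen ⊕ Fin A.memLen)) ⊕ Fin A.forge.anc)) :=
  A.forge.gates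

/-- The state before the forging circuit traces out wires, when it is run on `ρ`. -/
def runOn (ρ : Op ((Fin q × Fin s) ⊕ (Fin A.recLen ⊕ Fin A.memLen))) :
    Op (((Fin q × Fin s) ⊕ (Fin A.recLen ⊕ Fin A.memLen)) ⊕ Fin A.forge.anc) :=
  conj (gmat A.forgeGates) (addAnc A.forge.anc ρ)

/-- The wires of the forging circuit, assigned according to the roles they have as outputs. -/
def outWires (b : DescWires n A.steps → Bool) (y : Fin s → Bool) (z : Fin A.forge.traced → Bool) :
    ((Fin q × Fin s) ⊕ (Fin A.recLen ⊕ Fin A.memLen)) ⊕ Fin A.forge.anc → Bool :=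
  fun w => Sum.elim (Sum.elim b y) z (A.forge.out w)

/-- The reduction keeps all wires of the forger, so the forged tag has to be expressed through the
state before any wire is traced out. -/
theorem forgedTag_eq (sign : Chan (Fin n) (Fin s)) (r : Fin A.recLen → Bool)
    (b : DescWires n A.steps → Bool) : A.forgedTag sign r b =
      ∑ z, (A.runOn (A.afterQueries sign r)).submatrix (A.outWires b · z) (A.outWires b · z) := by
  ext y y'
  simp only [Matrix.sum_apply]
  rfl

theorem sum_outWires {α : Type*} [AddCommMonoid α]
    (f : (((Fin q × Fin s) ⊕ (Fin A.recLen ⊕ Fin A.memLen)) ⊕ Fin A.forge.anc → Bool) → α) :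
    ∑ w, f w = ∑ b, ∑ y, ∑ z, f (A.outWires b y z) := by
  rw [← Equiv.sum_comp (Equiv.arrowCongr A.forge.out (Equiv.refl Bool)).symm, sum_assignment_sum,
    sum_assignment_sum]
  rfl

variable {A} {sign : Chan (Fin n) (Fin s)} {r : Fin A.recLen → Bool}

theorem forgedTag_posSemidef (h : ∀ i, (sign (ketbra (A.msg r i))).PosSemidef)
    (b : DescWires n A.steps → Bool) : (A.forgedTag sign r b).PosSemidef := by
  rw [forgedTag_eq, afterQueries_eq]
  exact posSemidef_sum _ fun z _ => ((addAnc_posSemidef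
    (tagState_posSemidef h (A.memory_isDensity r).1)).mul_mul_conjTranspose_same _).submatrix _

theorem sum_forgedTag_trace (h : ∀ i, (sign (ketbra (A.msg r i))).trace = 1) :
    ∑ b, (A.forgedTag sign r b).trace = 1 := by
  have h1 : (A.runOn (A.afterQueries sign r)).trace = 1 := by
    rw [runOn, conj, trace_mul_comm, ← Matrix.mul_assoc, gmat_conjTranspose_mul, Matrix.one_mul,
      addAnc_trace, afterQueries_eq, tagState_trace, (A.memory_isDensity r).2]
    simp [h]
  rw [← h1, trace, A.sum_outWires]
  refine Finset.sum_congr rfl fun b _ => ?_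
  rw [forgedTag_eq]
  simp only [trace, diag_apply, Matrix.sum_apply, submatrix_apply]

end Forger

theorem ketbra_posSemidef {W : Type} (ψ : (W → Bool) → ℂ) [Fintype W] [DecidableEq W] :
    (ketbra ψ).PosSemidef :=
  posSemidef_vecMulVec_self_star ψ

theorem ketbra_trace {W : Type} [Fintype W] [DecidableEq W] {ψ : (W → Bool) → ℂ} (h : IsPure ψ) :
    (ketbra ψ).trace = 1 := by
  rw [ketbra, trace_vecMulVec, dotProduct_comm]; exact h

section Conj

variable {A B : Type} [Fintype A] [DecidableEq A] [Fintype B] [DecidableEq B]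

/-- The channel `ρ ↦ V ρ V†` as a linear map. -/
def conjLin (V : Matrix (B → Bool) (A → Bool) ℂ) : Op A →ₗ[ℂ] Op B where
  toFun := conj V
  map_add' X Y := by simp [conj, Matrix.mul_add, Matrix.add_mul]
  map_smul' c X := by simp [conj]

theorem conj_trace {V : Matrix (B → Bool) (A → Bool) ℂ} (hV : IsIsometry V) (X : Op A) :
    (conj V X).trace = X.trace := by
  rw [conj, trace_mul_comm, ← Matrix.mul_assoc, hV, Matrix.one_mul]

theorem conj_posSemidef (V : Matrix (B → Bool) (A → Bool) ℂ) {X : Op A} (hX : X.PosSemidef) :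
    (conj V X).PosSemidef := hX.mul_mul_conjTranspose_same V

theorem conj_ketbra (V : Matrix (B → Bool) (A → Bool) ℂ) (ψ : (A → Bool) → ℂ) :
    conj V (ketbra ψ) = ketbra (V *ᵥ ψ) := by
  rw [conj, ketbra, ketbra, mul_vecMulVec, vecMulVec_mul, star_mulVec]

end Conj

/-- The advice stores each message, padded by zeros, on the wires of its future tag. A forward query
discards the padding, and this shows that nothing is lost. -/
theorem traceAux_conj_padZero {n m : ℕ} (X : Op (Fin n)) :
    traceAux n m (conj (padZero n m) X) = X := by
  rw [traceAux_eq_sum, Finset.sum_eq_single fun _ => false]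
  · rw [padWith_zero, conj, ← Matrix.mul_assoc, ← Matrix.mul_assoc, ← padWith_zero,
      padWith_isometry, Matrix.one_mul, Matrix.mul_assoc, padWith_isometry, Matrix.mul_one]
  · intro a _ ha
    rw [conj, ← Matrix.mul_assoc, ← Matrix.mul_assoc, ← padWith_zero, padWith_conjTranspose_mul,
      if_neg ha]
    simp
  · simp

end

section

open Matrix

/-! ### The wires of the reduction -/

namespace Forger

variable {n m q : ℕ} (A : Forger n (n + m) q) (T : ℕ)

/-- The wires on which the forger works. -/
abbrev WorkWires : Type :=
  ((Fin q × Fin (n + m)) ⊕ (Fin A.recLen ⊕ Fin A.memLen)) ⊕ Fin A.forge.anc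

/-- Classical ancillas: one for controlled gates, and one ladder for each of `T` tests and for the
final answer. -/
abbrev AuxWires (n T : ℕ) : Type := Unit ⊕ ((Fin T × Fin (n + 1)) ⊕ Fin (T + n + 1))

/-- All wires of the reduction: those of the forger, `T` registers of `n` qubits for the tests, and
ancillas. -/
abbrev AllWires : Type := A.WorkWires ⊕ ((Fin T × Fin n) ⊕ AuxWires n T)

/-- The number of wires of the reduction. -/
def numWires : ℕ := Fintype.card (A.AllWires T)

/-- The wires of the reduction as numbers. -/
def label : A.AllWires T ≃ Fin (A.numWires T) := Fintype.equivFin _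

/-- The wires of the forger. -/
def workE : A.WorkWires ↪ Fin (A.numWires T) :=
  Function.Embedding.inl.trans (A.label T).toEmbedding

/-- The register of the test `j`. -/
def copyE (j : Fin T) : Fin n ↪ Fin (A.numWires T) :=
  ⟨fun i => A.label T (Sum.inr (Sum.inl (j, i))), fun a b h => by simpa using h⟩

/-- The ancillas. -/
def auxE : AuxWires n T ↪ Fin (A.numWires T) :=
  ⟨fun x => A.label T (Sum.inr (Sum.inr x)), fun a b h => by simpa using h⟩

/-- The register of the `i`-th tag. -/
def tagE (i : Fin q) : Fin (n + m) ↪ (Fin q × Fin (n + m)) ⊕ (Fin A.recLen ⊕ Fin A.memLen) :=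
  ⟨fun j => Sum.inl (i, j), fun a b h => by simpa using h⟩

/-- The register of the forged tag. -/
def outE : Fin (n + m) ↪ A.WorkWires :=
  ⟨fun j => A.forge.out.symm (Sum.inl (Sum.inr j)), fun a b h => by simpa using h⟩

/-- The register of the verified message. -/
def verE : Fin n ↪ Fin (A.numWires T) :=
  (Fin.castAddEmb m).trans (A.outE.trans (A.workE T))

/-- The wires of the description of a circuit. -/
def descW (p : Fin A.steps × Fin (gateList n).length) : Fin (A.numWires T) :=
  A.workE T (A.forge.out.symm (Sum.inl (Sum.inl p)))

/-- The ancilla for controlled gates. -/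
def ctlAnc : Fin (A.numWires T) := A.auxE T (Sum.inl ())

theorem workE_ne_copyE (w : A.WorkWires) (j : Fin T) (i : Fin n) :
    A.workE T w ≠ A.copyE T j i := fun h => by
  have := (A.label T).injective h; cases this

theorem workE_ne_auxE (w : A.WorkWires) (x : AuxWires n T) :
    A.workE T w ≠ A.auxE T x := fun h => by
  have := (A.label T).injective h; cases this

theorem copyE_ne_auxE (j : Fin T) (i : Fin n) (x : AuxWires n T) :
    A.copyE T j i ≠ A.auxE T x := fun h => by
  have := (A.label T).injective h; cases this

theorem copyE_ne_copyE {j k : Fin T} (hjk : j ≠ k) (i l : Fin n) :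
    A.copyE T j i ≠ A.copyE T k l := fun h => by
  have := (A.label T).injective h; cases this; exact hjk rfl

theorem descW_notMem_verE (p : Fin A.steps × Fin (gateList n).length) :
    A.descW T p ∉ Set.range (A.verE T) := by
  rintro ⟨i, hi⟩
  have h := A.forge.out.symm.injective ((A.workE T).injective hi)
  cases h

theorem descW_notMem_copyE (p : Fin A.steps × Fin (gateList n).length) (j : Fin T) :
    A.descW T p ∉ Set.range (A.copyE T j) := fun ⟨_, hi⟩ => A.workE_ne_copyE T _ _ _ hi.symm

theorem ctlAnc_notMem_verE : A.ctlAnc T ∉ Set.range (A.verE T) :=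
  fun ⟨_, hi⟩ => A.workE_ne_auxE T _ _ hi

theorem ctlAnc_notMem_copyE (j : Fin T) : A.ctlAnc T ∉ Set.range (A.copyE T j) :=
  fun ⟨_, hi⟩ => A.copyE_ne_auxE T _ _ _ hi

theorem descW_ne_ctlAnc (p : Fin A.steps × Fin (gateList n).length) :
    A.descW T p ≠ A.ctlAnc T := A.workE_ne_auxE T _ _

/-- The assignment of all wires from the assignments of the registers. -/
def assign (w : A.WorkWires → Bool) (c : Fin T → Fin n → Bool) (x : AuxWires n T → Bool) :
    Fin (A.numWires T) → Bool :=
  fun v => Sum.elim w (Sum.elim (fun p => c p.1 p.2) x) ((A.label T).symm v)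

theorem assign_workE (w : A.WorkWires → Bool) (c : Fin T → Fin n → Bool)
    (x : AuxWires n T → Bool) : A.assign T w c x ∘ A.workE T = w := by
  funext i; simp [assign, workE]

theorem assign_copyE (w : A.WorkWires → Bool) (c : Fin T → Fin n → Bool)
    (x : AuxWires n T → Bool) (j : Fin T) : A.assign T w c x ∘ A.copyE T j = c j := by
  funext i
  exact congrArg _ ((A.label T).symm_apply_apply (Sum.inr (Sum.inl (j, i))))

theorem assign_auxE (w : A.WorkWires → Bool) (c : Fin T → Fin n → Bool)
    (x : AuxWires n T → Bool) : A.assign T w c x ∘ A.auxE T = x := by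
  funext i
  exact congrArg _ ((A.label T).symm_apply_apply (Sum.inr (Sum.inr i)))

/-- The initial assignment of the ancillas. -/
def auxInit (n T : ℕ) : AuxWires n T → Bool
  | Sum.inl _ => false
  -- The bottom wire of each ladder holds `true`, the value of the empty conjunction.
  | Sum.inr (Sum.inl p) => decide (p.2 = 0)
  | Sum.inr (Sum.inr i) => decide (i = 0)

theorem sum_assign {α : Type*} [AddCommMonoid α] (f : (Fin (A.numWires T) → Bool) → α) :
    ∑ y, f y = ∑ w, ∑ c, ∑ x, f (A.assign T w c x) := by
  rw [← Equiv.sum_comp (Equiv.arrowCongr (A.label T) (Equiv.refl Bool)), sum_assignment_sum]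
  refine Finset.sum_congr rfl fun w _ => ?_
  rw [sum_assignment_sum, sum_assignment_prod]
  rfl

/-- The classical state of the ancillas. -/
def auxOp : Op (Fin (A.numWires T)) := pull (A.auxE T) (indicatorOp fun x => x = auxInit n T)

theorem auxOp_apply (y : Fin (A.numWires T) → Bool) [Decidable (y ∘ A.auxE T = auxInit n T)] :
    A.auxOp T y y = if y ∘ A.auxE T = auxInit n T then 1 else 0 := by
  simp [auxOp, pull, indicatorOp]

theorem sum_mul_auxOp (f : (Fin (A.numWires T) → Bool) → ℂ) :
    ∑ y, f y * A.auxOp T y y = ∑ w, ∑ c, f (A.assign T w c (auxInit n T)) := by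
  classical
  rw [A.sum_assign T]
  refine Finset.sum_congr rfl fun w _ => Finset.sum_congr rfl fun c _ => ?_
  rw [Finset.sum_eq_single (auxInit n T)]
  · rw [auxOp_apply, assign_auxE, if_pos rfl, mul_one]
  · intro x _ hx
    rw [auxOp_apply, assign_auxE, if_neg hx, mul_zero]
  · simp

/-- The product of operators on the test registers. -/
def copiesOp {V : Type} {T : ℕ} (S : Fin T → Op V) : Op V := Matrix.of fun y y' => ∏ j, S j y y'

/-- The quantum advice of the reduction. -/
def advice (r : Fin A.recLen → Bool) (σ : Op (Fin n)) : Op (Fin (A.numWires T)) :=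
  pull (A.workE T) (addAnc A.forge.anc (tagState
    (fun i => conj (padZero n m) (ketbra (A.msg r i))) r (A.memory r))) ⊙
      (copiesOp (fun j => pull (A.copyE T j) σ) ⊙ A.auxOp T)

theorem advice_isDensity (r : Fin A.recLen → Bool) {σ : Op (Fin n)} (hσ : IsDensity σ) :
    IsDensity (A.advice T r σ) := by
  constructor
  · refine (pull_posSemidef _ (addAnc_posSemidef (tagState_posSemidef (fun i =>
      conj_posSemidef _ (ketbra_posSemidef _)) (A.memory_isDensity r).1))).hadamard
        (PosSemidef.hadamard ?_ (pull_posSemidef _ (indicatorOp_posSemidef _)))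
    exact prod_posSemidef _ fun j _ => pull_posSemidef _ hσ.1
  · have hp : IsIsometry (padZero n m) := padWith_isometry n m _
    have h1 : (addAnc A.forge.anc (tagState (fun i => conj (padZero n m) (ketbra (A.msg r i))) r
        (A.memory r))).trace = 1 := by
      rw [addAnc_trace, tagState_trace, (A.memory_isDensity r).2]
      simp [conj_trace hp, ketbra_trace (A.msg_isPure r _)]
    simp only [trace, diag_apply, advice, hadamard_apply, ← mul_assoc]
    rw [A.sum_mul_auxOp T]
    simp only [copiesOp, pull, of_apply, assign_workE, assign_copyE]
    rw [← h1, trace]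
    refine Finset.sum_congr rfl fun w _ => ?_
    rw [← Finset.mul_sum]
    have h2 : ∑ c : Fin T → Fin n → Bool, ∏ j, σ (c j) (c j) = 1 := by
      rw [sum_prod_pi fun _ b => σ b b]
      exact Finset.prod_eq_one fun _ _ => hσ.2
    exact (congrArg (_ * ·) h2).trans (mul_one _)

/-- The ladder that tests whether the register of the test `j` is zero. -/
def testLadder (j : Fin T) : List (AndNot (Fin (A.numWires T))) :=
  ladder n (fun i => A.auxE T (Sum.inr (Sum.inl (j, i)))) (fun i => A.copyE T j i)
    (fun a b h => by simpa using h) fun _ _ => A.copyE_ne_auxE T _ _ _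

/-- The inputs of the final ladder: the results of the tests and the verified message. -/
def answerInput (i : Fin (T + n)) : Fin (A.numWires T) :=
  Fin.addCases (fun j => A.auxE T (Sum.inr (Sum.inl (j, Fin.last n)))) (fun i => A.verE T i) i

theorem answerInput_ne (i : Fin (T + n)) (k : Fin (T + n + 1)) :
    A.answerInput T i ≠ A.auxE T (Sum.inr (Sum.inr k)) := by
  induction i using Fin.addCases with
  | left j =>
    simp only [answerInput, Fin.addCases_left]
    exact fun h => by simpa using (A.auxE T).injective h
  | right i =>
    simp only [answerInput, Fin.addCases_right]
    exact A.workE_ne_auxE T _ _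

/-- The ladder that computes the answer. -/
def answerLadder : List (AndNot (Fin (A.numWires T))) :=
  ladder (T + n) (fun i => A.auxE T (Sum.inr (Sum.inr i))) (A.answerInput T)
    (fun a b h => by simpa using h) (A.answerInput_ne T)

theorem length_testLadder (j : Fin T) : (A.testLadder T j).length = n := length_ladder _ _ _ _ _

theorem length_answerLadder : (A.answerLadder T).length = T + n := length_ladder _ _ _ _ _

/-- The classical part of the reduction. -/
def classicalPart : List (AndNot (Fin (A.numWires T))) :=
  (List.finRange T).flatMap (A.testLadder T) ++ A.answerLadder T

/-- The gates that uncompute the described circuit on the verified message. -/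
def verInv : List (Gate (Fin (A.numWires T))) :=
  controlledInvList (A.descW T) (A.descW_notMem_verE T) (A.ctlAnc_notMem_verE T)
    (A.descW_ne_ctlAnc T) (describedGates n A.steps)

/-- The gates that uncompute the described circuit on a test register. -/
def copyInv (j : Fin T) : List (Gate (Fin (A.numWires T))) :=
  controlledInvList (A.descW T) (fun p => A.descW_notMem_copyE T p j) (A.ctlAnc_notMem_copyE T j)
    (A.descW_ne_ctlAnc T) (describedGates n A.steps)

/-- The gates of the reduction after the last query. -/
def postGates : List (Gate (Fin (A.numWires T))) :=
  A.verInv T ++ ((List.finRange T).flatMap (A.copyInv T) ++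
    (A.classicalPart T).flatMap AndNot.circuit)

/-- The instructions of the reduction. -/
def program : List (OracleInstr (A.numWires T) n m) :=
  (List.finRange q).map (fun i =>
    OracleInstr.forward (((A.tagE i).trans Function.Embedding.inl).trans (A.workE T))) ++
  ((A.forgeGates.map (Gate.map (A.workE T))).map OracleInstr.gate ++
    (OracleInstr.backward (A.outE.trans (A.workE T)) ::
      (A.postGates T).map OracleInstr.gate))

/-- The distinguisher that runs the forger and checks the forgery. -/
def reduction (r : Fin A.recLen → Bool) (σ : Op (Fin n)) (hσ : IsDensity σ) :
    Distinguisher n m where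
  N := A.numWires T
  advice := A.advice T r σ
  advice_isDensity := A.advice_isDensity T r hσ
  program := A.program T
  out := A.auxE T (Sum.inr (Sum.inr (Fin.last (T + n))))

/-- The flags number at most `A.size`, since the description is an output register of the forger.
Each controlled gate costs at most 81 gates and each reversible gate 38, and 200 leaves room for the
wires. -/
theorem size_reduction_le (r : Fin A.recLen → Bool) (σ : Op (Fin n)) (hσ : IsDensity σ) :
    (A.reduction T r σ hσ).size ≤
      2 * A.size + q + 200 * (T + 1) * (A.size + n + 1) := by
  have h1 : A.numWires T = q * (n + m) + (A.recLen + A.memLen) + A.forge.anc + (T * n +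
      (1 + (T * (n + 1) + (T + n + 1)))) := by
    simp [numWires]
  have h2 : A.size = A.forge.gates.length + (q * (n + m) + (A.recLen + A.memLen) + A.forge.anc) +
      (A.steps * (gateList n).length + (n + m) + A.forge.traced) := by
    simp [Forger.size, GenCircuit.size]
  have hv : (A.verInv T).length ≤ 81 * (A.steps * (gateList n).length) := by
    rw [← length_describedGates]; exact length_controlledInvList_le _ _ _ _ _
  have hc : ∀ j, (A.copyInv T j).length ≤ 81 * (A.steps * (gateList n).length) := fun j => by
    rw [← length_describedGates]; exact length_controlledInvList_le _ _ _ _ _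
  have hcs : ((List.finRange T).flatMap (A.copyInv T)).length ≤
      T * (81 * (A.steps * (gateList n).length)) := by
    rw [List.length_flatMap]
    refine (List.sum_le_card_nsmul _ (81 * (A.steps * (gateList n).length)) fun x hx => ?_).trans
      (by simp)
    obtain ⟨j, -, rfl⟩ := List.mem_map.1 hx
    exact hc j
  have hl : ((A.classicalPart T).flatMap AndNot.circuit).length = (T * n + (T + n)) * 38 := by
    rw [List.length_flatMap]
    simp [AndNot.length_circuit, classicalPart, List.length_flatMap, length_testLadder,
      length_answerLadder]
  have h3 : (A.program T).length = q + (A.forge.gates.length + ((A.verInv T).length +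
      (((List.finRange T).flatMap (A.copyInv T)).length +
        ((A.classicalPart T).flatMap AndNot.circuit).length) + 1)) := by
    simp only [program, postGates, List.length_append, List.length_map, List.length_cons,
      List.length_finRange]
    rfl
  have h4 : (A.reduction T r σ hσ).size = A.numWires T + (A.program T).length := rfl
  rw [h4, h3, hl]
  set g := A.steps * (gateList n).length
  have hg : g ≤ A.size := by omega
  have h5 : T * (81 * g) ≤ T * (81 * A.size) := by gcongr
  have h6 : q * (n + m) + (A.recLen + A.memLen) + A.forge.anc + A.forge.gates.length ≤ A.size := by
    omega
  nlinarith [Nat.zero_le (T * A.size), Nat.zero_le (T * n), Nat.zero_le T, Nat.zero_le n]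

end Forger

end

section

open Matrix

/-! ### The output distribution of the reduction -/

theorem conj_gmat_append {V : Type} [Fintype V] [DecidableEq V] (l l' : List (Gate V)) (ρ : Op V) :
    conj (gmat (l ++ l')) ρ = conj (gmat l') (conj (gmat l) ρ) := by
  simp only [conj, gmat_append, conjTranspose_mul, Matrix.mul_assoc]

theorem foldl_gates {N n m : ℕ} (F : Chan (Fin n) (Fin (n + m))) (G : Chan (Fin (n + m)) (Fin n))
    (l : List (Gate (Fin N))) (ρ : Op (Fin N)) :
    (l.map (OracleInstr.gate (n := n) (m := m))).foldl (fun ρ c => c.apply F G ρ) ρ =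
      conj (gmat l) ρ := by
  induction l generalizing ρ with
  | nil => simp [conj, gmat_nil]
  | cons g l ih =>
    rw [List.map_cons, List.foldl_cons, ih, ← List.singleton_append, conj_gmat_append,
      gmat_singleton]
    rfl

theorem conj_padZero_apply {n m : ℕ} (Y : Op (Fin n)) (x x' : Fin n → Bool) (a : Fin m → Bool) :
    conj (padZero n m) Y (Fin.append x a) (Fin.append x' a) =
      if a = fun _ => false then Y x x' else 0 := by
  have h1 : ∀ z : Fin n → Bool, padZero n m (Fin.append x a) z =
      if a = (fun _ => false) ∧ z = x then 1 else 0 := fun z => by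
    simp [padZero, append_inj, and_comm, eq_comm]
  have h2 : ∀ z : Fin n → Bool, padZero n m (Fin.append x' a) z =
      if a = (fun _ => false) ∧ z = x' then 1 else 0 := fun z => by
    simp [padZero, append_inj, and_comm, eq_comm]
  by_cases ha : a = fun _ => false
  · simp only [conj, mul_apply, conjTranspose_apply, h1, h2]
    simp [ha]
  · simp only [conj, mul_apply, conjTranspose_apply, h1, h2]
    simp [ha]

namespace Forger

variable {n m q : ℕ} (A : Forger n (n + m) q) (T : ℕ)

/-- The part of a state outside the wires of the forger. -/
def restOp (S : Fin T → Op (Fin (A.numWires T))) : Op (Fin (A.numWires T)) :=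
  copiesOp S ⊙ A.auxOp T

theorem insensitive₂_restOp {E : Type} [Fintype E] [DecidableEq E] (e : E ↪ Fin (A.numWires T))
    (h : ∀ i x, e i ≠ A.auxE T x) {S : Fin T → Op (Fin (A.numWires T))}
    (hS : ∀ j, Insensitive₂ e (S j)) : Insensitive₂ e (A.restOp T S) := by
  refine Insensitive₂.hadamard ?_ (insensitive₂_pull h _)
  intro x x' y y'
  simp only [copiesOp, of_apply]
  exact Finset.prod_congr rfl fun j _ => hS j x x' y y'

theorem insensitive₂_restOp_work {E : Type} [Fintype E] [DecidableEq E] (e : E ↪ A.WorkWires)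
    (σ : Op (Fin n)) : Insensitive₂ (e.trans (A.workE T))
      (A.restOp T fun j => pull (A.copyE T j) σ) :=
  A.insensitive₂_restOp T (e.trans (A.workE T)) (fun _ _ => A.workE_ne_auxE T _ _) fun _ =>
    insensitive₂_pull (e := e.trans (A.workE T)) (fun _ _ => A.workE_ne_copyE T _ _ _) _

section Queries

variable (F : Op (Fin n) →ₗ[ℂ] Op (Fin (n + m))) (G : Op (Fin (n + m)) →ₗ[ℂ] Op (Fin n))

theorem homogeneous_forward : Homogeneous fun X => F (traceAux n m X) := fun c X => by
  simp only [traceAux_smul, map_smul]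

theorem homogeneous_backward : Homogeneous fun X => conj (padZero n m) (G X) := fun c X => by
  simp only [map_smul]
  exact (conjLin (padZero n m)).map_smul c _

/-- The list of queries is kept general for the induction; having no repetitions, it never signs an
already signed register. -/
theorem foldl_forward (σ : Op (Fin n)) (r : Fin A.recLen → Bool) (l : List (Fin q)) (hl : l.Nodup)
    (X : Fin q → Op (Fin (n + m))) :
    (l.map fun i => OracleInstr.forward (n := n) (m := m)
      (((A.tagE i).trans Function.Embedding.inl).trans (A.workE T))).foldl
        (fun ρ c => c.apply F G ρ)
        (pull (A.workE T) (addAnc A.forge.anc (tagState X r (A.memory r))) ⊙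
          A.restOp T fun j => pull (A.copyE T j) σ) =
      pull (A.workE T) (addAnc A.forge.anc (tagState
        (fun i => if i ∈ l then F (traceAux n m (X i)) else X i) r (A.memory r))) ⊙
          A.restOp T fun j => pull (A.copyE T j) σ := by
  induction l generalizing X with
  | nil => simp
  | cons i l ih =>
    have hi := (List.nodup_cons.1 hl).1
    have hF := homogeneous_forward (m := m) F
    rw [List.map_cons, List.foldl_cons, OracleInstr.apply,
      applyOn_hadamard hF _ (A.insensitive₂_restOp_work T _ σ), applyOn_trans_pull,
      applyOn_addAnc _ hF, applyOn_tagState i _ (fun _ => rfl) hF, ih (List.nodup_cons.1 hl).2]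
    congr 4
    funext k
    by_cases hk : k = i
    · subst hk; simp [hi]
    · simp [hk]

theorem foldl_queries (σ : Op (Fin n)) (r : Fin A.recLen → Bool) :
    (A.program T).foldl (fun ρ c => c.apply F G ρ) (A.advice T r σ) =
      conj (gmat (A.postGates T)) (pull (A.workE T) (applyOn A.outE
        (fun X => conj (padZero n m) (G X)) (A.runOn (A.afterQueries F r))) ⊙
          A.restOp T fun j => pull (A.copyE T j) σ) := by
  have h1 := A.foldl_forward T F G σ r (List.finRange q) (List.nodup_finRange q)
    fun i => conj (padZero n m) (ketbra (A.msg r i))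
  simp only [List.mem_finRange, if_true, traceAux_conj_padZero] at h1
  rw [program, List.foldl_append, advice]
  rw [restOp] at h1
  rw [h1, ← restOp, ← afterQueries_eq, List.foldl_append, foldl_gates, gmat_map, conj_ctl_hadamard (fun _ _ => rfl),
    conj_ctl_const, applyOn_pull, List.foldl_cons, foldl_gates, OracleInstr.apply,
    applyOn_hadamard (homogeneous_backward G) _ (A.insensitive₂_restOp_work T _ σ),
    applyOn_trans_pull]
  · rfl
  · exact A.insensitive₂_restOp T _ (fun _ _ => A.workE_ne_auxE T _ _) fun j =>
      insensitive₂_pull (fun _ _ => A.workE_ne_copyE T _ _ _) _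

end Queries

theorem conj_ctl_copy {R : Op (Fin (A.numWires T))} (j : Fin T)
    (hR : Insensitive₂ (A.copyE T j) R) {S : Fin T → Op (Fin (A.numWires T))}
    (hS : ∀ k, k ≠ j → Insensitive₂ (A.copyE T j) (S k))
    {M : (Fin (A.numWires T) → Bool) → Op (Fin n)} (hM : Insensitive (A.copyE T j) M) :
    conj (ctl (A.copyE T j) M) (R ⊙ A.restOp T S) =
      R ⊙ A.restOp T (Function.update S j (conj (ctl (A.copyE T j) M) (S j))) := by
  let K : Op (Fin (A.numWires T)) := Matrix.of fun y y' => ∏ k ∈ Finset.univ.erase j, S k y y'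
  have hK : Insensitive₂ (A.copyE T j) K := fun x x' y y' => by
    simp only [K, of_apply]
    exact Finset.prod_congr rfl fun k hk => hS k (Finset.ne_of_mem_erase hk) x x' y y'
  have h1 : ∀ Y, R ⊙ A.restOp T (Function.update S j Y) = Y ⊙ (K ⊙ (A.auxOp T ⊙ R)) := by
    intro Y
    ext y y'
    simp only [hadamard_apply, restOp, copiesOp, of_apply, K]
    rw [← Finset.mul_prod_erase _ _ (Finset.mem_univ j), Function.update_self,
      Finset.prod_congr rfl fun k hk => by rw [Function.update_of_ne (Finset.ne_of_mem_erase hk)]]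
    ring
  have h2 := h1 (S j)
  rw [Function.update_eq_self] at h2
  have haux : Insensitive₂ (A.copyE T j) (A.auxOp T) :=
    insensitive₂_pull (fun _ _ => A.copyE_ne_auxE T _ _ _) _
  rw [h2, conj_ctl_hadamard hM _ (hK.hadamard (haux.hadamard hR)), ← h1]

/-- Once its test has been uncomputed, a factor also depends on the description wires and is no
longer pulled back from its own register. It still ignores the other test registers, and this is the
invariant of the induction. -/
theorem conj_copyInv_list {R : Op (Fin (A.numWires T))}
    (hR : ∀ j, Insensitive₂ (A.copyE T j) R) (σ : Op (Fin n))
    {M : Fin T → (Fin (A.numWires T) → Bool) → Op (Fin n)}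
    (hM : ∀ j k, Insensitive (A.copyE T k) (M j))
    (hMg : ∀ j, gmat (A.copyInv T j) = ctl (A.copyE T j) (M j)) (l : List (Fin T)) (hl : l.Nodup)
    (S : Fin T → Op (Fin (A.numWires T))) (hS : ∀ j ∈ l, S j = pull (A.copyE T j) σ)
    (hS' : ∀ j k, k ≠ j → Insensitive₂ (A.copyE T j) (S k)) :
    conj (gmat (l.flatMap (A.copyInv T))) (R ⊙ A.restOp T S) =
      R ⊙ A.restOp T fun j => if j ∈ l then
        conj (ctl (A.copyE T j) (M j)) (pull (A.copyE T j) σ) else S j := by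
  induction l generalizing S with
  | nil => simp [conj, gmat_nil]
  | cons j l ih =>
    have hj := (List.nodup_cons.1 hl).1
    rw [List.flatMap_cons, conj_gmat_append, hMg,
      A.conj_ctl_copy T j (hR j) (fun k hk => hS' j k hk) (hM j j), ih (List.nodup_cons.1 hl).2]
    · congr 2
      funext k
      by_cases hk : k = j
      · subst hk; simp [hj, hS k]
      · simp [hk]
    · intro k hk
      rw [Function.update_of_ne (fun h : k = j => hj (h ▸ hk)), hS k (List.mem_cons_of_mem _ hk)]
    · intro k i hik
      by_cases hi : i = j
      · subst hi
        rw [Function.update_self]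
        exact insensitive₂_conj_ctl (A.copyE_ne_copyE T hik.symm) (hM i i) (hM i k)
          (hS' k i hik)
      · rw [Function.update_of_ne hi]
        exact hS' k i hik

/-! #### The classical part -/

theorem actList_append {V : Type} [DecidableEq V] [Fintype V] (l l' : List (AndNot V))
    (y : V → Bool) : actList (l ++ l') y = actList l' (actList l y) := by
  simp only [actList, List.foldl_append]

theorem actList_testLadders (l : List (Fin T)) (hl : l.Nodup) (y : Fin (A.numWires T) → Bool)
    (h0 : ∀ j ∈ l, y (A.auxE T (Sum.inr (Sum.inl (j, 0)))) = true)
    (h1 : ∀ j ∈ l, ∀ i : Fin n, y (A.auxE T (Sum.inr (Sum.inl (j, i.succ)))) = false) :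
    (∀ v, (∀ j ∈ l, ∀ i : Fin n, v ≠ A.auxE T (Sum.inr (Sum.inl (j, i.succ)))) →
      actList (l.flatMap (A.testLadder T)) y v = y v) ∧
    ∀ j ∈ l, actList (l.flatMap (A.testLadder T)) y
      (A.auxE T (Sum.inr (Sum.inl (j, Fin.last n)))) =
        decide (∀ i, y (A.copyE T j i) = false) := by
  induction l generalizing y with
  | nil => simp [actList]
  | cons j l ih =>
    have hj := (List.nodup_cons.1 hl).1
    have hne : ∀ k ∈ l, ∀ a b, A.auxE T (Sum.inr (Sum.inl (k, a))) ≠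
        A.auxE T (Sum.inr (Sum.inl (j, b))) := fun k hk a b h => by
      have h' := (A.auxE T).injective h
      simp only [Sum.inr.injEq, Sum.inl.injEq, Prod.mk.injEq] at h'
      exact hj (h'.1 ▸ hk)
    obtain ⟨ha, hb⟩ := actList_ladder n (fun i => A.auxE T (Sum.inr (Sum.inl (j, i))))
      (fun i => A.copyE T j i) (fun a b h => by simpa using h)
      (fun _ _ => A.copyE_ne_auxE T _ _ _) y fun i => h1 j List.mem_cons_self i
    change ∀ w, _ → actList (A.testLadder T j) y w = y w at ha
    change actList (A.testLadder T j) y _ = _ at hb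
    rw [h0 j List.mem_cons_self, Bool.true_and] at hb
    set y' := actList (A.testLadder T j) y with hy'
    obtain ⟨hc, hd⟩ := ih (List.nodup_cons.1 hl).2 y'
      (fun k hk => by
        rw [ha _ fun i => hne k hk _ _]; exact h0 k (List.mem_cons_of_mem _ hk))
      (fun k hk i => by
        rw [ha _ fun i => hne k hk _ _]; exact h1 k (List.mem_cons_of_mem _ hk) i)
    rw [List.flatMap_cons, actList_append, ← hy']
    refine ⟨fun v hv => ?_, fun k hk => ?_⟩
    · rw [hc v fun k hk => hv k (List.mem_cons_of_mem _ hk), ha v (hv j List.mem_cons_self)]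
    · rcases List.mem_cons.1 hk with rfl | hk
      · rw [hc _ fun i hi l => (hne i hi _ _).symm, hb]
      · rw [hd k hk]
        have : ∀ i, y' (A.copyE T k i) = y (A.copyE T k i) := fun i =>
          ha _ fun _ => A.copyE_ne_auxE T _ _ _
        simp only [this]

/-- Ladders conjoin negated inputs. A test ladder reports that its copy reads `0^n`, and the answer
ladder negates this report while also requiring the verified message to be zero. -/
theorem actList_classicalPart (y : Fin (A.numWires T) → Bool)
    (hy : y ∘ A.auxE T = auxInit n T) : actList (A.classicalPart T) y
      (A.auxE T (Sum.inr (Sum.inr (Fin.last (T + n))))) =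
        (decide (∀ j, y ∘ A.copyE T j ≠ fun _ => false) &&
          decide (y ∘ A.verE T = fun _ => false)) := by
  have hy' : ∀ x, y (A.auxE T x) = auxInit n T x := fun x => congrFun hy x
  obtain ⟨ha, hb⟩ := A.actList_testLadders T (List.finRange T) (List.nodup_finRange T) y
    (fun j _ => by simp [hy', auxInit]) fun j _ i => by simp [hy', auxInit]
  rw [classicalPart, actList_append]
  set z := actList ((List.finRange T).flatMap (A.testLadder T)) y
  have hz : ∀ k, z (A.auxE T (Sum.inr (Sum.inr k))) = auxInit n T (Sum.inr (Sum.inr k)) := by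
    intro k
    rw [ha _ fun j _ i h => by simpa using (A.auxE T).injective h, hy']
  obtain ⟨-, hd⟩ := actList_ladder (T + n) (fun i => A.auxE T (Sum.inr (Sum.inr i)))
    (A.answerInput T) (fun a b h => by simpa using h) (A.answerInput_ne T) z fun i => by
      simp [hz, auxInit]
  change actList (A.answerLadder T) z _ = _ at hd
  rw [hd, hz, Bool.eq_iff_iff]
  have hv : ∀ i, z (A.verE T i) = y (A.verE T i) := fun i =>
    ha _ fun _ _ _ => A.workE_ne_auxE T _ _
  simp only [auxInit, decide_true, Bool.true_and, Bool.and_eq_true, decide_eq_true_eq]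
  have hsplit : (∀ i, z (A.answerInput T i) = false) ↔
      (∀ j, z (A.auxE T (Sum.inr (Sum.inl (j, Fin.last n)))) = false) ∧
        ∀ i, z (A.verE T i) = false := by
    constructor
    · intro h
      refine ⟨fun j => ?_, fun i => ?_⟩
      · simpa [answerInput] using h (Fin.castAdd n j)
      · simpa [answerInput] using h (Fin.natAdd T i)
    · rintro ⟨h, h'⟩ i
      induction i using Fin.addCases with
      | left j => simpa [answerInput] using h j
      | right i => simpa [answerInput] using h' i
  rw [hsplit]
  refine and_congr (forall_congr' fun j => ?_) ?_
  · rw [hb j (List.mem_finRange j), decide_eq_false_iff_not, ne_eq, funext_iff]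
    rfl
  · simp only [hv, funext_iff]
    rfl

end Forger

end

/-! ### Closed form of the acceptance probability -/

section

open Matrix

namespace Forger

variable {n m q : ℕ} (A : Forger n (n + m) q) (T : ℕ)

theorem outWires_outE (b : DescWires n A.steps → Bool) (t : Fin (n + m) → Bool)
    (z : Fin A.forge.traced → Bool) : A.outWires b t z ∘ A.outE = t := by
  funext j
  change Sum.elim (Sum.elim b t) z (A.forge.out (A.forge.out.symm (Sum.inl (Sum.inr j)))) = t j
  rw [Equiv.apply_symm_apply]
  rfl

theorem extend_outE (b : DescWires n A.steps → Bool) (t t' : Fin (n + m) → Bool)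
    (z : Fin A.forge.traced → Bool) :
    Function.extend A.outE t (A.outWires b t' z) = A.outWires b t z := by
  have h : ∀ w, w ∉ Set.range A.outE → A.outWires b t z w = A.outWires b t' z w := by
    intro w hw
    obtain ⟨u, rfl⟩ := A.forge.out.symm.surjective w
    rcases u with (u | u) | u
    · simp [outWires]
    · exact absurd ⟨u, rfl⟩ hw
    · simp [outWires]
  rw [← extend_eq_of_agree A.outE h, outWires_outE]

theorem extend_castAdd_outE (b : DescWires n A.steps → Bool) (v x : Fin n → Bool)
    (a : Fin m → Bool) (z : Fin A.forge.traced → Bool) :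
    Function.extend ((Fin.castAddEmb m).trans A.outE) x (A.outWires b (Fin.append v a) z) =
      A.outWires b (Fin.append x a) z := by
  have h : ∀ w, w ∉ Set.range ((Fin.castAddEmb m).trans A.outE) →
      A.outWires b (Fin.append x a) z w = A.outWires b (Fin.append v a) z w := by
    intro w hw
    obtain ⟨u, rfl⟩ := A.forge.out.symm.surjective w
    rcases u with (u | u) | u
    · simp [outWires]
    · induction u using Fin.addCases with
      | left i => exact absurd ⟨i, rfl⟩ hw
      | right i => simp [outWires]
    · simp [outWires]
  have h2 : A.outWires b (Fin.append x a) z ∘ ((Fin.castAddEmb m).trans A.outE) = x := by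
    have := congrArg (· ∘ Fin.castAdd m) (A.outWires_outE b (Fin.append x a) z)
    refine Eq.trans this ?_
    funext i
    simp
  have h3 := extend_eq_of_agree _ h
  rwa [h2] at h3

theorem block_outE (Φ : Chan (Fin (n + m)) (Fin (n + m))) (ρ : Op A.WorkWires)
    (b : DescWires n A.steps → Bool) (v : Fin n → Bool) (a : Fin m → Bool)
    (z : Fin A.forge.traced → Bool) (x x' : Fin n → Bool) :
    block ((Fin.castAddEmb m).trans A.outE) (applyOn A.outE Φ ρ)
      (A.outWires b (Fin.append v a) z) (A.outWires b (Fin.append v a) z) x x' =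
      Φ (ρ.submatrix (A.outWires b · z) (A.outWires b · z)) (Fin.append x a) (Fin.append x' a) := by
  simp only [block, of_apply, extend_castAdd_outE]
  simp only [applyOn, of_apply, extend_outE, outWires_outE]
  rfl

/-- A choice of the unitaries applied by the controlled inverse of the described circuit. -/
theorem exists_verInv : ∃ M : (Fin (A.numWires T) → Bool) → Op (Fin n),
    Insensitive (A.verE T) M ∧ (∀ j, Insensitive (A.copyE T j) M) ∧
      gmat (A.verInv T) = ctl (A.verE T) M ∧
      ∀ y, y (A.ctlAnc T) = false →
        M y = (describedUnitary fun p => y (A.descW T p))ᴴ := by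
  obtain ⟨M, h1, h2, h3⟩ := gmat_controlledInvList (A.descW T) (A.descW_notMem_verE T)
    (A.ctlAnc_notMem_verE T) (A.descW_ne_ctlAnc T) (describedGates n A.steps)
  refine ⟨M, fun x y => h1 _ _ (fun p => extend_of_notMem _ _ _ (A.descW_notMem_verE T p))
    (extend_of_notMem _ _ _ (A.ctlAnc_notMem_verE T)), fun j x y => h1 _ _
      (fun p => extend_of_notMem _ _ _ (A.descW_notMem_copyE T p j))
      (extend_of_notMem _ _ _ (A.ctlAnc_notMem_copyE T j)), h2, fun y hy => ?_⟩
  rw [h3 y hy, describedUnitary_eq]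

theorem exists_copyInv (j : Fin T) : ∃ M : (Fin (A.numWires T) → Bool) → Op (Fin n),
    (∀ k, Insensitive (A.copyE T k) M) ∧ gmat (A.copyInv T j) = ctl (A.copyE T j) M ∧
      ∀ y, y (A.ctlAnc T) = false →
        M y = (describedUnitary fun p => y (A.descW T p))ᴴ := by
  obtain ⟨M, h1, h2, h3⟩ := gmat_controlledInvList (A.descW T)
    (fun p => A.descW_notMem_copyE T p j) (A.ctlAnc_notMem_copyE T j) (A.descW_ne_ctlAnc T)
    (describedGates n A.steps)
  refine ⟨M, fun j x y => h1 _ _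
      (fun p => extend_of_notMem _ _ _ (A.descW_notMem_copyE T p j))
      (extend_of_notMem _ _ _ (A.ctlAnc_notMem_copyE T j)), h2, fun y hy => ?_⟩
  rw [h3 y hy, describedUnitary_eq]

/-- The copies are independent, and since the total weight is one, each of them misses `0^n` with
the complementary probability. -/
theorem sum_tests (C σ : Op (Fin n)) (hC : (Cᴴ * σ * C).trace = 1) :
    ∑ c : Fin T → Fin n → Bool, ∏ j, (if c j = (fun _ => false) then 0 else
      (Cᴴ * σ * C) (c j) (c j)) =
        (1 - (Cᴴ * σ * C) (fun _ => false) (fun _ => false)) ^ T := by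
  rw [sum_prod_pi fun _ b => if b = (fun _ => false) then 0 else (Cᴴ * σ * C) b b,
    Finset.prod_const, Finset.card_univ, Fintype.card_fin]
  congr 1
  rw [← hC, trace, ← Finset.add_sum_erase _ _ (Finset.mem_univ fun _ => false),
    ← Finset.add_sum_erase _ (fun b => diag (Cᴴ * σ * C) b) (Finset.mem_univ fun _ => false),
    if_pos rfl, zero_add, diag_apply, add_sub_cancel_left]
  exact Finset.sum_congr rfl fun b hb => if_neg (Finset.ne_of_mem_erase hb)

theorem describedUnitary_mul_conjTranspose {s : ℕ} (b : DescWires n s → Bool) :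
    describedUnitary b * (describedUnitary b)ᴴ = 1 := by
  rw [describedUnitary_eq]
  exact mul_eq_one_comm.1 (gmat_conjTranspose_mul _)

/-- Only diagonal entries matter after the last query. There the description wires have a value `b`,
so the controlled inverses apply the adjoint of the same unitary to the verified message and to all
copies, and the tests factor out as a power. -/
theorem prob_reduction (F : Op (Fin n) →ₗ[ℂ] Op (Fin (n + m)))
    (G : Op (Fin (n + m)) →ₗ[ℂ] Op (Fin n)) (r : Fin A.recLen → Bool) (σ : Op (Fin n))
    (hσ : IsDensity σ) : (A.reduction T r σ hσ).prob F G =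
      (∑ b, ((describedUnitary b)ᴴ * G (A.forgedTag F r b) * describedUnitary b)
        (fun _ => false) (fun _ => false) *
          (1 - ((describedUnitary b)ᴴ * σ * describedUnitary b)
            (fun _ => false) (fun _ => false)) ^ T).re := by
  classical
  obtain ⟨Mv, hMv, hMvc, hMvg, hMvy⟩ := A.exists_verInv T
  choose Mc hMc hMcg hMcy using A.exists_copyInv T
  set τ := applyOn A.outE (fun X => conj (padZero n m) (G X)) (A.runOn (A.afterQueries F r)) with hτ
  set R := conj (ctl (A.verE T) Mv) (pull (A.workE T) τ) with hR
  have hfin : (A.reduction T r σ hσ).finalState F G =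
      conj (gmat ((A.classicalPart T).flatMap AndNot.circuit)) (R ⊙ A.restOp T fun j =>
        conj (ctl (A.copyE T j) (Mc j)) (pull (A.copyE T j) σ)) := by
    have h1 := A.foldl_queries T F G σ r
    rw [← hτ, postGates, conj_gmat_append, conj_gmat_append, hMvg, conj_ctl_hadamard hMv,
      A.conj_copyInv_list T ?_ σ (fun j k => hMc j k) hMcg _ (List.nodup_finRange T) _
        (fun _ _ => rfl) ?_] at h1
    · simp only [List.mem_finRange, if_true] at h1
      exact h1
    · intro j
      have h2 : Insensitive₂ (A.copyE T j) (pull (A.workE T) τ) :=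
        insensitive₂_pull (fun i w => (A.workE_ne_copyE T w j i).symm) τ
      have h3 : ∀ i k, A.copyE T j i ≠ A.verE T k := fun i k => (A.workE_ne_copyE T _ j i).symm
      exact insensitive₂_conj_ctl h3 hMv (hMvc j) h2
    · intro j k hjk
      exact insensitive₂_pull (A.copyE_ne_copyE T hjk.symm) _
    · exact A.insensitive₂_restOp_work T ((Fin.castAddEmb m).trans A.outE) σ
  -- The contribution of one assignment: description `b`, verified message `v`, the wires `a` reset
  -- by the backward query, wires `z` that the forger would have traced out, and copies `c`.
  have hterm : ∀ b v a z c,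
      (if actList (A.classicalPart T) (A.assign T (A.outWires b (Fin.append v a) z) c
          (auxInit n T)) (A.auxE T (Sum.inr (Sum.inr (Fin.last (T + n))))) = true
        then (1 : ℂ) else 0) *
      (R (A.assign T (A.outWires b (Fin.append v a) z) c (auxInit n T))
        (A.assign T (A.outWires b (Fin.append v a) z) c (auxInit n T)) *
      ∏ j, conj (ctl (A.copyE T j) (Mc j)) (pull (A.copyE T j) σ)
        (A.assign T (A.outWires b (Fin.append v a) z) c (auxInit n T))
        (A.assign T (A.outWires b (Fin.append v a) z) c (auxInit n T))) =
      if a = (fun _ => false) ∧ v = (fun _ => false) then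
        ((describedUnitary b)ᴴ * G ((A.runOn (A.afterQueries F r)).submatrix
          (A.outWires b · z) (A.outWires b · z)) * describedUnitary b)
          (fun _ => false) (fun _ => false) *
        ∏ j, (if c j = (fun _ => false) then 0 else
          ((describedUnitary b)ᴴ * σ * describedUnitary b) (c j) (c j)) else 0 := by
    intro b v a z c
    set y := A.assign T (A.outWires b (Fin.append v a) z) c (auxInit n T) with hy
    have hw : y ∘ A.workE T = A.outWires b (Fin.append v a) z := A.assign_workE T _ _ _
    have hc : ∀ j, y ∘ A.copyE T j = c j := A.assign_copyE T _ _ _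
    have hx : y ∘ A.auxE T = auxInit n T := A.assign_auxE T _ _ _
    have hv : y ∘ A.verE T = v := by
      have h1 := congrArg (· ∘ A.outE) hw
      simp only [outWires_outE] at h1
      funext i
      have h2 := congrFun h1 (Fin.castAdd m i)
      rw [Fin.append_left] at h2
      exact h2
    have ha : y (A.ctlAnc T) = false := congrFun hx (Sum.inl ())
    have hd : (fun p => y (A.descW T p)) = b := by
      funext p
      have h2 := congrFun hw (A.forge.out.symm (Sum.inl (Sum.inl p)))
      refine h2.trans ?_
      simp [outWires]
    have hblock : block (A.verE T) (pull (A.workE T) τ) y y = if a = (fun _ => false) then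
        G ((A.runOn (A.afterQueries F r)).submatrix (A.outWires b · z) (A.outWires b · z))
        else 0 := by
      have h1 : A.verE T = ((Fin.castAddEmb m).trans A.outE).trans (A.workE T) := rfl
      rw [h1, block_trans_pull, hw]
      ext x x'
      rw [hτ, block_outE, conj_padZero_apply]
      split_ifs <;> rfl
    have hRy : R y y = if a = (fun _ => false) then
        ((describedUnitary b)ᴴ * G ((A.runOn (A.afterQueries F r)).submatrix
          (A.outWires b · z) (A.outWires b · z)) * describedUnitary b) v v else 0 := by
      rw [hR, conj_ctl_apply _ hMv, hMvy y ha, hd, hv, hblock, conjTranspose_conjTranspose]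
      split_ifs
      · rfl
      · rw [Matrix.mul_zero, Matrix.zero_mul, Matrix.zero_apply]
    have hSy : ∀ j, conj (ctl (A.copyE T j) (Mc j)) (pull (A.copyE T j) σ) y y =
        ((describedUnitary b)ᴴ * σ * describedUnitary b) (c j) (c j) := fun j => by
      rw [conj_ctl_apply _ (hMc j j), hMcy j y ha, hd, hc, block_pull, conjTranspose_conjTranspose]
    rw [A.actList_classicalPart T y hx, hv, hRy]
    simp only [hc, hSy]
    by_cases h1 : a = fun _ => false
    · by_cases h2 : v = fun _ => false
      · simp only [h1, h2, and_self, if_true, decide_true, Bool.and_true, decide_eq_true_eq]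
        by_cases h3 : ∀ j, c j ≠ fun _ => false
        · rw [if_pos h3, one_mul]
          simp only [h3, if_false]
        · rw [if_neg h3, zero_mul]
          push Not at h3
          obtain ⟨j, hj⟩ := h3
          symm
          refine mul_eq_zero_of_right _ ?_
          refine Finset.prod_eq_zero (i := j) (Finset.mem_univ j) ?_
          exact if_pos hj
      · simp [h2]
    · simp [h1]
  have hout : (A.reduction T r σ hσ).out = A.auxE T (Sum.inr (Sum.inr (Fin.last (T + n)))) := rfl
  have hsum : (A.reduction T r σ hσ).prob F G = (∑ y : Fin (A.numWires T) → Bool,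
      (if y (A.auxE T (Sum.inr (Sum.inr (Fin.last (T + n))))) = true then (1 : ℂ) else 0) *
        (A.reduction T r σ hσ).finalState F G y y).re := by
    rw [Complex.re_sum]
    refine Finset.sum_congr rfl fun y _ => ?_
    rw [hout]
    split_ifs
    · rw [one_mul]
    · rw [zero_mul, Complex.zero_re]
  rw [hsum, hfin, sum_conj_circuit (A.classicalPart T) _ fun y =>
    if y (A.auxE T (Sum.inr (Sum.inr (Fin.last (T + n))))) = true then (1 : ℂ) else 0]
  conv_lhs => simp only [restOp, hadamard_apply, ← mul_assoc]
  rw [A.sum_mul_auxOp T]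
  conv_lhs => simp only [mul_assoc, copiesOp, of_apply]
  rw [A.sum_outWires]
  congr 1
  refine Finset.sum_congr rfl fun b _ => ?_
  rw [sum_assignment_append]
  simp only [hterm]
  rw [Finset.sum_eq_single fun _ => false, Finset.sum_eq_single fun _ => false]
  · simp only [and_self, if_true]
    simp_rw [← Finset.mul_sum]
    have htr : ((describedUnitary b)ᴴ * σ * describedUnitary b).trace = 1 := by
      rw [trace_mul_comm, ← Matrix.mul_assoc, describedUnitary_mul_conjTranspose, Matrix.one_mul,
        hσ.2]
    rw [← Finset.sum_mul, sum_tests T _ _ htr, forgedTag_eq, map_sum, Matrix.mul_sum,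
      Matrix.sum_mul, Matrix.sum_apply]
  · intro a _ ha
    simp [ha]
  · simp
  · intro v _ hv
    simp [hv]
  · simp

end Forger

end

section

open Matrix MeasureTheory

/-! ### Estimates of quadratic forms -/

section QForm

variable {I : Type*} [Fintype I] [DecidableEq I]

theorem qform_smul (c : ℂ) (φ : I → ℂ) (X : Matrix I I ℂ) :
    qform (c • φ) X = star c * c * qform φ X := by
  simp only [qform, star_smul, mulVec_smul, dotProduct_smul, smul_dotProduct, smul_eq_mul]
  ring

theorem re_star_dotProduct_self_nonneg (φ : I → ℂ) : 0 ≤ (star φ ⬝ᵥ φ).re :=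
  (Complex.le_def.1 (dotProduct_star_self_nonneg φ)).1

theorem star_dotProduct_self_eq (φ : I → ℂ) : star φ ⬝ᵥ φ = ((star φ ⬝ᵥ φ).re : ℂ) := by
  have h := (Complex.le_def.1 (dotProduct_star_self_nonneg φ)).2
  exact Complex.ext rfl h.symm

/-- A normalised vector is an isometry with a single column, so the bound for columns applies after
rescaling. -/
theorem re_qform_le {X : Matrix I I ℂ} (hX : X.PosSemidef) (φ : I → ℂ) :
    (qform φ X).re ≤ (star φ ⬝ᵥ φ).re * X.trace.re := by
  by_cases h0 : φ = 0
  · simp [h0, qform]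
  set p := (star φ ⬝ᵥ φ).re with hp
  have hp0 : 0 < p := by
    refine lt_of_le_of_ne (re_star_dotProduct_self_nonneg φ) fun h => h0 ?_
    have := star_dotProduct_self_eq φ
    rw [← hp, ← h, Complex.ofReal_zero] at this
    simpa using this
  have hsq : (√p : ℂ) * √p = p := by rw [← Complex.ofReal_mul, Real.mul_self_sqrt hp0.le]
  have hs0 : (√p : ℂ) ≠ 0 := by simpa using (Real.sqrt_pos.2 hp0).ne'
  let A : Matrix I Unit ℂ := Matrix.of fun i _ => (√p : ℂ)⁻¹ * φ i
  have hA1 : A *ᵥ Pi.single () 1 = (√p : ℂ)⁻¹ • φ := by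
    ext i; simp [A]
  have hA : Aᴴ * A = 1 := by
    ext i j
    have : (Aᴴ * A) i j = ((√p : ℂ) * √p)⁻¹ * (star φ ⬝ᵥ φ) := by
      simp only [mul_apply, conjTranspose_apply, A, of_apply, dotProduct, Finset.mul_sum,
        Pi.star_apply, star_mul', mul_inv]
      refine Finset.sum_congr rfl fun x _ => ?_
      have : star (√p : ℂ)⁻¹ = (√p : ℂ)⁻¹ := by simp
      rw [this]; ring
    rw [this, hsq, star_dotProduct_self_eq, ← hp, inv_mul_cancel₀]
    · rfl
    · exact_mod_cast hp0.ne'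
  have h := sum_qform_columns_le hA hX
  rw [Fintype.sum_unique] at h
  change (qform (A *ᵥ Pi.single () 1) X).re ≤ _ at h
  rw [hA1, qform_smul] at h
  have h2 : star (√p : ℂ)⁻¹ * (√p : ℂ)⁻¹ = ((p⁻¹ : ℝ) : ℂ) := by
    have : star (√p : ℂ)⁻¹ = (√p : ℂ)⁻¹ := by simp
    rw [this, ← mul_inv, hsq, Complex.ofReal_inv]
  rw [h2, Complex.re_ofReal_mul, inv_mul_le_iff₀ hp0] at h
  exact h

/-- The parallelogram law, with the nonnegative form at `φ - χ` dropped. -/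
theorem re_qform_add_le {X : Matrix I I ℂ} (hX : X.PosSemidef) (φ χ : I → ℂ) :
    (qform (φ + χ) X).re ≤ 2 * (qform φ X).re + 2 * (qform χ X).re := by
  have h1 : qform (φ + χ) X + qform (φ - χ) X = 2 * qform φ X + 2 * qform χ X := by
    simp only [qform, star_add, star_sub, mulVec_add, mulVec_sub, dotProduct_add, dotProduct_sub,
      add_dotProduct, sub_dotProduct]
    ring
  have h2 := congrArg Complex.re h1
  simp only [Complex.add_re, Complex.mul_re, Complex.re_ofNat, Complex.im_ofNat, zero_mul,
    sub_zero] at h2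
  linarith [qform_nonneg hX (φ - χ)]

theorem qform_eq_re {X : Matrix I I ℂ} (hX : X.PosSemidef) (φ : I → ℂ) :
    qform φ X = ((qform φ X).re : ℂ) := by
  have h := (Complex.le_def.1 (hX.dotProduct_mulVec_nonneg φ)).2
  exact Complex.ext rfl h.symm

/-- Bernoulli gives `T * x ≤ (1 + x) ^ T`, and `(1 - x) * (1 + x) ≤ 1`. -/
theorem mul_one_sub_pow_le {x : ℝ} (h0 : 0 ≤ x) (h1 : x ≤ 1) (T : ℕ) :
    (1 - x) ^ T * (T * x) ≤ 1 := by
  have h2 : (1 - x) ^ T * (1 + x) ^ T ≤ 1 := by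
    rw [← mul_pow]
    exact pow_le_one₀ (mul_nonneg (by linarith) (by linarith)) (by nlinarith)
  have h3 : (T : ℝ) * x ≤ (1 + x) ^ T := by
    linarith [one_add_mul_le_pow (show (-2 : ℝ) ≤ x by linarith) T]
  exact (mul_le_mul_of_nonneg_left h3 (pow_nonneg (by linarith) T)).trans h2

end QForm

/-- `T` copies of a state `σ` allow to test whether a vector is orthogonal to the columns
of `E`. -/
structure TestState {n s : ℕ} (E : Matrix (Fin n → Bool) (Fin s) ℂ) (t : ℕ) where
  T : ℕ
  T_le : T ≤ t * s
  σ : Op (Fin n)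
  isDensity : IsDensity σ
  complete : ∀ φ, Eᴴ *ᵥ φ = 0 → (1 - (qform φ σ).re) ^ T = 1
  sound : ∀ φ, star φ ⬝ᵥ φ = 1 →
    t * ((1 - (qform φ σ).re) ^ T * (star (Eᴴ *ᵥ φ) ⬝ᵥ (Eᴴ *ᵥ φ)).re) ≤ 1

theorem IsDensity.re_qform_le_one {W : Type} [Fintype W] [DecidableEq W] {σ : Op W}
    (hσ : IsDensity σ) {φ : (W → Bool) → ℂ} (hφ : star φ ⬝ᵥ φ = 1) : (qform φ σ).re ≤ 1 := by
  have := re_qform_le hσ.1 φ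
  rwa [hφ, hσ.2, Complex.one_re, one_mul] at this

/-- Take `σ = E Eᴴ / s`, which overlaps with `φ` by `x = ‖Eᴴ φ‖² / s`. With `T = t * s` copies, `T *
x = t * ‖Eᴴ φ‖²`, so soundness is `mul_one_sub_pow_le`. For `s = 0` there is nothing to test, and no
copies are used. -/
theorem exists_testState {n s : ℕ} {E : Matrix (Fin n → Bool) (Fin s) ℂ} (hE : Eᴴ * E = 1)
    (t : ℕ) : Nonempty (TestState E t) := by
  rcases Nat.eq_zero_or_pos s with rfl | hs
  · have hp : IsPure (Pi.single (fun _ => false) 1 : (Fin n → Bool) → ℂ) := by simp [IsPure]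
    refine ⟨⟨0, le_rfl, _, ⟨ketbra_posSemidef _, ketbra_trace hp⟩, fun φ _ => pow_zero _,
      fun φ _ => ?_⟩⟩
    simp [dotProduct]
  · have hs' : (s : ℂ) ≠ 0 := by exact_mod_cast hs.ne'
    have hsr : (0 : ℝ) < s := by exact_mod_cast hs
    have hd : IsDensity ((s : ℂ)⁻¹ • (E * Eᴴ)) := by
      constructor
      · refine (posSemidef_self_mul_conjTranspose E).smul ?_
        rw [← Complex.ofReal_natCast, ← Complex.ofReal_inv]
        exact_mod_cast (inv_pos.2 hsr).le
      · rw [trace_smul, trace_mul_comm, hE, trace_one, Fintype.card_fin, smul_eq_mul,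
          inv_mul_cancel₀ hs']
    have hq : ∀ φ, s * (qform φ ((s : ℂ)⁻¹ • (E * Eᴴ))).re =
        (star (Eᴴ *ᵥ φ) ⬝ᵥ (Eᴴ *ᵥ φ)).re := by
      intro φ
      have h1 : qform φ ((s : ℂ)⁻¹ • (E * Eᴴ)) = (s : ℂ)⁻¹ * (star (Eᴴ *ᵥ φ) ⬝ᵥ (Eᴴ *ᵥ φ)) := by
        rw [qform, smul_mulVec, dotProduct_smul, smul_eq_mul, star_mulVec,
          conjTranspose_conjTranspose, ← mulVec_mulVec, dotProduct_mulVec]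
      rw [h1, ← Complex.ofReal_natCast, ← Complex.ofReal_inv, Complex.re_ofReal_mul,
        mul_inv_cancel_left₀ hsr.ne']
    refine ⟨⟨t * s, le_rfl, _, hd, fun φ hφ => ?_, fun φ hφ => ?_⟩⟩
    · have h := hq φ
      rw [hφ] at h
      simp only [star_zero, zero_dotProduct, Complex.zero_re, mul_eq_zero, hsr.ne',
        false_or] at h
      rw [h, sub_zero, one_pow]
    · rw [← hq]
      have h := mul_one_sub_pow_le (qform_nonneg hd.1 φ) (hd.re_qform_le_one hφ) (t * s)
      refine le_trans (le_of_eq ?_) h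
      push_cast
      ring

/-! ### The reduction with real keys and with Haar isometries -/

namespace Forger

variable {n m q : ℕ} (A : Forger n (n + m) q)

/-- The state `C|0^n⟩` for the circuit `C` described by `b`. -/
def target (b : DescWires n A.steps → Bool) : (Fin n → Bool) → ℂ :=
  describedUnitary b *ᵥ Pi.single (fun _ => false) 1

theorem conjTranspose_describedUnitary_mul {s : ℕ} (b : DescWires n s → Bool) :
    (describedUnitary b)ᴴ * describedUnitary b = 1 := by
  rw [describedUnitary_eq]
  exact gmat_conjTranspose_mul _

theorem target_isPure (b : DescWires n A.steps → Bool) : star (A.target b) ⬝ᵥ A.target b = 1 := by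
  rw [target, mulVec_dotProduct_of_isometry (conjTranspose_describedUnitary_mul b)]
  simp

theorem conj_describedUnitary_apply (b : DescWires n A.steps → Bool) (X : Op (Fin n)) :
    ((describedUnitary b)ᴴ * X * describedUnitary b) (fun _ => false) (fun _ => false) =
      qform (A.target b) X := by
  rw [target, ← qform_conj, qform_single]

theorem fresh_iff (r : Fin A.recLen → Bool) (b : DescWires n A.steps → Bool) :
    A.Fresh r b ↔ ∀ i, star (A.msg r i) ⬝ᵥ A.target b = 0 := by
  have : A.target b = fun x => describedUnitary b x fun _ => false := by
    funext x; simp [target]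
  rw [Fresh, this]

variable {V : Matrix (Fin (n + m) → Bool) (Fin n → Bool) ℂ} (r : Fin A.recLen → Bool)

theorem forgedTag_conj_posSemidef (V : Matrix (Fin (n + m) → Bool) (Fin n → Bool) ℂ)
    (b : DescWires n A.steps → Bool) : (A.forgedTag (conj V) r b).PosSemidef :=
  forgedTag_posSemidef (fun _ => conj_posSemidef _ (ketbra_posSemidef _)) b

theorem sum_forgedTag_conj_trace (hV : IsIsometry V) :
    ∑ b, (A.forgedTag (conj V) r b).trace.re = 1 := by
  rw [← Complex.re_sum, sum_forgedTag_trace, Complex.one_re]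
  intro i
  rw [conj_trace hV, ketbra_trace (A.msg_isPure r i)]

theorem prob_reduction_conj (T : ℕ) {σ : Op (Fin n)} (hσ : IsDensity σ) :
    (A.reduction T r σ hσ).prob (conj V) (isometryInverse V) =
      ∑ b, (qform (A.target b) (isometryInverse V (A.forgedTag (conj V) r b))).re *
        (1 - (qform (A.target b) σ).re) ^ T := by
  have h := A.prob_reduction T (conjLin V) (isometryInverseLin V) r σ hσ
  refine Eq.trans h ?_
  rw [Complex.re_sum]
  refine Finset.sum_congr rfl fun b _ => ?_
  rw [conj_describedUnitary_apply, conj_describedUnitary_apply, qform_eq_re hσ.1,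
    ← Complex.ofReal_one, ← Complex.ofReal_sub, ← Complex.ofReal_pow, Complex.re_mul_ofReal]
  rfl

/-- The probability that the adversary wins if the record is `r`. -/
def winProbOf (sign : Chan (Fin n) (Fin (n + m))) (ver : Chan (Fin (n + m)) (Fin n)) : ℝ := by
  classical
  exact ∑ b, if A.Fresh r b then
    (((describedUnitary b)ᴴ * ver (A.forgedTag sign r b) * describedUnitary b)
      (fun _ => false) (fun _ => false)).re else 0

variable {s t : ℕ} {E : Matrix (Fin n → Bool) (Fin s) ℂ}

theorem pow_mem_Icc (S : TestState E t) (b : DescWires n A.steps → Bool) :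
    (1 - (qform (A.target b) S.σ).re) ^ S.T ∈ Set.Icc (0 : ℝ) 1 := by
  have h0 := qform_nonneg S.isDensity.1 (A.target b)
  have h1 := S.isDensity.re_qform_le_one (A.target_isPure b)
  exact ⟨pow_nonneg (by linarith) _, pow_le_one₀ (by linarith) (by linarith)⟩

/-- Fresh descriptions keep their full weight by completeness of the test; all others add
nonnegative terms. -/
theorem winProbOf_le_prob (S : TestState E t)
    (hfresh : ∀ φ, (∀ i, star (A.msg r i) ⬝ᵥ φ = 0) → Eᴴ *ᵥ φ = 0) :
    A.winProbOf r (conj V) (isometryInverse V) ≤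
      (A.reduction S.T r S.σ S.isDensity).prob (conj V) (isometryInverse V) := by
  rw [prob_reduction_conj, winProbOf]
  refine Finset.sum_le_sum fun b _ => ?_
  rw [conj_describedUnitary_apply]
  split_ifs with h
  · rw [S.complete _ (hfresh _ ((A.fresh_iff r b).1 h)), mul_one]
  · exact mul_nonneg (re_qform_isometryInverse_nonneg V (A.forgedTag_conj_posSemidef r V b) _)
      (A.pow_mem_Icc S b).1

theorem continuous_forgedTag (b : DescWires n A.steps → Bool) : Continuous fun U : UGroup (n + m) =>
    A.forgedTag (conj (U.1 * padZero n m)) r b := by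
  have hc : Continuous fun U : UGroup (n + m) => U.1 * padZero n m :=
    continuous_subtype_val.matrix_mul continuous_const
  have h1 : Continuous fun U : UGroup (n + m) => A.afterQueries (conj (U.1 * padZero n m)) r := by
    refine continuous_matrix fun x x' => ?_
    simp only [afterQueries, of_apply]
    refine ((continuous_finsetProd _ fun i _ => ?_).mul continuous_const).mul continuous_const
    exact ((hc.matrix_mul continuous_const).matrix_mul hc.matrix_conjTranspose).matrix_elem _ _
  have h2 : Continuous fun U : UGroup (n + m) =>
      addAnc A.forge.anc (A.afterQueries (conj (U.1 * padZero n m)) r) := by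
    refine continuous_matrix fun x x' => ?_
    simp only [addAnc, of_apply]
    split_ifs
    · exact h1.matrix_elem _ _
    · exact continuous_const
  simp only [forgedTag_eq]
  refine continuous_finsetSum _ fun z _ => ?_
  exact ((continuous_const.matrix_mul h2).matrix_mul continuous_const).matrix_submatrix _ _

/-- The messages lie in the range of `E`, so the forger meets `V` only through `V * E`. This is the
independence that the Haar estimate requires. -/
theorem forgedTag_congr (hmsg : ∀ i, E *ᵥ Eᴴ *ᵥ A.msg r i = A.msg r i)
    (b : DescWires n A.steps → Bool) {V V' : Matrix (Fin (n + m) → Bool) (Fin n → Bool) ℂ}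
    (h : V * E = V' * E) : A.forgedTag (conj V) r b = A.forgedTag (conj V') r b := by
  have h1 : ∀ i, conj V (ketbra (A.msg r i)) = conj V' (ketbra (A.msg r i)) := fun i => by
    rw [conj_ketbra, conj_ketbra, ← hmsg i, mulVec_mulVec, h, ← mulVec_mulVec]
  rw [forgedTag_eq, forgedTag_eq, afterQueries_eq, afterQueries_eq]
  simp only [h1]

/-- For each description, replace the inverse by `V` at the cost `2⁻¹ ^ n`, and split the target
along the range of `E` at the cost of a factor 2. The tests bound the part inside the range by `1 /
t`; the traces of the forged tags sum to one. -/
theorem prob_reduction_le (hE : Eᴴ * E = 1) (ht : 0 < t) (S : TestState E t)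
    (hV : IsIsometry V) :
    (A.reduction S.T r S.σ S.isDensity).prob (conj V) (isometryInverse V) ≤
      2 / t + 2⁻¹ ^ n + 2 * ∑ b, (qform (V *ᵥ (A.target b - E *ᵥ Eᴴ *ᵥ A.target b))
        (A.forgedTag (conj V) r b)).re := by
  have htr : (0 : ℝ) < t := by exact_mod_cast ht
  have hone : 2 / (t : ℝ) + 2⁻¹ ^ n =
      ∑ b, (2 / (t : ℝ) + 2⁻¹ ^ n) * (A.forgedTag (conj V) r b).trace.re := by
    rw [← Finset.mul_sum, A.sum_forgedTag_conj_trace r hV, mul_one]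
  rw [prob_reduction_conj, hone, Finset.mul_sum, ← Finset.sum_add_distrib]
  refine Finset.sum_le_sum fun b _ => ?_
  set X := A.forgedTag (conj V) r b
  have hX : X.PosSemidef := A.forgedTag_conj_posSemidef r V b
  obtain ⟨hw0, hw1⟩ := A.pow_mem_Icc S b
  have hw := S.sound (A.target b) (A.target_isPure b)
  set w := (1 - (qform (A.target b) S.σ).re) ^ S.T
  set φ := A.target b with hφ
  set χ := Eᴴ *ᵥ φ
  have h1 : (qform φ (isometryInverse V X)).re ≤ (qform (V *ᵥ φ) X).re + 2⁻¹ ^ n * X.trace.re := by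
    rw [← qform_conj]
    exact re_qform_isometryInverse_le hV hX (conjTranspose_describedUnitary_mul b) _
  have h2 : (qform (V *ᵥ φ) X).re ≤ 2 * (qform (V *ᵥ E *ᵥ χ) X).re +
      2 * (qform (V *ᵥ (φ - E *ᵥ χ)) X).re := by
    have : V *ᵥ φ = V *ᵥ E *ᵥ χ + V *ᵥ (φ - E *ᵥ χ) := by
      rw [← mulVec_add, add_sub_cancel]
    rw [this]
    exact re_qform_add_le hX _ _
  have h3 : (qform (V *ᵥ E *ᵥ χ) X).re ≤ (star χ ⬝ᵥ χ).re * X.trace.re := by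
    refine (re_qform_le hX _).trans_eq ?_
    rw [mulVec_dotProduct_of_isometry hV, mulVec_dotProduct_of_isometry hE]
  have hx : 0 ≤ X.trace.re := (Complex.le_def.1 hX.trace_nonneg).1
  have h4 : w * (star χ ⬝ᵥ χ).re ≤ 1 / t := by
    rw [le_div_iff₀ htr, mul_comm]; exact hw
  have h5 := qform_nonneg hX (V *ᵥ (φ - E *ᵥ χ))
  have h6 : (0 : ℝ) ≤ 2⁻¹ ^ n := by positivity
  calc (qform φ (isometryInverse V X)).re * w
      ≤ (2 * ((star χ ⬝ᵥ χ).re * X.trace.re) + 2 * (qform (V *ᵥ (φ - E *ᵥ χ)) X).re +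
          2⁻¹ ^ n * X.trace.re) * w := by
        refine mul_le_mul_of_nonneg_right ?_ hw0
        linarith
    _ = 2 * (w * (star χ ⬝ᵥ χ).re) * X.trace.re + w * (2 * (qform (V *ᵥ (φ - E *ᵥ χ)) X).re) +
          w * (2⁻¹ ^ n * X.trace.re) := by ring
    _ ≤ 2 * (1 / t) * X.trace.re + 1 * (2 * (qform (V *ᵥ (φ - E *ᵥ χ)) X).re) +
          1 * (2⁻¹ ^ n * X.trace.re) := by gcongr
    _ = _ := by ring

/-- The remainders are orthogonal to `E` and of norm at most one, so each has average form at most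
`(q + 1) * 2⁻¹ ^ n` times the weight of its description. Doubled and added to the error of the
inverse, this yields `2 * q + 3`. -/
theorem integral_prob_reduction_le (hs : s ≤ q) (hE : Eᴴ * E = 1)
    (hmsg : ∀ i, E *ᵥ Eᴴ *ᵥ A.msg r i = A.msg r i) (ht : 0 < t) (S : TestState E t) :
    ∫ U : UGroup (n + m), (A.reduction S.T r S.σ S.isDensity).prob (conj (U.1 * padZero n m))
      (isometryInverse (U.1 * padZero n m)) ∂haarUnitary (Fin (n + m) → Bool) ≤
        2 / t + (2 * q + 3) * 2⁻¹ ^ n := by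
  have hc : Continuous fun U : UGroup (n + m) => U.1 * padZero n m :=
    continuous_subtype_val.matrix_mul continuous_const
  have hq : ∀ b, Continuous fun U : UGroup (n + m) =>
      (qform ((U.1 * padZero n m) *ᵥ (A.target b - E *ᵥ Eᴴ *ᵥ A.target b))
        (A.forgedTag (conj (U.1 * padZero n m)) r b)).re := by
    intro b
    have h1 : Continuous fun U : UGroup (n + m) =>
        (U.1 * padZero n m) *ᵥ (A.target b - E *ᵥ Eᴴ *ᵥ A.target b) :=
      hc.matrix_mulVec continuous_const
    refine Complex.continuous_re.comp ?_
    unfold qform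
    exact h1.star.dotProduct ((A.continuous_forgedTag r b).matrix_mulVec h1)
  have hint : ∀ b, Integrable (fun U : UGroup (n + m) =>
      (qform ((U.1 * padZero n m) *ᵥ (A.target b - E *ᵥ Eᴴ *ᵥ A.target b))
        (A.forgedTag (conj (U.1 * padZero n m)) r b)).re) (haarUnitary (Fin (n + m) → Bool)) :=
    fun b => integrable_of_continuous (hq b)
  have hint' : Integrable (fun U : UGroup (n + m) => 2 * ∑ b,
      (qform ((U.1 * padZero n m) *ᵥ (A.target b - E *ᵥ Eᴴ *ᵥ A.target b))
        (A.forgedTag (conj (U.1 * padZero n m)) r b)).re) (haarUnitary (Fin (n + m) → Bool)) :=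
    (integrable_finsetSum _ fun b _ => hint b).const_mul 2
  have htrint : ∀ b, Integrable (fun U : UGroup (n + m) =>
      (A.forgedTag (conj (U.1 * padZero n m)) r b).trace.re)
        (haarUnitary (Fin (n + m) → Bool)) := fun b =>
    integrable_of_continuous (Complex.continuous_re.comp
      (A.continuous_forgedTag r b).matrix_trace)
  have horth : ∀ b, Eᴴ *ᵥ (A.target b - E *ᵥ Eᴴ *ᵥ A.target b) = 0 := fun b => by
    rw [mulVec_sub, mulVec_mulVec _ Eᴴ E, hE, one_mulVec, sub_self]
  have hnorm : ∀ b, (star (A.target b - E *ᵥ Eᴴ *ᵥ A.target b) ⬝ᵥ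
      (A.target b - E *ᵥ Eᴴ *ᵥ A.target b)).re ≤ 1 := fun b => by
    set φ := A.target b
    set u := φ - E *ᵥ Eᴴ *ᵥ φ with hu
    have h1 : star (E *ᵥ Eᴴ *ᵥ φ) ⬝ᵥ u = 0 := by
      rw [star_mulVec, ← dotProduct_mulVec, horth b, dotProduct_zero]
    have h2 : star u ⬝ᵥ (E *ᵥ Eᴴ *ᵥ φ) = 0 := by
      rw [star_dotProduct, h1, star_zero]
    have h3 : star φ ⬝ᵥ φ = star u ⬝ᵥ u + star (E *ᵥ Eᴴ *ᵥ φ) ⬝ᵥ (E *ᵥ Eᴴ *ᵥ φ) := by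
      have h4 : φ = u + E *ᵥ Eᴴ *ᵥ φ := by rw [hu, sub_add_cancel]
      conv_lhs => rw [h4]
      rw [star_add, add_dotProduct, dotProduct_add, dotProduct_add, h1, h2, add_zero, zero_add]
    have h5 := congrArg Complex.re h3
    rw [A.target_isPure b, Complex.one_re, Complex.add_re] at h5
    linarith [re_star_dotProduct_self_nonneg (E *ᵥ Eᴴ *ᵥ φ)]
  have hb : ∀ b, ∫ U : UGroup (n + m),
      (qform ((U.1 * padZero n m) *ᵥ (A.target b - E *ᵥ Eᴴ *ᵥ A.target b))
        (A.forgedTag (conj (U.1 * padZero n m)) r b)).re ∂haarUnitary (Fin (n + m) → Bool) ≤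
      (q + 1) * (2 : ℝ)⁻¹ ^ n * ∫ U : UGroup (n + m),
        (A.forgedTag (conj (U.1 * padZero n m)) r b).trace.re
          ∂haarUnitary (Fin (n + m) → Bool) := fun b =>
    integral_qform_orthogonal_le hs hE _ (A.continuous_forgedTag r b)
      (fun U => A.forgedTag_conj_posSemidef r _ b)
      (fun U U' h => A.forgedTag_congr r hmsg b h) (horth b) (hnorm b)
  have hsum : ∑ b, ∫ U : UGroup (n + m), (A.forgedTag (conj (U.1 * padZero n m)) r b).trace.re
      ∂haarUnitary (Fin (n + m) → Bool) = 1 := by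
    rw [← integral_finsetSum _ fun b _ => htrint b]
    simp only [fun U : UGroup (n + m) => A.sum_forgedTag_conj_trace r (isIsometry_mul_padZero U)]
    simp
  calc _ ≤ ∫ U : UGroup (n + m), (2 / (t : ℝ) + 2⁻¹ ^ n + 2 * ∑ b,
        (qform ((U.1 * padZero n m) *ᵥ (A.target b - E *ᵥ Eᴴ *ᵥ A.target b))
          (A.forgedTag (conj (U.1 * padZero n m)) r b)).re)
            ∂haarUnitary (Fin (n + m) → Bool) := by
        -- The consistent unitary in `isometryInverse` is an arbitrary choice, so continuity in `U`
        -- is not evident. Nonnegativity and an integrable upper bound are enough here.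
        refine integral_mono_of_nonneg (Filter.Eventually.of_forall fun U => ?_)
          ((integrable_const _).add hint') (Filter.Eventually.of_forall fun U =>
            A.prob_reduction_le r hE ht S (isIsometry_mul_padZero U))
        change 0 ≤ (A.reduction S.T r S.σ S.isDensity).prob _ _
        rw [prob_reduction_conj]
        exact Finset.sum_nonneg fun b _ => mul_nonneg (re_qform_isometryInverse_nonneg _
          (A.forgedTag_conj_posSemidef r _ b) _) (A.pow_mem_Icc S b).1
    _ = 2 / (t : ℝ) + 2⁻¹ ^ n + 2 * ∑ b, ∫ U : UGroup (n + m),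
        (qform ((U.1 * padZero n m) *ᵥ (A.target b - E *ᵥ Eᴴ *ᵥ A.target b))
          (A.forgedTag (conj (U.1 * padZero n m)) r b)).re
            ∂haarUnitary (Fin (n + m) → Bool) := by
        rw [integral_add (integrable_const _) hint', integral_const_mul,
          integral_finsetSum _ fun b _ => hint b]
        simp
    _ ≤ 2 / (t : ℝ) + 2⁻¹ ^ n + 2 * ((q + 1) * (2 : ℝ)⁻¹ ^ n * 1) := by
        have h := Finset.sum_le_sum fun b (_ : b ∈ Finset.univ) => hb b
        rw [← Finset.mul_sum, hsum] at h
        linarith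
    _ = _ := by ring

end Forger

end

section

open Matrix MeasureTheory

/-! ### Averages over keys -/

theorem keyAvg_mono {κ : ℕ} {f g : (Fin κ → Bool) → ℝ} (h : ∀ k, f k ≤ g k) :
    keyAvg κ f ≤ keyAvg κ g :=
  div_le_div_of_nonneg_right (Finset.sum_le_sum fun k _ => h k) (by positivity)

theorem keyAvg_sum_mul {κ : ℕ} {ι : Type*} [Fintype ι] (p : ι → ℝ) (f : ι → (Fin κ → Bool) → ℝ) :
    keyAvg κ (fun k => ∑ r, p r * f r k) = ∑ r, p r * keyAvg κ (f r) := by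
  simp only [keyAvg]
  rw [Finset.sum_comm, Finset.sum_div]
  exact Finset.sum_congr rfl fun r _ => by rw [← Finset.mul_sum, mul_div_assoc]

theorem exists_sum_mul_le {ι : Type*} [Fintype ι] {p f : ι → ℝ} (hp : ∀ r, 0 ≤ p r)
    (hp1 : ∑ r, p r = 1) : ∃ r, ∑ r, p r * f r ≤ f r := by
  by_contra! h
  set M := ∑ r, p r * f r with hM
  have h1 : ∑ r, p r * (M - f r) = 0 := by
    simp only [mul_sub, Finset.sum_sub_distrib]
    rw [← Finset.sum_mul, hp1, one_mul, ← hM, sub_self]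
  have h2 := (Finset.sum_eq_zero_iff_of_nonneg fun r _ =>
    mul_nonneg (hp r) (sub_nonneg.2 (h r).le)).1 h1
  have h3 : ∀ r, p r = 0 := fun r =>
    (mul_eq_zero.1 (h2 r (Finset.mem_univ r))).resolve_right (sub_pos.2 (h r)).ne'
  simp [h3] at hp1

/-! ### The security reduction -/

section Reduction

variable {n m : ℕ → ℕ} (P : StrongInvertiblePRI n m) {q : ℕ → ℕ}
  (A : ∀ κ, Forger (n κ) (n κ + m κ) (q κ))

/-- The probability that the forger wins against a uniformly random key. -/
def forgeProb (κ : ℕ) : ℝ :=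
  keyAvg κ fun k => (A κ).winProb ((P.F κ).keyed k) ((P.Inv κ).keyed k)

theorem forgeProb_nonneg (κ : ℕ) : 0 ≤ forgeProb P A κ := by
  refine div_nonneg (Finset.sum_nonneg fun k _ => ?_) (by positivity)
  obtain ⟨V, -, hF, hI⟩ := P.functional κ k
  rw [hF, hI]
  refine Finset.sum_nonneg fun r _ => mul_nonneg ((A κ).prob_nonneg r)
    (Finset.sum_nonneg fun b _ => ?_)
  split_ifs
  · rw [(A κ).conj_describedUnitary_apply]
    exact re_qform_isometryInverse_nonneg V ((A κ).forgedTag_conj_posSemidef r V b) _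
  · exact le_rfl

/-- The winning probability is a convex combination over records. The record must be fixed
independently of the key, because the test state in the advice is built from its messages. -/
theorem exists_forgeProb_le (κ : ℕ) : ∃ r, forgeProb P A κ ≤
    keyAvg κ fun k => (A κ).winProbOf r ((P.F κ).keyed k) ((P.Inv κ).keyed k) := by
  have h : forgeProb P A κ = ∑ r, (A κ).prob r * keyAvg κ fun k =>
      (A κ).winProbOf r ((P.F κ).keyed k) ((P.Inv κ).keyed k) := by
    rw [← keyAvg_sum_mul]
    rfl
  rw [h]
  exact exists_sum_mul_le (A κ).prob_nonneg (A κ).prob_sum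

theorem exists_distinguisher {t : ℕ} (ht : 0 < t) (κ : ℕ) :
    ∃ D : Distinguisher (n κ) (m κ),
      D.size ≤ 2 * (A κ).size + q κ + 200 * (t * q κ + 1) * ((A κ).size + (A κ).size + 1) ∧
      forgeProb P A κ ≤
        keyAvg κ (fun k => D.prob ((P.F κ).keyed k) ((P.Inv κ).keyed k)) ∧
      ∫ U : UGroup (n κ + m κ), D.prob (conj (U.1 * padZero (n κ) (m κ)))
        (isometryInverse (U.1 * padZero (n κ) (m κ))) ∂haarUnitary (Fin (n κ + m κ) → Bool) ≤
          2 / t + (2 * q κ + 3) * 2⁻¹ ^ n κ := by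
  obtain ⟨r, hr⟩ := exists_forgeProb_le P A κ
  obtain ⟨s, E, hs, hE, hmsg, hfresh⟩ := exists_orthonormal_columns ((A κ).msg r)
  obtain ⟨S⟩ := exists_testState hE t
  refine ⟨(A κ).reduction S.T r S.σ S.isDensity, ?_, ?_,
    (A κ).integral_prob_reduction_le r hs hE hmsg ht S⟩
  · refine ((A κ).size_reduction_le S.T r S.σ S.isDensity).trans ?_
    have hT : S.T ≤ t * q κ := S.T_le.trans (Nat.mul_le_mul_left t hs)
    -- The forged tag alone has `n κ + m κ` wires, all counted in the size of the forger.
    have hn : n κ ≤ (A κ).size := by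
      simp only [Forger.size, GenCircuit.size, Fintype.card_sum, Fintype.card_fin]
      omega
    gcongr
  · refine hr.trans (keyAvg_mono fun k => ?_)
    obtain ⟨V, -, hF, hI⟩ := P.functional κ k
    rw [hF, hI]
    exact (A κ).winProbOf_le_prob r S hfresh

theorem forgeProb_le (hq : PolyBounded q) (hA : PolyBounded fun κ => (A κ).size) {t : ℕ → ℕ}
    (ht : PolyBounded t) (ht0 : ∀ κ, 0 < t κ) : ∃ ε : ℕ → ℝ, Negligible ε ∧ ∀ κ,
      forgeProb P A κ ≤ ε κ + (2 / t κ + (2 * q κ + 3) * 2⁻¹ ^ n κ) := by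
  choose D hD hreal hhaar using fun κ => exists_distinguisher P A (ht0 κ) κ
  obtain ⟨pq, hpq⟩ := hq
  obtain ⟨pA, hpA⟩ := hA
  obtain ⟨pt, hpt⟩ := ht
  have hsize : PolyBounded fun κ => (D κ).size := by
    refine ⟨2 * pA + pq + 200 * (pt * pq + 1) * (pA + pA + 1), fun κ => (hD κ).trans ?_⟩
    simp only [Polynomial.eval_add, Polynomial.eval_mul, Polynomial.eval_one,
      Polynomial.eval_ofNat]
    have h1 := hpq κ
    have h2 := hpA κ
    have h3 := hpt κ
    gcongr
  obtain ⟨ε, hε, h⟩ := P.secure D hsize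
  refine ⟨ε, hε, fun κ => ?_⟩
  have h1 := (abs_le.1 (h κ)).2
  linarith [hreal κ, hhaar κ]

theorem negligible_polyBounded_mul {f : ℕ → ℕ} (hf : PolyBounded f) {ε : ℕ → ℝ}
    (hε : Negligible ε) : Negligible fun κ => f κ * ε κ := by
  obtain ⟨p, hp⟩ := hf
  have h := hε.polynomial_mul (p.map (Nat.castRingHom ℝ))
  refine Asymptotics.SuperpolynomialDecay.trans_abs_le h fun κ => ?_
  have h1 : (f κ : ℝ) ≤ (p.map (Nat.castRingHom ℝ)).eval (κ : ℝ) := by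
    rw [Polynomial.eval_natCast_map]
    exact Nat.cast_le (α := ℝ).2 (hp κ)
  simp only [abs_mul, Nat.abs_cast]
  exact mul_le_mul_of_nonneg_right (h1.trans (le_abs_self _)) (abs_nonneg _)

/-- `ε` may change with `t`, as each `t` gives another distinguisher. Decay against `κ ^ c` is
tested with `t = κ ^ (c + 1) + 1`: then `κ ^ c * (2 / t) ≤ 2 / κ` for `κ > 0`, and the summand 1
keeps `t` positive at `κ = 0`. -/
theorem negligible_of_forall_le {f : ℕ → ℝ} (hf : ∀ κ, 0 ≤ f κ)
    (h : ∀ t : ℕ → ℕ, PolyBounded t → (∀ κ, 0 < t κ) →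
      ∃ ε : ℕ → ℝ, Negligible ε ∧ ∀ κ, f κ ≤ ε κ + 2 / t κ) : Negligible f := by
  intro c
  obtain ⟨ε, hε, hfε⟩ := h (fun κ => κ ^ (c + 1) + 1) ⟨Polynomial.X ^ (c + 1) + 1, fun κ => by simp⟩
    fun κ => Nat.succ_pos _
  have h1 := (hε c).add ((tendsto_inv_atTop_nhds_zero_nat (𝕜 := ℝ)).const_mul 2)
  rw [mul_zero, add_zero] at h1
  refine tendsto_of_tendsto_of_tendsto_of_le_of_le' tendsto_const_nhds h1
    (Filter.Eventually.of_forall fun κ => mul_nonneg (by positivity) (hf κ)) ?_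
  filter_upwards [Filter.eventually_gt_atTop 0] with κ hκ
  have hκ' : (0 : ℝ) < κ := by exact_mod_cast hκ
  calc (κ : ℝ) ^ c * f κ ≤ (κ : ℝ) ^ c * (ε κ + 2 / ((κ ^ (c + 1) + 1 : ℕ) : ℝ)) :=
        mul_le_mul_of_nonneg_left (hfε κ) (by positivity)
    _ = (κ : ℝ) ^ c * ε κ + 2 * ((κ : ℝ) ^ c / (κ ^ (c + 1) + 1)) := by push_cast; ring
    _ ≤ (κ : ℝ) ^ c * ε κ + 2 * (κ : ℝ)⁻¹ := by
        gcongr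
        rw [div_le_iff₀ (by positivity), pow_succ, mul_add, mul_comm ((κ : ℝ) ^ c),
          inv_mul_cancel_left₀ hκ'.ne']
        linarith [inv_pos.2 hκ']

theorem forgeProb_negligible (hn : Negligible fun κ => (2 : ℝ)⁻¹ ^ n κ) (hq : PolyBounded q)
    (hA : PolyBounded fun κ => (A κ).size) : Negligible (forgeProb P A) := by
  refine negligible_of_forall_le (forgeProb_nonneg P A) fun t ht ht0 => ?_
  obtain ⟨ε, hε, h⟩ := forgeProb_le P A hq hA ht ht0
  obtain ⟨p, hp⟩ := hq
  have h1 : PolyBounded fun κ => 2 * q κ + 3 := ⟨2 * p + 3, fun κ => by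
    simp only [Polynomial.eval_add, Polynomial.eval_mul, Polynomial.eval_ofNat]
    have := hp κ
    gcongr⟩
  refine ⟨_, hε.add (negligible_polyBounded_mul h1 hn), fun κ => ?_⟩
  refine (h κ).trans_eq ?_
  simp only [Pi.add_apply]
  push_cast
  ring

end Reduction

end

end PRIMac

end

theorem mainTheorem11 (n m : ℕ → ℕ) (hn : PRIMac.Negligible fun κ => (2 : ℝ)⁻¹ ^ n κ)
    (P : PRIMac.StrongInvertiblePRI n m) : P.toQMAC.UncomputeUnforgeable :=
  fun _ hq A hA => ⟨PRIMac.forgeProb P A, PRIMac.forgeProb_negligible P A hn hq hA,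
    fun _ => le_rfl⟩
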